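/- Let $(M,g)$ be a smooth Riemannian manifold of dimension $n\ge 4$ with Levi-Civita connection $\nabla$, curvature $R(X,Y,Z,T)=g(\nabla_X\nabla_YZ-\nabla_Y\nabla_XZ-\nabla_{[X,Y]}Z,\,T)$, Ricci tensor $\mathrm{Ric}(X,Y)=\operatorname{trace}(V\mapsto R_{V,X}Y)$, scalar curvature $S$, Schouten tensor $\mathfrak k=\frac1{n-2}\bigl(\mathrm{Ric}-\frac{S}{2(n-1)}g\bigr)$ and Weyl tensor $W=R-g\odot\mathfrak k$, where $(g\odot h)(X,Y,Z,T)=g(X,T)h(Y,Z)+g(Y,Z)h(X,T)-g(X,Z)h(Y,T)-g(Y,T)h(X,Z)$. Write $X^*=g(X,\cdot)$, let $e_1,\dots,e_n$ be $g$-orthonormal, and define: - $\mathcal W$, acting on $(0,2)$ tensors, as the linear extension of $\mathcal W(X^*\otimes Y^*)(Z,T)=W(Y,Z,T,X)$; - $\delta_rA$, the divergence of a covariant tensor $A$ in its $r$-th argument, $\delta_rA=\sum_j(\nabla_{e_j}A)(\dots,e_j,\dots)$; $\delta W=\delta_4W$ and $\delta W_Z(X,Y)=\delta W(X,Y,Z)$;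 - $\mathfrak w(\theta)=\sum_i e_i\llcorner\mathcal W^2(e_i^*\wedge\theta)$ on one-forms $\theta$ (with $\alpha\wedge\beta=\alpha\otimes\beta-\beta\otimes\alpha$), and $\mathfrak w^\#$ its pointwise Moore–Penrose inverse with respect to $g$; - the vector field $\mathbb T$ by $\mathbb T^*=\frac1{n-3}\,\mathfrak w^\#\bigl(\sum_i e_i\llcorner\mathcal W(\delta W_{e_i})\bigr)$; - $C_{\mathbb T}(X,Y,Z)=(\nabla_X\mathfrak k)(Y,Z)-(\nabla_Y\mathfrak k)(X,Z)-W(X,Y,Z,\mathbb T)$; - $E_{\mathbb T}=\mathrm{Ric}-\frac Sn g+(n-2)\bigl(\nabla\mathbb T^*+\mathbb T^*\otimes\mathbb T^*-\frac1n(\operatorname{div}\mathbb T+g(\mathbb T,\mathbb T))g\bigr)$; - $\mathrm{sym}(b)(X,Y)=b(X,Y)+b(Y,X)$. Let $M_{\mathcal E}\subseteq M$ be the set of all points near which the dimension of $\mathcal E_p=\{v\in T_pM: W(v,\cdot,\cdot,\cdot)=0\}$ is locally constant. On $M_{\mathcal E}$ define the generalized Bach tensor $$B_{\mathbb T}=\delta_1\delta_4W+\tfrac{n-3}{n-2}\mathcal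 W(\mathrm{Ric})-\tfrac{n-4}{n-2}\mathcal W(\mathrm{sym}(E_{\mathbb T}))-(n-3)(n-4)\bigl[\mathcal W(\mathbb T^*\otimes\mathbb T^*)+\mathrm{sym}(C_{\mathbb T}(\mathbb T,\cdot,\cdot))\bigr].$$ **Proposition.** $\mathbb T$ and $B_{\mathbb T}$ are smooth on $M_{\mathcal E}$, and $B_{\mathbb T}$ is conformally invariant of weight $1$ there: if $\psi:M\to(0,\infty)$ is smooth and $\bar g=\psi^{-2}g$, then $\bar g$ has the same set $M_{\mathcal E}$, and on it $\bar B_{\bar{\mathbb T}}=\psi^2B_{\mathbb T}$, where the bars denote the objects formed with $\bar g$. If $n=4$, then $B_{\mathbb T}$ equals the classical Bach tensor $\delta_1\delta_4W+\frac12\mathcal W(\mathrm{Ric})$. (All tensors are evaluated through their components in an arbitrary chart of the maximal smooth atlas.) -/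

import Mathlib

open scoped Manifold ContDiff Topology
open Bundle

noncomputable section

namespace ConformalBach

/-! ### Tensor calculus in coordinates

Tensor fields on (an open piece of) `ℝⁿ` are given by their component functions. `G` is the matrix
of components `g_{ij}` of a Riemannian metric. A trace over a `g`-orthonormal basis is written as a
contraction with the inverse matrix `g^{ij}`. -/

/-- The coordinate space `ℝⁿ`. -/
abbrev Coord (n : ℕ) : Type := EuclideanSpace ℝ (Fin n)

section Coordinates

variable {n : ℕ}

/-- The partial derivative `∂_i f`. -/
def pd (i : Fin n) (f : Coord n → ℝ) (x : Coord n) : ℝ :=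
  fderiv ℝ f x (EuclideanSpace.single i 1)

/-- The components `g^{ij}` of the inverse metric. -/
def ginv (G : Coord n → Matrix (Fin n) (Fin n) ℝ) (x : Coord n) (i j : Fin n) : ℝ :=
  (G x)⁻¹ i j

/-- The Christoffel symbols `Γ^k_{ij}` of the Levi-Civita connection:
`∇_{∂_i} ∂_j = Σ_k Γ^k_{ij} ∂_k`. -/
def christoffel (G : Coord n → Matrix (Fin n) (Fin n) ℝ) (x : Coord n) (k i j : Fin n) : ℝ :=
  (1 / 2) * ∑ l, ginv G x k l *
    (pd i (fun y => G y j l) x + pd j (fun y => G y i l) x - pd l (fun y => G y i j) x)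

/-! Covariant derivatives of `(0,s)` tensor fields for `s = 1, 2, 3, 4`; the first index is the
direction of differentiation. -/

/-- `(∇_{∂_j} A)_a`. -/
def covD1 (G : Coord n → Matrix (Fin n) (Fin n) ℝ) (A : Coord n → Fin n → ℝ)
    (x : Coord n) (j a : Fin n) : ℝ :=
  pd j (fun y => A y a) x - ∑ m, christoffel G x m j a * A x m

/-- `(∇_{∂_j} A)_{ab}`. -/
def covD2 (G : Coord n → Matrix (Fin n) (Fin n) ℝ) (A : Coord n → Fin n → Fin n → ℝ)
    (x : Coord n) (j a b : Fin n) : ℝ :=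
  pd j (fun y => A y a b) x
    - ∑ m, christoffel G x m j a * A x m b
    - ∑ m, christoffel G x m j b * A x a m

/-- `(∇_{∂_j} A)_{abc}`. -/
def covD3 (G : Coord n → Matrix (Fin n) (Fin n) ℝ) (A : Coord n → Fin n → Fin n → Fin n → ℝ)
    (x : Coord n) (j a b c : Fin n) : ℝ :=
  pd j (fun y => A y a b c) x
    - ∑ m, christoffel G x m j a * A x m b c
    - ∑ m, christoffel G x m j b * A x a m c
    - ∑ m, christoffel G x m j c * A x a b m

/-- `(∇_{∂_j} A)_{abcd}`. -/
def covD4 (G : Coord n → Matrix (Fin n) (Fin n) ℝ)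
    (A : Coord n → Fin n → Fin n → Fin n → Fin n → ℝ)
    (x : Coord n) (j a b c d : Fin n) : ℝ :=
  pd j (fun y => A y a b c d) x
    - ∑ m, christoffel G x m j a * A x m b c d
    - ∑ m, christoffel G x m j b * A x a m c d
    - ∑ m, christoffel G x m j c * A x a b m d
    - ∑ m, christoffel G x m j d * A x a b c m

/-- The curvature `R_{∂_i,∂_j} ∂_k = Σ_l (riemannUp l i j k) ∂_l`, where
`R_{X,Y} = ∇_X ∇_Y - ∇_Y ∇_X - ∇_{[X,Y]}`. -/
def riemannUp (G : Coord n → Matrix (Fin n) (Fin n) ℝ) (x : Coord n) (l i j k : Fin n) : ℝ :=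
  pd i (fun y => christoffel G y l j k) x - pd j (fun y => christoffel G y l i k) x
    + ∑ m, (christoffel G x l i m * christoffel G x m j k
      - christoffel G x l j m * christoffel G x m i k)

/-- The Riemannian curvature tensor `R(X,Y,Z,T) = g(R_{X,Y} Z, T)`. -/
def riemann (G : Coord n → Matrix (Fin n) (Fin n) ℝ) (x : Coord n) (i j k l : Fin n) : ℝ :=
  ∑ m, G x m l * riemannUp G x m i j k

/-- The Ricci tensor `Ric(X,Y) = trace (V ↦ R_{V,X} Y)`. -/
def ricci (G : Coord n → Matrix (Fin n) (Fin n) ℝ) (x : Coord n) (i j : Fin n) : ℝ :=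
  ∑ a, riemannUp G x a a i j

/-- The scalar curvature. -/
def scal (G : Coord n → Matrix (Fin n) (Fin n) ℝ) (x : Coord n) : ℝ :=
  ∑ i, ∑ j, ginv G x i j * ricci G x i j

/-- The Schouten tensor `(Ric - S g / (2 (n-1))) / (n-2)`. -/
def schouten (G : Coord n → Matrix (Fin n) (Fin n) ℝ) (x : Coord n) (i j : Fin n) : ℝ :=
  1 / ((n : ℝ) - 2) * (ricci G x i j - 1 / (2 * ((n : ℝ) - 1)) * scal G x * G x i j)

/-- The Kulkarni-Nomizu product `(g ⊙ h)(X,Y,Z,T) =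
g(X,T) h(Y,Z) + g(Y,Z) h(X,T) - g(X,Z) h(Y,T) - g(Y,T) h(X,Z)`. -/
def kulkarniNomizu (g h : Fin n → Fin n → ℝ) (i j k l : Fin n) : ℝ :=
  g i l * h j k + g j k * h i l - g i k * h j l - g j l * h i k

/-- The Weyl tensor `W = R - g ⊙ (Schouten tensor)`. -/
def weyl (G : Coord n → Matrix (Fin n) (Fin n) ℝ) (x : Coord n) (i j k l : Fin n) : ℝ :=
  riemann G x i j k l - kulkarniNomizu (fun a b => G x a b) (schouten G x) i j k l

/-- The action of the Weyl tensor on `(0,2)` tensors, the linear extension of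
`𝒲(X* ⊗ Y*)(Z,T) = W(Y,Z,T,X)`. -/
def weylOp (G : Coord n → Matrix (Fin n) (Fin n) ℝ) (x : Coord n) (b : Fin n → Fin n → ℝ)
    (k l : Fin n) : ℝ :=
  ∑ p, ∑ q, b p q * ∑ c, ∑ d, ginv G x p c * ginv G x q d * weyl G x d k l c

/-- The subspace `{v | W(v,·,·,·) = 0}` at the point `x`. -/
def weylNull (G : Coord n → Matrix (Fin n) (Fin n) ℝ) (x : Coord n) :
    Submodule ℝ (Fin n → ℝ) where
  carrier := {v | ∀ j k l, ∑ i, v i * weyl G x i j k l = 0}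
  add_mem' := by
    intro v w hv hw j k l
    have h1 := hv j k l
    have h2 := hw j k l
    simp only [Pi.add_apply, add_mul, Finset.sum_add_distrib, h1, h2, add_zero]
  zero_mem' := by
    intro j k l
    simp
  smul_mem' := by
    intro c v hv j k l
    have h1 := hv j k l
    simp only [Pi.smul_apply, smul_eq_mul, mul_assoc, ← Finset.mul_sum, h1, mul_zero]

/-- The divergence `δW = δ₄W`, `δ₄W(X,Y,Z) = Σ_j (∇_{e_j} W)(X,Y,Z,e_j)`. -/
def divWeyl (G : Coord n → Matrix (Fin n) (Fin n) ℝ) (x : Coord n) (a b c : Fin n) : ℝ :=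
  ∑ i, ∑ j, ginv G x i j * covD4 G (weyl G) x i a b c j

/-- The double divergence `δ₁δ₄W`, `δ₁A(X,Y) = Σ_j (∇_{e_j} A)(e_j,X,Y)`. -/
def divDivWeyl (G : Coord n → Matrix (Fin n) (Fin n) ℝ) (x : Coord n) (a b : Fin n) : ℝ :=
  ∑ i, ∑ j, ginv G x i j * covD3 G (divWeyl G) x i j a b

/-- The wedge product of one-forms, `α ∧ β = α ⊗ β - β ⊗ α`. -/
def wedge (α β : Fin n → ℝ) (a b : Fin n) : ℝ := α a * β b - β a * α b

/-- The negative Ricci contraction of `𝒲²`, acting on one-forms: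
`𝔴(θ) = Σ_i ∂_i ⌟ 𝒲²(dx^i ∧ θ)`. The matrix entry `(b, c)` is the `b`-th component of
`𝔴(dx^c)`. -/
def ricciWeylSq (G : Coord n → Matrix (Fin n) (Fin n) ℝ) (x : Coord n) :
    Matrix (Fin n) (Fin n) ℝ :=
  Matrix.of fun b c =>
    ∑ i, weylOp G x (weylOp G x (wedge (Pi.single i 1) (Pi.single c 1))) i b

/-- `B` is the Moore-Penrose inverse of `A` with respect to the inner product with Gram matrix
`H`: `ABA = A`, `BAB = B`, and `AB` and `BA` are symmetric for that inner product. -/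
def IsMoorePenrose (H A B : Matrix (Fin n) (Fin n) ℝ) : Prop :=
  A * B * A = A ∧ B * A * B = B ∧
    (A * B).transpose * H = H * (A * B) ∧ (B * A).transpose * H = H * (B * A)

/-- The Moore-Penrose inverse (it exists and is unique for positive definite `H`). -/
def moorePenrose (H A : Matrix (Fin n) (Fin n) ℝ) : Matrix (Fin n) (Fin n) ℝ :=
  Classical.epsilon (IsMoorePenrose H A)

/-- The one-form `Σ_i e_i ⌟ 𝒲(δW_{e_i})`, where `δW_Z(X,Y) = δW(X,Y,Z)`. -/
def weylDivForm (G : Coord n → Matrix (Fin n) (Fin n) ℝ) (x : Coord n) (b : Fin n) : ℝ :=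
  ∑ i, ∑ j, ginv G x i j * weylOp G x (fun a c => divWeyl G x a c j) i b

/-- The one-form `𝕋* = g(𝕋,·) = (1/(n-3)) 𝔴^# (Σ_i e_i ⌟ 𝒲(δW_{e_i}))`. The Moore-Penrose inverse
is taken with respect to the inner product `g^{ij}` on one-forms. -/
def tForm (G : Coord n → Matrix (Fin n) (Fin n) ℝ) (x : Coord n) (a : Fin n) : ℝ :=
  1 / ((n : ℝ) - 3) *
    ∑ b, moorePenrose (G x)⁻¹ (ricciWeylSq G x) a b * weylDivForm G x b

/-- The vector field `𝕋`. -/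
def tVec (G : Coord n → Matrix (Fin n) (Fin n) ℝ) (x : Coord n) (a : Fin n) : ℝ :=
  ∑ b, ginv G x a b * tForm G x b

/-- The tensor `C_𝕋 = d^∇ (Schouten tensor) - W(·,·,·,𝕋)`, where
`d^∇ b(X,Y,Z) = (∇_X b)(Y,Z) - (∇_Y b)(X,Z)`. -/
def cottonT (G : Coord n → Matrix (Fin n) (Fin n) ℝ) (x : Coord n) (a b c : Fin n) : ℝ :=
  covD2 G (schouten G) x a b c - covD2 G (schouten G) x b a c
    - ∑ d, weyl G x a b c d * tVec G x d

/-- The divergence `div 𝕋`. -/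
def divT (G : Coord n → Matrix (Fin n) (Fin n) ℝ) (x : Coord n) : ℝ :=
  ∑ i, ∑ j, ginv G x i j * covD1 G (tForm G) x i j

/-- The squared norm `g(𝕋,𝕋)`. -/
def normSqT (G : Coord n → Matrix (Fin n) (Fin n) ℝ) (x : Coord n) : ℝ :=
  ∑ i, ∑ j, G x i j * tVec G x i * tVec G x j

/-- The conformal Ricci tensor
`E_𝕋 = Ric - (S/n) g + (n-2) (∇𝕋* + 𝕋* ⊗ 𝕋* - (1/n) (div 𝕋 + g(𝕋,𝕋)) g)`. -/
def confRicciT (G : Coord n → Matrix (Fin n) (Fin n) ℝ) (x : Coord n) (i j : Fin n) : ℝ :=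
  ricci G x i j - scal G x / n * G x i j
    + ((n : ℝ) - 2) * (covD1 G (tForm G) x i j + tForm G x i * tForm G x j
      - 1 / n * (divT G x + normSqT G x) * G x i j)

/-- The symmetrization `sym(b)(X,Y) = b(X,Y) + b(Y,X)`. -/
def sym (b : Fin n → Fin n → ℝ) (i j : Fin n) : ℝ := b i j + b j i

/-- The components of the generalized Bach tensor `B_𝕋`. -/
def genBach (G : Coord n → Matrix (Fin n) (Fin n) ℝ) (x : Coord n) (i j : Fin n) : ℝ :=
  divDivWeyl G x i j
    + ((n : ℝ) - 3) / ((n : ℝ) - 2) * weylOp G x (ricci G x) i j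
    - ((n : ℝ) - 4) / ((n : ℝ) - 2) * weylOp G x (sym (confRicciT G x)) i j
    - ((n : ℝ) - 3) * ((n : ℝ) - 4) *
      (weylOp G x (fun a b => tForm G x a * tForm G x b) i j
        + sym (fun a b => ∑ d, tVec G x d * cottonT G x d a b) i j)

/-- The components of the classical Bach tensor `δ₁δ₄W + (1/2) 𝒲(Ric)`. -/
def classicalBach (G : Coord n → Matrix (Fin n) (Fin n) ℝ) (x : Coord n) (i j : Fin n) : ℝ :=
  divDivWeyl G x i j + 1 / 2 * weylOp G x (ricci G x) i j

end Coordinates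

/-! ### Riemannian manifolds -/

section Manifold

variable {n : ℕ} {M : Type*} [TopologicalSpace M] [ChartedSpace (Coord n) M]
  [IsManifold (𝓡 n) ∞ M]

/-- Smooth Riemannian metrics on the `n`-dimensional manifold `M`. -/
abbrev RMetric (n : ℕ) (M : Type*) [TopologicalSpace M] [ChartedSpace (Coord n) M]
    [IsManifold (𝓡 n) ∞ M] : Type _ :=
  ContMDiffRiemannianMetric (𝓡 n) ∞ (Coord n) (fun p : M => TangentSpace (𝓡 n) p)

/-- The components `g_{ij} = g(∂_i, ∂_j)` of the metric in the chart `e`. -/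
def metricInChart (g : RMetric n M) (e : OpenPartialHomeomorph M (Coord n)) (x : Coord n) :
    Matrix (Fin n) (Fin n) ℝ :=
  Matrix.of fun i j =>
    g.inner (e.symm x)
      (mfderiv (𝓡 n) (𝓡 n) e.symm x (EuclideanSpace.single i (1 : ℝ) : Coord n))
      (mfderiv (𝓡 n) (𝓡 n) e.symm x (EuclideanSpace.single j (1 : ℝ) : Coord n))

/-- The components of a tangent vector `v ∈ T_pM` in the chart `e`. -/
def vecInChart (e : OpenPartialHomeomorph M (Coord n)) (p : M) (v : TangentSpace (𝓡 n) p) :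
    Coord n :=
  mfderiv (𝓡 n) (𝓡 n) e p v

/-- The value at `v, w ∈ T_pM` of the `(0,2)` tensor at `p` with components `b` in the
chart `e`. -/
def evalInChart (e : OpenPartialHomeomorph M (Coord n)) (p : M) (b : Fin n → Fin n → ℝ)
    (v w : TangentSpace (𝓡 n) p) : ℝ :=
  ∑ i, ∑ j, b i j * vecInChart e p v i * vecInChart e p w j

/-- The part inside the domain of the chart `e` of the set `M_𝓔` of all points at which the rank
of `𝓔_p = {v ∈ T_pM | W(v,·,·,·) = 0}` is locally constant. -/
def constRankSet (g : RMetric n M) (e : OpenPartialHomeomorph M (Coord n)) : Set M :=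
  {p | p ∈ e.source ∧ ∀ᶠ q in 𝓝 p,
    Module.finrank ℝ (weylNull (metricInChart g e) (e q)) =
      Module.finrank ℝ (weylNull (metricInChart g e) (e p))}

/-- The generalized Bach tensor `B_𝕋` of `g` as a bilinear form on `T_pM`, computed in the
chart `e`. -/
def genBachAt (g : RMetric n M) (e : OpenPartialHomeomorph M (Coord n)) (p : M)
    (v w : TangentSpace (𝓡 n) p) : ℝ :=
  evalInChart e p (genBach (metricInChart g e) (e p)) v w

/-- The classical Bach tensor of `g` as a bilinear form on `T_pM`, computed in the chart `e`. -/
def classicalBachAt (g : RMetric n M) (e : OpenPartialHomeomorph M (Coord n)) (p : M)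
    (v w : TangentSpace (𝓡 n) p) : ℝ :=
  evalInChart e p (classicalBach (metricInChart g e) (e p)) v w

end Manifold

end ConformalBach

end

noncomputable section

namespace ConformalBach

open TopologicalSpace (Opens)

/-! ### Tensor calculus over a commutative ring with commuting derivations -/

/-! Write $f = d\log\psi$ and $W(u)$ for $W(\cdot,\cdot,\cdot,u^\#)$. Under $\bar g = \psi^{-2}g$
the (1,3) Weyl tensor is unchanged (`conf_weylUp`), the Schouten tensor gains $\nabla f + f\otimes f
- \frac12|f|^2 g$ (`conf_sch`), and $\delta W$ loses $(n-3)W(f)$ (`conf_divWeyl`). A one-form $t$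
that transformed exactly by $t \mapsto t - f$ would therefore make $C_t$ invariant and would
compensate the terms in $f$ produced by $\delta_1\delta_4W$ and by $\mathcal W(\mathrm{Ric})$.

The form $\mathbb T^*$ does this up to an error that $W$ cannot see. By the first Bianchi identity
$2\langle\mathfrak w\theta,\eta\rangle = \langle W(\theta),W(\eta)\rangle$ (`two_mul_sum_wsq`), so
$\mathfrak w$ is self-adjoint and its kernel is the null space of $W$. Since $\bar{\mathfrak w} =
\psi^4\mathfrak w$ and the one-form to which $\mathfrak w^\#$ is applied changes by $-(n-3)\mathfrak
w(f)$ up to the same factor $\psi^4$ (`conf_weylDivForm`), $\bar{\mathbb T}^* = \mathbb T^* -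
\mathfrak w^\#\mathfrak w f = \mathbb T^* - f + u$ with $W(u)=0$. All algebraic terms in $u$ vanish.
Differentiating $W(u)=0$ gives $\mathcal W(\nabla u) = -\delta W(u^\#,\cdot,\cdot)$
(`wOp_cov1_of_null`), and this cancels against $(n-3)C_{\mathbb T}(u^\#,\cdot,\cdot) = \delta
W(u^\#,\cdot,\cdot)$. The cancellation is `conf_genBach`.

For smoothness, if $L$ is any generalized inverse of $\mathfrak w^3$, then $\mathfrak w^\# =
\mathfrak w L\mathfrak w$ (`moorePenrose_eq_of_reg`). Where the rank is locally constant, $L =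
(\mathfrak w^3+Q)^{-1}$ works with one constant matrix $Q$ (`mul_inv_mul_of_finrank`), so $\mathfrak
w^\#$ is smooth.

The tensor identities are proved over an arbitrary commutative $\mathbb R$-algebra with commuting
derivations, where they are polynomial identities with no differentiability side conditions. They
are then specialised to the smooth functions on an open set of $\mathbb R^n$; `Rep` and `RepMetric`
tie the two settings together. -/

/-- A metric with coefficients in a commutative algebra `A` that carries `n` commuting derivations:
a symmetric matrix `G` with its symmetric inverse `H`. -/
structure AlgMetric (n : ℕ) (A : Type*) [CommRing A] [Algebra ℝ A] where
  /-- the partial derivatives -/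
  d : Fin n → Derivation ℝ A A
  d_comm : ∀ i j a, d i (d j a) = d j (d i a)
  /-- the metric -/
  G : Fin n → Fin n → A
  /-- the inverse metric -/
  H : Fin n → Fin n → A
  G_symm : ∀ i j, G i j = G j i
  H_symm : ∀ i j, H i j = H j i
  G_mul_H : ∀ i j, ∑ k, G i k * H k j = if i = j then 1 else 0

namespace AlgMetric

variable {n : ℕ} {A : Type*} [CommRing A] [Algebra ℝ A] (g : AlgMetric n A)

theorem H_mul_G (i j : Fin n) : ∑ k, g.H i k * g.G k j = if i = j then 1 else 0 := by
  have h := g.G_mul_H j i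
  rw [show (∑ k, g.H i k * g.G k j) = ∑ k, g.G j k * g.H k i from
    Finset.sum_congr rfl fun k _ => by rw [g.H_symm i k, g.G_symm k j, mul_comm], h]
  simp [eq_comm]

/-- Raising an index. -/
def up (X : Fin n → A) (m : Fin n) : A := ∑ l, g.H m l * X l

/-- Lowering an index. -/
def low (X : Fin n → A) (m : Fin n) : A := ∑ l, g.G m l * X l

theorem low_up (X : Fin n → A) (j : Fin n) : g.low (g.up X) j = X j := by
  simp only [low, up, Finset.mul_sum]
  rw [Finset.sum_comm]
  simp only [← mul_assoc, ← Finset.sum_mul, g.G_mul_H]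
  simp

theorem up_low (X : Fin n → A) (j : Fin n) : g.up (g.low X) j = X j := by
  simp only [low, up, Finset.mul_sum]
  rw [Finset.sum_comm]
  simp only [← mul_assoc, ← Finset.sum_mul, g.H_mul_G]
  simp

theorem up_G (j m : Fin n) : g.up (fun l => g.G l j) m = if m = j then 1 else 0 :=
  g.H_mul_G m j

theorem up_add (X Y : Fin n → A) (m : Fin n) :
    g.up (fun i => X i + Y i) m = g.up X m + g.up Y m := by
  simp only [up, mul_add, Finset.sum_add_distrib]

theorem up_sub (X Y : Fin n → A) (m : Fin n) :
    g.up (fun i => X i - Y i) m = g.up X m - g.up Y m := by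
  simp only [up, mul_sub, Finset.sum_sub_distrib]

theorem up_mul (c : A) (X : Fin n → A) (m : Fin n) :
    g.up (fun i => c * X i) m = c * g.up X m := by
  simp only [up, Finset.mul_sum]
  exact Finset.sum_congr rfl fun _ _ => by ring

theorem up_mul_right (c : A) (X : Fin n → A) (m : Fin n) :
    g.up (fun i => X i * c) m = g.up X m * c := by
  simp only [up, Finset.sum_mul]
  exact Finset.sum_congr rfl fun _ _ => by ring

theorem up_sum {ι : Type*} (s : Finset ι) (X : ι → Fin n → A) (m : Fin n) :
    g.up (fun i => ∑ k ∈ s, X k i) m = ∑ k ∈ s, g.up (X k) m := by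
  simp only [up, Finset.mul_sum]
  exact Finset.sum_comm

theorem sum_up_mul (X Y : Fin n → A) : ∑ m, g.up X m * Y m = ∑ m, X m * g.up Y m := by
  simp only [up, Finset.sum_mul, Finset.mul_sum]
  rw [Finset.sum_comm]
  exact Finset.sum_congr rfl fun _ _ => Finset.sum_congr rfl fun _ _ => by
    rw [g.H_symm]; ring

/-- The metric trace of a bilinear form. -/
def tr (B : Fin n → Fin n → A) : A := ∑ i, ∑ j, g.H i j * B i j

theorem tr_add (B C : Fin n → Fin n → A) :
    g.tr (fun i j => B i j + C i j) = g.tr B + g.tr C := by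
  simp only [tr, mul_add, Finset.sum_add_distrib]

theorem tr_sub (B C : Fin n → Fin n → A) :
    g.tr (fun i j => B i j - C i j) = g.tr B - g.tr C := by
  simp only [tr, mul_sub, Finset.sum_sub_distrib]

theorem tr_mul (c : A) (B : Fin n → Fin n → A) :
    g.tr (fun i j => c * B i j) = c * g.tr B := by
  simp only [tr, Finset.mul_sum]
  exact Finset.sum_congr rfl fun _ _ => Finset.sum_congr rfl fun _ _ => by ring

theorem tr_sum {ι : Type*} (s : Finset ι) (B : ι → Fin n → Fin n → A) :
    g.tr (fun i j => ∑ k ∈ s, B k i j) = ∑ k ∈ s, g.tr (B k) := by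
  simp only [tr, Finset.mul_sum]
  rw [Finset.sum_congr rfl fun i _ => Finset.sum_comm, Finset.sum_comm]

theorem tr_swap (B : Fin n → Fin n → A) : g.tr (fun i j => B j i) = g.tr B := by
  simp only [tr]
  rw [Finset.sum_comm]
  exact Finset.sum_congr rfl fun _ _ => Finset.sum_congr rfl fun _ _ => by rw [g.H_symm]

theorem tr_eq_sum_up (B : Fin n → Fin n → A) : g.tr B = ∑ i, g.up (B i) i := rfl

theorem tr_eq_sum_up' (B : Fin n → Fin n → A) :
    g.tr B = ∑ j, g.up (fun i => B i j) j := by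
  rw [← tr_swap]; rfl

theorem tr_G : g.tr g.G = n := by
  simp [tr_eq_sum_up', up_G]

theorem tr_G_left (X : Fin n → A) (a : Fin n) : g.tr (fun i j => g.G i a * X j) = X a := by
  rw [tr_eq_sum_up']
  simp [up_mul_right, up_G]

theorem tr_G_right (X : Fin n → A) (a : Fin n) : g.tr (fun i j => g.G j a * X i) = X a := by
  rw [g.tr_swap (fun i j => g.G i a * X j), tr_G_left]

/-- The trace equals its own negative, and 2 is invertible because `A` is an $\mathbb R$-algebra. -/
theorem tr_antisymm_of (B : Fin n → Fin n → A) (h : ∀ i j, B i j = -B j i) : g.tr B = 0 := by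
  have h1 : g.tr B = - g.tr B := by
    conv_lhs => rw [← tr_swap]
    rw [show (fun i j => B j i) = fun i j => (-1 : A) * B i j from by
      funext i j; rw [h j i]; ring, tr_mul]; ring
  have h2 : (2 : A) * g.tr B = 0 := by linear_combination h1
  have h3 : algebraMap ℝ A (1 / 2) * 2 = 1 := by
    rw [← map_ofNat (algebraMap ℝ A) 2, ← map_mul]; norm_num
  linear_combination algebraMap ℝ A (1 / 2) * h2 - g.tr B * h3

/-! #### The Levi-Civita connection -/

/-- The Christoffel symbols of the first kind. -/
def gam (l i j : Fin n) : A :=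
  algebraMap ℝ A (1 / 2) * (g.d i (g.G j l) + g.d j (g.G i l) - g.d l (g.G i j))

/-- The Christoffel symbols. -/
def chr (k i j : Fin n) : A := g.up (fun l => g.gam l i j) k

theorem half_add_half : algebraMap ℝ A (1 / 2) + algebraMap ℝ A (1 / 2) = 1 := by
  rw [← map_add]; norm_num

theorem gam_symm (l i j : Fin n) : g.gam l i j = g.gam l j i := by
  simp only [gam, g.G_symm i j]; ring

theorem chr_symm (k i j : Fin n) : g.chr k i j = g.chr k j i := by
  simp only [chr, g.gam_symm _ i j]

theorem gam_add (i k l : Fin n) : g.gam l i k + g.gam k i l = g.d i (g.G k l) := by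
  simp only [gam, g.G_symm l k, g.G_symm i k, g.G_symm i l]
  linear_combination (g.d i (g.G k l)) * half_add_half (A := A)

theorem low_chr (l i j : Fin n) : g.low (fun m => g.chr m i j) l = g.gam l i j :=
  g.low_up _ _

theorem sum_chr_mul_G (i j l : Fin n) : ∑ m, g.chr m i j * g.G m l = g.gam l i j := by
  rw [← low_chr, low]
  exact Finset.sum_congr rfl fun _ _ => by rw [g.G_symm l, mul_comm]

theorem sum_chr_mul_G' (i j l : Fin n) : ∑ m, g.chr m i j * g.G l m = g.gam l i j := by
  rw [← low_chr, low]
  exact Finset.sum_congr rfl fun _ _ => by rw [mul_comm]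

theorem d_G (i k l : Fin n) :
    g.d i (g.G k l) = ∑ m, g.chr m i k * g.G m l + ∑ m, g.chr m i l * g.G k m := by
  rw [sum_chr_mul_G, sum_chr_mul_G', gam_add]

/-- Metric compatibility for a vector field: lowering an index commutes with $\nabla$, with the
Christoffel terms written out. -/
theorem d_low (i l : Fin n) (X : Fin n → A) :
    g.d i (g.low X l) = g.low (fun m => g.d i (X m) + ∑ q, g.chr m i q * X q) l
      + ∑ q, g.chr q i l * g.low X q := by
  have h1 : g.d i (g.low X l) = ∑ m, (g.d i (g.G l m) * X m + g.G l m * g.d i (X m)) := by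
    simp only [low, map_sum, Derivation.leibniz, smul_eq_mul]
    exact Finset.sum_congr rfl fun _ _ => by ring
  have h2 : g.low (fun m => g.d i (X m) + ∑ q, g.chr m i q * X q) l
      = ∑ m, g.G l m * g.d i (X m) + ∑ q, g.gam l i q * X q := by
    simp only [low, mul_add, Finset.sum_add_distrib, Finset.mul_sum]
    congr 1
    rw [Finset.sum_comm]
    simp only [← sum_chr_mul_G', Finset.sum_mul]
    exact Finset.sum_congr rfl fun _ _ => Finset.sum_congr rfl fun _ _ => by ring
  have h3 : ∑ q, g.chr q i l * g.low X q = ∑ q, g.gam q i l * X q := by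
    simp only [low, Finset.mul_sum]
    rw [Finset.sum_comm]
    simp only [← sum_chr_mul_G, Finset.sum_mul]
    exact Finset.sum_congr rfl fun _ _ => Finset.sum_congr rfl fun _ _ => by ring
  have h4 : ∑ q, g.gam l i q * X q + ∑ q, g.gam q i l * X q = ∑ q, g.d i (g.G l q) * X q := by
    rw [← Finset.sum_add_distrib]
    exact Finset.sum_congr rfl fun _ _ => by rw [← gam_add]; ring
  rw [h1, h2, h3, Finset.sum_add_distrib]
  linear_combination -h4

theorem d_up (i l : Fin n) (X : Fin n → A) :
    g.d i (g.up X l) = g.up (fun m => g.d i (X m) - ∑ q, g.chr q i m * X q) l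
      - ∑ q, g.chr l i q * g.up X q := by
  have h := fun m => g.d_low i m (g.up X)
  simp only [low_up] at h
  have h2 : (fun m => g.d i (X m) - ∑ q, g.chr q i m * X q) =
      fun m => g.low (fun m => g.d i (g.up X m) + ∑ q, g.chr m i q * g.up X q) m := by
    funext m; rw [h m]; ring
  rw [h2, up_low]; ring

theorem d_tr (i : Fin n) (B : Fin n → Fin n → A) :
    g.d i (g.tr B) = g.tr fun k m => g.d i (B k m) - ∑ q, g.chr q i k * B q m
      - ∑ q, g.chr q i m * B k q := by
  rw [tr_sub, tr_eq_sum_up, map_sum, tr_sub]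
  simp only [d_up, Finset.sum_sub_distrib]
  rw [show (∑ x, g.up (fun m => g.d i (B x m) - ∑ q, g.chr q i m * B x q) x)
    = g.tr (fun k m => g.d i (B k m) - ∑ q, g.chr q i m * B k q) from rfl, tr_sub]
  have : (∑ x, ∑ q, g.chr x i q * g.up (B x) q) =
      g.tr (fun k m => ∑ q, g.chr q i k * B q m) := by
    rw [tr_eq_sum_up, Finset.sum_comm]
    refine Finset.sum_congr rfl fun m _ => ?_
    rw [up_sum]
    exact Finset.sum_congr rfl fun m _ => by rw [up_mul]
  rw [this]; ring

/-- The covariant derivative of a one-form. -/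
def cov1 (B : Fin n → A) (j a : Fin n) : A := g.d j (B a) - ∑ m, g.chr m j a * B m

/-- The covariant derivative of a `(0,2)` tensor. -/
def cov2 (B : Fin n → Fin n → A) (j a b : Fin n) : A :=
  g.d j (B a b) - ∑ m, g.chr m j a * B m b - ∑ m, g.chr m j b * B a m

/-- The covariant derivative of a `(0,3)` tensor. -/
def cov3 (B : Fin n → Fin n → Fin n → A) (j a b c : Fin n) : A :=
  g.d j (B a b c) - ∑ m, g.chr m j a * B m b c - ∑ m, g.chr m j b * B a m c
    - ∑ m, g.chr m j c * B a b m

/-- The covariant derivative of a `(0,4)` tensor. -/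
def cov4 (B : Fin n → Fin n → Fin n → Fin n → A) (j a b c e : Fin n) : A :=
  g.d j (B a b c e) - ∑ m, g.chr m j a * B m b c e - ∑ m, g.chr m j b * B a m c e
    - ∑ m, g.chr m j c * B a b m e - ∑ m, g.chr m j e * B a b c m

/-- The covariant derivative of a `(1,3)` tensor. -/
def covU (B : Fin n → Fin n → Fin n → Fin n → A) (j l a b c : Fin n) : A :=
  g.d j (B l a b c) + ∑ m, g.chr l j m * B m a b c - ∑ m, g.chr m j a * B l m b c
    - ∑ m, g.chr m j b * B l a m c - ∑ m, g.chr m j c * B l a b m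

theorem cov2_G (j a b : Fin n) : g.cov2 g.G j a b = 0 := by
  rw [cov2, d_G]; ring

theorem d_tr_eq_tr_cov2 (i : Fin n) (B : Fin n → Fin n → A) :
    g.d i (g.tr B) = g.tr (g.cov2 B i) := g.d_tr i B

/-- Raising an index commutes with $\nabla$ because $\nabla g = 0$. Divergences thereby become plain
index contractions that do not involve the metric. -/
theorem covU_up (B : Fin n → Fin n → Fin n → Fin n → A) (j l a b c : Fin n) :
    g.covU (fun l a b c => g.up (B a b c) l) j l a b c = g.up (g.cov4 B j a b c) l := by
  have : g.cov4 B j a b c = fun e => (((g.d j (B a b c e) - ∑ m, g.chr m j e * B a b c m)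
      - ∑ m, g.chr m j a * B m b c e) - ∑ m, g.chr m j b * B a m c e)
      - ∑ m, g.chr m j c * B a b m e := by
    funext e; rw [cov4]; ring
  rw [this, up_sub, up_sub, up_sub, covU, d_up]
  simp only [up_sum, up_mul]
  ring

/-- The trace over the second and third argument commutes with covariant derivatives. -/
theorem tr_cov4_mid (B : Fin n → Fin n → Fin n → Fin n → A) (i j p : Fin n) :
    g.tr (fun k m => g.cov4 B i j k m p) = g.cov2 (fun j p => g.tr fun k m => B j k m p) i j p := by
  have : (fun k m => g.cov4 B i j k m p) = fun k m =>
      ((g.d i (B j k m p) - ∑ q, g.chr q i k * B j q m p - ∑ q, g.chr q i m * B j k q p)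
      - ∑ q, g.chr q i j * B q k m p) - ∑ q, g.chr q i p * B j k m q := by
    funext k m; rw [cov4]; ring
  rw [this, tr_sub, tr_sub, ← d_tr, cov2]
  simp only [tr_sum, tr_mul]

end AlgMetric

/-! ### Curvature symmetries and the Bianchi identities -/

/-- The algebraic symmetries of a curvature tensor. -/
structure IsCurvLike {n : ℕ} {A : Type*} [CommRing A] (R : Fin n → Fin n → Fin n → Fin n → A) :
    Prop where
  antisymm₁ : ∀ i j k l, R i j k l = -R j i k l
  antisymm₂ : ∀ i j k l, R i j k l = -R i j l k
  cyclic : ∀ i j k l, R i j k l + R j k i l + R k i j l = 0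

/-- The classical octahedron argument: in a signed sum of four cyclic identities everything cancels
except twice the desired difference. -/
theorem IsCurvLike.pair {n : ℕ} {A : Type*} [CommRing A] [Algebra ℝ A]
    {R : Fin n → Fin n → Fin n → Fin n → A} (h : IsCurvLike R) (i j k l : Fin n) :
    R i j k l = R k l i j := by
  have h3 : algebraMap ℝ A (1 / 2) * 2 = 1 := by
    rw [← map_ofNat (algebraMap ℝ A) 2, ← map_mul]; norm_num
  have e1 := h.cyclic i j k l
  have e2 : R k l i j + R j k i l + R j l k i = 0 := by
    linear_combination -h.cyclic j k l i + h.antisymm₂ k l i j + h.antisymm₂ j k i l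
      + h.antisymm₁ j l k i
  have e3 : R k l i j + R i l j k + R k i j l = 0 := by
    linear_combination h.cyclic k l i j + h.antisymm₁ i l j k - h.antisymm₂ l i j k
      + h.antisymm₁ k i j l - h.antisymm₂ i k j l
  have e4 : R i j k l + R i l j k + R j l k i = 0 := by
    linear_combination -h.cyclic l i j k + h.antisymm₂ i j k l + h.antisymm₁ i l j k
      + h.antisymm₂ j l k i
  have h2 : 2 * R i j k l = 2 * R k l i j := by linear_combination e1 - e2 - e3 + e4
  linear_combination algebraMap ℝ A (1 / 2) * h2 - (R i j k l - R k l i j) * h3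

namespace AlgMetric

variable {n : ℕ} {A : Type*} [CommRing A] [Algebra ℝ A] (g : AlgMetric n A)

/-- The curvature `R^l_{ijk}`. -/
def riemUp (l i j k : Fin n) : A :=
  g.d i (g.chr l j k) - g.d j (g.chr l i k)
    + ∑ m, (g.chr l i m * g.chr m j k - g.chr l j m * g.chr m i k)

/-- The Riemannian curvature tensor. -/
def riem (i j k l : Fin n) : A := g.low (fun m => g.riemUp m i j k) l

/-- The Ricci tensor. -/
def ric (i j : Fin n) : A := ∑ a, g.riemUp a a i j

/-- The scalar curvature. -/
def scal : A := g.tr g.ric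

theorem up_riem (l i j k : Fin n) : g.up (g.riem i j k) l = g.riemUp l i j k := g.up_low _ _

/-- In terms of Christoffel symbols of the first kind the antisymmetry in the last two indices
becomes visible: there `gam_add` reduces it to commuting second derivatives of $g_{kl}$. -/
theorem riem_eq (i j k l : Fin n) :
    g.riem i j k l = g.d i (g.gam l j k) - g.d j (g.gam l i k)
      - ∑ m, g.gam m i l * g.chr m j k + ∑ m, g.gam m j l * g.chr m i k := by
  have h1 := g.d_low i l (fun m => g.chr m j k)
  have h2 := g.d_low j l (fun m => g.chr m i k)
  simp only [low_chr] at h1 h2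
  rw [h1, h2]
  have h3 : ∑ q, g.chr q i l * g.gam q j k = ∑ q, g.gam q i l * g.chr q j k :=
    g.sum_up_mul _ _
  have h4 : ∑ q, g.chr q j l * g.gam q i k = ∑ q, g.gam q j l * g.chr q i k :=
    g.sum_up_mul _ _
  rw [h3, h4]
  have h5 : g.riem i j k l = g.low (fun m => g.d i (g.chr m j k) + ∑ q, g.chr m i q * g.chr q j k) l
      - g.low (fun m => g.d j (g.chr m i k) + ∑ q, g.chr m j q * g.chr q i k) l := by
    simp only [riem, low, ← Finset.sum_sub_distrib, riemUp]
    exact Finset.sum_congr rfl fun m _ => by rw [Finset.sum_sub_distrib]; ring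
  rw [h5]; ring

theorem riemUp_antisymm (l i j k : Fin n) : g.riemUp l i j k = -g.riemUp l j i k := by
  simp only [riemUp, Finset.sum_sub_distrib]; ring

theorem riemUp_cyclic (l i j k : Fin n) :
    g.riemUp l i j k + g.riemUp l j k i + g.riemUp l k i j = 0 := by
  simp only [riemUp, Finset.sum_sub_distrib]
  rw [g.chr_symm l j k, g.chr_symm l i k, g.chr_symm l j i]
  simp only [g.chr_symm _ j k, g.chr_symm _ i k, g.chr_symm _ j i]
  ring

theorem riem_curvLike : IsCurvLike g.riem where
  antisymm₁ i j k l := by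
    simp only [riem, low]
    rw [← Finset.sum_neg_distrib]
    exact Finset.sum_congr rfl fun m _ => by rw [riemUp_antisymm]; ring
  antisymm₂ i j k l := by
    have h : ∀ i j k l, ∑ m, g.gam m i l * g.chr m j k = ∑ m, g.gam m j k * g.chr m i l :=
      fun i j k l => by
        rw [Finset.sum_congr rfl fun m _ => mul_comm (g.gam m j k) (g.chr m i l)]
        exact (g.sum_up_mul _ _).symm
    rw [riem_eq, riem_eq, h i j k l, h j i k l]
    have h1 := congrArg (g.d i) (g.gam_add j k l)
    have h2 := congrArg (g.d j) (g.gam_add i k l)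
    rw [map_add] at h1 h2
    linear_combination h1 - h2 + g.d_comm i j (g.G k l)
  cyclic i j k l := by
    simp only [riem, low, ← Finset.sum_add_distrib, ← mul_add, riemUp_cyclic, mul_zero,
      Finset.sum_const_zero]

theorem ric_eq (j k : Fin n) : g.ric j k = g.tr fun a l => g.riem a j k l := by
  rw [tr_eq_sum_up]
  simp only [up_riem]
  rfl

theorem ric_symm (j k : Fin n) : g.ric j k = g.ric k j := by
  rw [ric_eq, ric_eq, ← tr_swap]
  congr 1
  funext a l
  rw [g.riem_curvLike.pair, g.riem_curvLike.antisymm₁, g.riem_curvLike.antisymm₂, neg_neg]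

/-- The connection matrices. -/
def conn (i : Fin n) : Matrix (Fin n) (Fin n) A := Matrix.of fun l k => g.chr l i k

/-- The curvature matrices. -/
def curv (i j : Fin n) : Matrix (Fin n) (Fin n) A := Matrix.of fun l k => g.riemUp l i j k

theorem map_d_mul (i : Fin n) (X Y : Matrix (Fin n) (Fin n) A) :
    (X * Y).map (g.d i) = X.map (g.d i) * Y + X * Y.map (g.d i) := by
  ext a b
  simp only [Matrix.map_apply, Matrix.mul_apply, Matrix.add_apply, map_sum, Derivation.leibniz,
    smul_eq_mul, ← Finset.sum_add_distrib]
  exact Finset.sum_congr rfl fun _ _ => by ring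

theorem curv_eq (i j : Fin n) : g.curv i j = (g.conn j).map (g.d i) - (g.conn i).map (g.d j)
    + (g.conn i * g.conn j - g.conn j * g.conn i) := by
  ext a b
  simp only [curv, conn, riemUp, Matrix.of_apply, Matrix.add_apply, Matrix.sub_apply,
    Matrix.map_apply, Matrix.mul_apply, Finset.sum_sub_distrib]

/-- With $\omega$ the connection matrices and $F = d\omega + \omega\wedge\omega$, this is $dF +
[\omega,F] = 0$. Once the second derivatives commute it is an identity in a noncommutative ring. -/
theorem curv_bianchi (i j k : Fin n) :
    ((g.curv j k).map (g.d i) + g.conn i * g.curv j k - g.curv j k * g.conn i)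
    + ((g.curv k i).map (g.d j) + g.conn j * g.curv k i - g.curv k i * g.conn j)
    + ((g.curv i j).map (g.d k) + g.conn k * g.curv i j - g.curv i j * g.conn k) = 0 := by
  have hc : ∀ a b (X : Matrix (Fin n) (Fin n) A),
      (X.map (g.d a)).map (g.d b) = (X.map (g.d b)).map (g.d a) := fun a b X => by
    ext u v; simp [g.d_comm a b]
  have hs : ∀ a (X Y : Matrix (Fin n) (Fin n) A),
      (X - Y).map (g.d a) = X.map (g.d a) - Y.map (g.d a) := fun a X Y => by ext u v; simp
  have hd : ∀ a (X Y : Matrix (Fin n) (Fin n) A),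
      (X + Y).map (g.d a) = X.map (g.d a) + Y.map (g.d a) := fun a X Y => by ext u v; simp
  simp only [curv_eq, hs, hd, map_d_mul]
  rw [hc i j, hc i k, hc j k]
  noncomm_ring

/-- The Christoffel terms on the two form indices, absent from `curv_bianchi`, cancel in the cyclic
sum since the connection is torsion-free. -/
theorem covU_riemUp_cyclic (i j k l m : Fin n) :
    g.covU g.riemUp i l j k m + g.covU g.riemUp j l k i m + g.covU g.riemUp k l i j m = 0 := by
  have h := congrFun (congrFun (g.curv_bianchi i j k) l) m
  simp only [Matrix.add_apply, Matrix.sub_apply, Matrix.map_apply, Matrix.mul_apply, curv, conn,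
    Matrix.of_apply, Matrix.zero_apply] at h
  have e1 : ∀ i j k, ∑ q, g.chr q i j * g.riemUp l q k m
      = - ∑ q, g.chr q j i * g.riemUp l k q m := fun i j k => by
    rw [← Finset.sum_neg_distrib]
    exact Finset.sum_congr rfl fun q _ => by rw [g.chr_symm, riemUp_antisymm]; ring
  have e2 : ∀ i j k, ∑ q, g.riemUp l j k q * g.chr q i m = ∑ q, g.chr q i m * g.riemUp l j k q :=
    fun i j k => Finset.sum_congr rfl fun q _ => mul_comm _ _
  simp only [covU, e1, e2] at h ⊢
  linear_combination h

/-- The trace of the upper index with the first lower index commutes with covariant derivatives. -/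
theorem sum_covU_first (B : Fin n → Fin n → Fin n → Fin n → A) (j b c : Fin n) :
    ∑ l, g.covU B j l l b c = g.cov2 (fun b c => ∑ l, B l l b c) j b c := by
  simp only [covU, cov2, Finset.sum_sub_distrib, Finset.sum_add_distrib, map_sum, Finset.mul_sum]
  have h : ∑ l, ∑ m, g.chr l j m * B m l b c = ∑ l, ∑ m, g.chr m j l * B l m b c :=
    Finset.sum_comm
  rw [h, Finset.sum_comm (f := fun l m => g.chr m j b * B l l m c),
    Finset.sum_comm (f := fun l m => g.chr m j c * B l l b m)]
  ring

theorem covU_antisymm {B : Fin n → Fin n → Fin n → Fin n → A}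
    (hB : ∀ l a b c, B l a b c = -B l b a c) (j l a b c : Fin n) :
    g.covU B j l a b c = -g.covU B j l b a c := by
  have h1 : ∀ a b, ∑ m, g.chr m j a * B l m b c = -∑ m, g.chr m j a * B l b m c := fun a b => by
    rw [← Finset.sum_neg_distrib]
    exact Finset.sum_congr rfl fun m _ => by rw [hB]; ring
  have h2 : ∑ m, g.chr m j c * B l a b m = -∑ m, g.chr m j c * B l b a m := by
    rw [← Finset.sum_neg_distrib]
    exact Finset.sum_congr rfl fun m _ => by rw [hB]; ring
  have h3 : ∑ m, g.chr l j m * B m a b c = -∑ m, g.chr l j m * B m b a c := by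
    rw [← Finset.sum_neg_distrib]
    exact Finset.sum_congr rfl fun m _ => by rw [hB]; ring
  rw [covU, covU, h1 a b, h2, h3, h1 b a, hB l a b c, map_neg]
  ring

/-- The contracted second Bianchi identity. -/
theorem sum_covU_riemUp (j k m : Fin n) :
    ∑ i, g.covU g.riemUp i i j k m = g.cov2 g.ric j k m - g.cov2 g.ric k j m := by
  have h : ∑ i, (g.covU g.riemUp i i j k m + g.covU g.riemUp j i k i m
      + g.covU g.riemUp k i i j m) = 0 := Finset.sum_eq_zero fun i _ => g.covU_riemUp_cyclic ..
  simp only [g.covU_antisymm g.riemUp_antisymm j _ k, Finset.sum_add_distrib,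
    Finset.sum_neg_distrib, sum_covU_first] at h
  change _ + -g.cov2 g.ric j k m + g.cov2 g.ric k j m = 0 at h
  linear_combination h

theorem div_riem (a b c : Fin n) : g.tr (fun i j => g.cov4 g.riem i a b c j)
    = g.cov2 g.ric a b c - g.cov2 g.ric b a c := by
  rw [← sum_covU_riemUp, tr_eq_sum_up]
  refine Finset.sum_congr rfl fun i _ => ?_
  rw [← covU_up]
  simp only [up_riem]

/-- The divergence of the Ricci tensor is half the differential of the scalar curvature. -/
theorem div_ric (j : Fin n) : 2 * g.tr (fun i p => g.cov2 g.ric i j p) = g.d j g.scal := by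
  -- Exchange the two traces of the divergence of `riem`: one order gives the divergence of `ric`,
  -- the other can be evaluated by `div_riem`.
  have h1 : g.tr (fun k m => g.tr fun i p => g.cov4 g.riem i j k m p)
      = g.tr (fun i p => g.cov2 g.ric i j p) := by
    have : g.tr (fun k m => g.tr fun i p => g.cov4 g.riem i j k m p)
       = g.tr (fun i p => g.tr fun k m => g.cov4 g.riem i j k m p) := by
      simp only [tr, Finset.mul_sum]
      rw [Finset.sum_congr rfl fun k _ => Finset.sum_comm, Finset.sum_comm]
      refine Finset.sum_congr rfl fun i _ => ?_
      rw [Finset.sum_congr rfl fun k _ => Finset.sum_comm, Finset.sum_comm]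
      exact Finset.sum_congr rfl fun _ _ => Finset.sum_congr rfl fun _ _ =>
        Finset.sum_congr rfl fun _ _ => by ring
    rw [this]
    simp only [tr_cov4_mid]
    congr 1
    funext i p
    congr 1
    funext j p
    rw [ric_eq]
    congr 1
    funext a l
    rw [g.riem_curvLike.antisymm₁, g.riem_curvLike.antisymm₂, neg_neg]
  simp only [div_riem, tr_sub] at h1
  rw [scal, d_tr_eq_tr_cov2]
  have h2 : g.tr (fun k m => g.cov2 g.ric k j m) = g.tr (fun i p => g.cov2 g.ric i j p) := rfl
  have h3 : g.tr (fun k m => g.cov2 g.ric j k m) = g.tr (g.cov2 g.ric j) := rfl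
  linear_combination -h1 - h2 + h3

end AlgMetric

/-! ### Schouten, Weyl and Cotton tensors; the divergence of the Weyl tensor -/

namespace AlgMetric

variable {n : ℕ} {A : Type*} [CommRing A] [Algebra ℝ A] (g : AlgMetric n A)

theorem cov2_sub (B C : Fin n → Fin n → A) (j a b : Fin n) :
    g.cov2 (fun a b => B a b - C a b) j a b = g.cov2 B j a b - g.cov2 C j a b := by
  simp only [cov2, map_sub, mul_sub, Finset.sum_sub_distrib]; ring

theorem cov2_mul (f : A) (B : Fin n → Fin n → A) (j a b : Fin n) :
    g.cov2 (fun a b => f * B a b) j a b = g.d j f * B a b + f * g.cov2 B j a b := by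
  have h1 : ∑ m, g.chr m j a * (f * B m b) = f * ∑ m, g.chr m j a * B m b := by
    rw [Finset.mul_sum]; exact Finset.sum_congr rfl fun _ _ => by ring
  have h2 : ∑ m, g.chr m j b * (f * B a m) = f * ∑ m, g.chr m j b * B a m := by
    rw [Finset.mul_sum]; exact Finset.sum_congr rfl fun _ _ => by ring
  simp only [cov2, Derivation.leibniz, smul_eq_mul, h1, h2]; ring

theorem cov2_symm {B : Fin n → Fin n → A} (hB : ∀ a b, B a b = B b a) (j a b : Fin n) :
    g.cov2 B j a b = g.cov2 B j b a := by
  simp only [cov2, hB a b, hB _ b, hB a _]; ring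

theorem cov4_sub (B C : Fin n → Fin n → Fin n → Fin n → A) (j a b c e : Fin n) :
    g.cov4 (fun a b c e => B a b c e - C a b c e) j a b c e
      = g.cov4 B j a b c e - g.cov4 C j a b c e := by
  simp only [cov4, map_sub, mul_sub, Finset.sum_sub_distrib]; ring

/-- The Kulkarni-Nomizu product with the metric. -/
def kn (h : Fin n → Fin n → A) (i j k l : Fin n) : A :=
  g.G i l * h j k + g.G j k * h i l - g.G i k * h j l - g.G j l * h i k

/-- Since $\nabla g = 0$, only the factor `h` is differentiated. -/
theorem cov4_kn (h : Fin n → Fin n → A) (i a b c e : Fin n) :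
    g.cov4 (g.kn h) i a b c e = g.G a e * g.cov2 h i b c + g.G b c * g.cov2 h i a e
      - g.G a c * g.cov2 h i b e - g.G b e * g.cov2 h i a c := by
  have h1 : ∀ a j x, ∑ m, g.chr m i a * (g.G m j * x) = g.gam j i a * x := fun a j x => by
    rw [← sum_chr_mul_G, Finset.sum_mul]; exact Finset.sum_congr rfl fun _ _ => by ring
  have h2 : ∀ a j x, ∑ m, g.chr m i a * (g.G j m * x) = g.gam j i a * x := fun a j x => by
    rw [← sum_chr_mul_G', Finset.sum_mul]; exact Finset.sum_congr rfl fun _ _ => by ring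
  have h3 : ∀ (a : Fin n) (x : A) (Y : Fin n → A),
      ∑ m, g.chr m i a * (x * Y m) = x * ∑ m, g.chr m i a * Y m := fun a x Y => by
    rw [Finset.mul_sum]; exact Finset.sum_congr rfl fun _ _ => by ring
  simp only [cov4, kn, cov2, map_add, map_sub, mul_add, mul_sub, Finset.sum_add_distrib,
    Finset.sum_sub_distrib, h1, h2, h3 _ _ (fun m => h m _), h3 _ _ (fun m => h _ m),
    Derivation.leibniz, smul_eq_mul, ← gam_add]
  ring

theorem tr_kn (h : Fin n → Fin n → A) (j k : Fin n) :
    g.tr (fun a l => g.kn h a j k l) = n * h j k + g.G j k * g.tr h - 2 * h j k := by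
  have h1 : g.tr (fun a l => g.G a l * h j k) = n * h j k := by
    rw [show (fun a l => g.G a l * h j k) = fun a l => h j k * g.G a l from by
      funext a l; ring, tr_mul, tr_G]; ring
  have h2 : g.tr (fun a l => g.G j l * h a k) = h j k := by
    rw [← g.tr_G_right (fun a => h a k) j]
    congr 1; funext a l; rw [g.G_symm]
  simp only [kn, tr_sub, tr_add, h1, h2, tr_mul, tr_G_left]
  ring

theorem div_kn (h : Fin n → Fin n → A) (a b c : Fin n) :
    g.tr (fun i e => g.cov4 (g.kn h) i a b c e) = g.cov2 h a b c - g.cov2 h b a c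
      + g.G b c * g.tr (fun i e => g.cov2 h i a e)
      - g.G a c * g.tr (fun i e => g.cov2 h i b e) := by
  have h2 : ∀ a b, g.tr (fun i e => g.G a e * g.cov2 h i b c) = g.cov2 h a b c := fun a b => by
    rw [← g.tr_G_right (fun i => g.cov2 h i b c) a]
    congr 1; funext i e; rw [g.G_symm]
  simp only [cov4_kn, tr_sub, tr_add, h2, tr_mul]
  ring

/-- The Schouten tensor. -/
def sch (i j : Fin n) : A := algebraMap ℝ A (1 / ((n : ℝ) - 2)) *
  (g.ric i j - algebraMap ℝ A (1 / (2 * ((n : ℝ) - 1))) * g.scal * g.G i j)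

/-- The Weyl tensor. -/
def weyl (i j k l : Fin n) : A := g.riem i j k l - g.kn g.sch i j k l

/-- The Weyl tensor with the last index raised. -/
def weylUp (l i j k : Fin n) : A := g.up (g.weyl i j k) l

theorem const_sub_two (hn : 4 ≤ n) :
    ((n : A) - 2) * algebraMap ℝ A (1 / ((n : ℝ) - 2)) = 1 := by
  have h : (4 : ℝ) ≤ n := by exact_mod_cast hn
  rw [← map_natCast (algebraMap ℝ A), ← map_ofNat (algebraMap ℝ A) 2, ← map_sub, ← map_mul,
    mul_one_div_cancel (by linarith), map_one]

theorem const_sub_one (hn : 4 ≤ n) :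
    (2 * ((n : A) - 1)) * algebraMap ℝ A (1 / (2 * ((n : ℝ) - 1))) = 1 := by
  have h : (4 : ℝ) ≤ n := by exact_mod_cast hn
  rw [← map_natCast (algebraMap ℝ A), ← map_ofNat (algebraMap ℝ A) 2,
    ← map_one (algebraMap ℝ A), ← map_sub, ← map_mul, ← map_mul,
    mul_one_div_cancel (by nlinarith)]

theorem sch_symm (i j : Fin n) : g.sch i j = g.sch j i := by
  rw [sch, sch, ric_symm, g.G_symm]

theorem ric_eq_sch (hn : 4 ≤ n) (i j : Fin n) : g.ric i j = ((n : A) - 2) * g.sch i j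
    + algebraMap ℝ A (1 / (2 * ((n : ℝ) - 1))) * g.scal * g.G i j := by
  rw [sch]
  linear_combination (-(g.ric i j - algebraMap ℝ A (1 / (2 * ((n : ℝ) - 1))) * g.scal * g.G i j))
    * const_sub_two (A := A) hn

theorem tr_sch (hn : 4 ≤ n) :
    g.tr g.sch = algebraMap ℝ A (1 / (2 * ((n : ℝ) - 1))) * g.scal := by
  have h : g.tr g.sch = algebraMap ℝ A (1 / ((n : ℝ) - 2)) *
      (g.scal - algebraMap ℝ A (1 / (2 * ((n : ℝ) - 1))) * g.scal * n) := by
    rw [show g.sch = fun i j => algebraMap ℝ A (1 / ((n : ℝ) - 2)) * (g.ric i j -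
      algebraMap ℝ A (1 / (2 * ((n : ℝ) - 1))) * g.scal * g.G i j) from rfl, tr_mul, tr_sub,
      tr_mul, tr_G]
    rfl
  rw [h]
  linear_combination (-algebraMap ℝ A (1 / ((n : ℝ) - 2)) * g.scal) * const_sub_one (A := A) hn
    + algebraMap ℝ A (1 / (2 * ((n : ℝ) - 1))) * g.scal * const_sub_two (A := A) hn

theorem weyl_curvLike : IsCurvLike g.weyl where
  antisymm₁ i j k l := by
    rw [weyl, weyl, g.riem_curvLike.antisymm₁, kn, kn]; ring
  antisymm₂ i j k l := by
    rw [weyl, weyl, g.riem_curvLike.antisymm₂, kn, kn]; ring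
  cyclic i j k l := by
    simp only [weyl, kn]
    rw [g.G_symm k i, g.G_symm j i, g.G_symm k j, g.sch_symm k i, g.sch_symm j i, g.sch_symm k j]
    linear_combination g.riem_curvLike.cyclic i j k l

/-- The Schouten tensor is normalised so that the trace of its Kulkarni-Nomizu product with $g$ is
exactly the Ricci tensor. -/
theorem sum_weylUp_first (hn : 4 ≤ n) (j k : Fin n) : ∑ a, g.weylUp a a j k = 0 := by
  change g.tr (fun a l => g.weyl a j k l) = 0
  simp only [weyl]
  rw [tr_sub, tr_kn, ← ric_eq, g.ric_eq_sch hn, tr_sch g hn]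
  ring

theorem sum_weylUp_second (hn : 4 ≤ n) (j k : Fin n) : ∑ a, g.weylUp a j a k = 0 := by
  have h : ∀ a, g.weylUp a j a k = - g.weylUp a a j k := fun a => by
    simp only [weylUp, up, ← Finset.sum_neg_distrib]
    exact Finset.sum_congr rfl fun _ _ => by rw [g.weyl_curvLike.antisymm₁]; ring
  simp only [h, Finset.sum_neg_distrib, g.sum_weylUp_first hn, neg_zero]

theorem sum_weylUp_third (i j : Fin n) : ∑ a, g.weylUp a i j a = 0 :=
  g.tr_antisymm_of (fun a l => g.weyl i j a l) fun _ _ => g.weyl_curvLike.antisymm₂ ..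

theorem cov2_sch (i a b : Fin n) : g.cov2 g.sch i a b = algebraMap ℝ A (1 / ((n : ℝ) - 2)) *
    (g.cov2 g.ric i a b - algebraMap ℝ A (1 / (2 * ((n : ℝ) - 1))) * g.d i g.scal * g.G a b) := by
  rw [show g.sch = fun i j => algebraMap ℝ A (1 / ((n : ℝ) - 2)) * (g.ric i j -
      algebraMap ℝ A (1 / (2 * ((n : ℝ) - 1))) * g.scal * g.G i j) from rfl, cov2_mul,
    cov2_sub, cov2_mul, cov2_G, Derivation.map_algebraMap, Derivation.leibniz,
    Derivation.map_algebraMap]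
  simp only [smul_eq_mul]
  ring

theorem div_sch (hn : 4 ≤ n) (j : Fin n) : g.tr (fun i p => g.cov2 g.sch i j p)
    = algebraMap ℝ A (1 / (2 * ((n : ℝ) - 1))) * g.d j g.scal := by
  have h0 : g.tr (fun i p => g.d i g.scal * g.G j p) = g.d j g.scal := by
    rw [← g.tr_G_right (fun i => g.d i g.scal) j]
    congr 1; funext i e; rw [g.G_symm]; ring
  have h : g.tr (fun i p => g.cov2 g.sch i j p) = algebraMap ℝ A (1 / ((n : ℝ) - 2)) *
      (g.tr (fun i p => g.cov2 g.ric i j p)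
        - algebraMap ℝ A (1 / (2 * ((n : ℝ) - 1))) * g.d j g.scal) := by
    simp only [cov2_sch, tr_mul, tr_sub, mul_assoc, h0]
  have h1 := g.div_ric j
  have h2 := const_sub_two (A := A) hn
  have h3 := const_sub_one (A := A) hn
  rw [h]
  linear_combination (-(algebraMap ℝ A (1 / ((n : ℝ) - 2)) *
      g.tr (fun i p => g.cov2 g.ric i j p))) * h3
    + ((n : A) - 1) * algebraMap ℝ A (1 / ((n : ℝ) - 2)) *
      algebraMap ℝ A (1 / (2 * ((n : ℝ) - 1))) * h1
    + algebraMap ℝ A (1 / (2 * ((n : ℝ) - 1))) * g.d j g.scal * h2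

/-- The Cotton tensor `d^∇` of the Schouten tensor. -/
def cotton (a b c : Fin n) : A := g.cov2 g.sch a b c - g.cov2 g.sch b a c

theorem cotton_antisymm (a b c : Fin n) : g.cotton a b c = -g.cotton b a c := by
  simp only [cotton]; ring

theorem cotton_cyclic (a b c : Fin n) :
    g.cotton a b c + g.cotton b c a + g.cotton c a b = 0 := by
  simp only [cotton]
  rw [g.cov2_symm g.sch_symm a b c, g.cov2_symm g.sch_symm b a c, g.cov2_symm g.sch_symm c a b]
  ring

/-- The contracted Bianchi identity makes the divergence of the Schouten tensor equal to the
differential of its trace. -/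
theorem tr_cotton (hn : 4 ≤ n) (a : Fin n) : g.tr (fun b c => g.cotton a b c) = 0 := by
  simp only [cotton, tr_sub]
  rw [div_sch g hn]
  rw [← d_tr_eq_tr_cov2, tr_sch g hn, Derivation.leibniz, Derivation.map_algebraMap]
  simp

/-- The divergence of the Weyl tensor in the last argument. -/
def divWeyl (a b c : Fin n) : A := g.tr fun i j => g.cov4 g.weyl i a b c j

/-- The divergence of `riem` is the antisymmetrised $\nabla\mathrm{Ric}$, which contains $n-2$
copies of the Cotton tensor; the Kulkarni-Nomizu part removes one copy, and the terms in $dS$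
cancel. -/
theorem divWeyl_eq_cotton (hn : 4 ≤ n) (a b c : Fin n) :
    g.divWeyl a b c = ((n : A) - 3) * g.cotton a b c := by
  have h : g.divWeyl a b c = g.tr (fun i j => g.cov4 g.riem i a b c j)
      - g.tr (fun i j => g.cov4 (g.kn g.sch) i a b c j) := by
    rw [← tr_sub, divWeyl]
    congr 1; funext i j
    exact g.cov4_sub _ _ _ _ _ _ _
  rw [h, div_riem, div_kn, div_sch g hn, div_sch g hn, cotton]
  have h1 := g.cov2_sch a b c
  have h2 := g.cov2_sch b a c
  linear_combination (-(g.cov2 g.ric a b c - g.cov2 g.ric b a c) + algebraMap ℝ A (1 / (2 * ((n : ℝ) - 1))) *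
    (g.d a g.scal * g.G b c - g.d b g.scal * g.G a c)) * const_sub_two (A := A) hn
      - ((n : A) - 2) * (h1 - h2)

/-- Here the metric enters only through the connection and the conformally invariant `weylUp`, so a
conformal change acts only through the Christoffel symbols. -/
theorem divWeyl_eq_sum (a b c : Fin n) :
    g.divWeyl a b c = ∑ i, g.covU g.weylUp i i a b c := by
  rw [divWeyl, tr_eq_sum_up]
  exact Finset.sum_congr rfl fun i _ => (g.covU_up g.weyl i i a b c).symm

end AlgMetric

/-! ### Conformal change of the connection and the curvature -/

/-- The Kronecker delta. -/
def kd {n : ℕ} (A : Type*) [CommRing A] (i j : Fin n) : A := if i = j then 1 else 0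

section

variable {n : ℕ} {A : Type*} [CommRing A]

theorem sum_kd_mul (i : Fin n) (X : Fin n → A) : ∑ m, kd A i m * X m = X i := by simp [kd]

theorem sum_kd_mul' (i : Fin n) (X : Fin n → A) : ∑ m, kd A m i * X m = X i := by simp [kd]

theorem sum_mul_kd (i : Fin n) (X : Fin n → A) : ∑ m, X m * kd A i m = X i := by simp [kd]

theorem sum_mul_kd' (i : Fin n) (X : Fin n → A) : ∑ m, X m * kd A m i = X i := by simp [kd]

theorem sum_kd_self : ∑ m : Fin n, kd A m m = n := by simp [kd]

end

namespace AlgMetric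

variable {n : ℕ} {A : Type*} [CommRing A] [Algebra ℝ A] (g : AlgMetric n A)

/-- The conformally changed metric `s⁻² g`, where `r` is the inverse of `s`. -/
def conf (s r : A) (h : s * r = 1) : AlgMetric n A where
  d := g.d
  d_comm := g.d_comm
  G i j := r ^ 2 * g.G i j
  H i j := s ^ 2 * g.H i j
  G_symm i j := by rw [g.G_symm]
  H_symm i j := by rw [g.H_symm]
  G_mul_H i j := by
    rw [← g.G_mul_H i j]
    refine Finset.sum_congr rfl fun k _ => ?_
    linear_combination (s * r + 1) * g.G i k * g.H k j * h

/-- The logarithmic derivative of `s`, where `r` is the inverse of `s`. -/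
def dlog (s r : A) (i : Fin n) : A := r * g.d i s

variable (s r : A) (h : s * r = 1)

theorem d_kd (i a b : Fin n) : g.d i (kd A a b) = 0 := by
  by_cases hab : a = b <;> simp [kd, hab]

@[simp] theorem conf_d : (g.conf s r h).d = g.d := rfl

@[simp] theorem conf_G (i j : Fin n) : (g.conf s r h).G i j = r ^ 2 * g.G i j := rfl

@[simp] theorem conf_H (i j : Fin n) : (g.conf s r h).H i j = s ^ 2 * g.H i j := rfl

theorem conf_up (X : Fin n → A) (m : Fin n) : (g.conf s r h).up X m = s ^ 2 * g.up X m := by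
  simp only [up, conf_H, Finset.mul_sum, mul_assoc]

theorem conf_low (X : Fin n → A) (m : Fin n) : (g.conf s r h).low X m = r ^ 2 * g.low X m := by
  simp only [low, conf_G, Finset.mul_sum, mul_assoc]

theorem conf_tr (B : Fin n → Fin n → A) : (g.conf s r h).tr B = s ^ 2 * g.tr B := by
  simp only [tr, conf_H, Finset.mul_sum, mul_assoc]

include h in
theorem d_r (i : Fin n) : g.d i r = -(r * g.dlog s r i) := by
  have h1 := congrArg (g.d i) h
  simp only [Derivation.leibniz, Derivation.map_one_eq_zero, smul_eq_mul] at h1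
  rw [dlog]
  linear_combination r * h1 - g.d i r * h

include h in
-- The form `dlog` is closed, as $d\log s$ should be; no logarithm of `s` is needed in `A`.
theorem d_dlog_symm (i j : Fin n) : g.d i (g.dlog s r j) = g.d j (g.dlog s r i) := by
  have h1 : ∀ i j, g.d i (g.dlog s r j) = r * g.d i (g.d j s) - g.dlog s r i * g.dlog s r j :=
    fun i j => by
      rw [dlog, Derivation.leibniz, g.d_r s r h, smul_eq_mul, smul_eq_mul]
      simp only [dlog]; ring
  rw [h1, h1, g.d_comm]; ring

theorem conf_gam (l i j : Fin n) : (g.conf s r h).gam l i j = r ^ 2 * (g.gam l i j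
    - (g.dlog s r i * g.G j l + g.dlog s r j * g.G i l - g.dlog s r l * g.G i j)) := by
  have h1 : ∀ k a b, g.d k (r ^ 2 * g.G a b)
      = r ^ 2 * g.d k (g.G a b) - 2 * r ^ 2 * g.dlog s r k * g.G a b := fun k a b => by
    rw [Derivation.leibniz, Derivation.leibniz_pow, g.d_r s r h]
    simp only [smul_eq_mul, nsmul_eq_mul]; push_cast; ring
  simp only [gam, conf_d, conf_G, h1]
  linear_combination (-(r ^ 2 * (g.dlog s r i * g.G j l + g.dlog s r j * g.G i l
    - g.dlog s r l * g.G i j))) * half_add_half (A := A)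

/-- The difference of the Levi-Civita connections. -/
def connDiff (f : Fin n → A) (k i j : Fin n) : A :=
  -(kd A k i * f j + kd A k j * f i - g.G i j * g.up f k)

theorem up_G_left (j m : Fin n) : g.up (fun l => g.G j l) m = kd A m j := by
  simp only [g.G_symm j, up_G, kd]

theorem conf_chr (k i j : Fin n) : (g.conf s r h).chr k i j
    = g.chr k i j + g.connDiff (g.dlog s r) k i j := by
  rw [chr, conf_up]
  simp only [conf_gam, up_mul, up_sub, up_add, up_mul_right, up_G_left]
  rw [connDiff, chr]
  linear_combination (g.up (fun l => g.gam l i j) k - g.dlog s r i * kd A k j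
    - g.dlog s r j * kd A k i + g.up (g.dlog s r) k * g.G i j) * (s * r + 1) * h

theorem sum_G_mul_up (i : Fin n) (f : Fin n → A) : ∑ m, g.G i m * g.up f m = f i := g.low_up f i

theorem sum_G_mul_up' (i : Fin n) (f : Fin n → A) : ∑ m, g.G m i * g.up f m = f i := by
  simp only [g.G_symm _ i, sum_G_mul_up]

/-- The squared norm of a one-form. -/
def nsq (f : Fin n → A) : A := ∑ m, f m * g.up f m

theorem connDiff_mul_connDiff (f : Fin n → A) (l i j k : Fin n) :
    ∑ m, g.connDiff f l i m * g.connDiff f m j k =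
      kd A l i * (2 * f j * f k - g.G j k * g.nsq f)
      + f i * (kd A l j * f k + kd A l k * f j - g.G j k * g.up f l)
      - g.up f l * (g.G i j * f k + g.G i k * f j - g.G j k * f i) := by
  have h1 : ∀ m, g.connDiff f l i m * g.connDiff f m j k =
      kd A l i * f k * (kd A m j * f m) + kd A l i * f j * (kd A m k * f m)
        - kd A l i * g.G j k * (f m * g.up f m)
      + f i * f k * (kd A l m * kd A m j) + f i * f j * (kd A l m * kd A m k)
        - f i * g.G j k * (kd A l m * g.up f m)
      - g.up f l * f k * (g.G i m * kd A m j) - g.up f l * f j * (g.G i m * kd A m k)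
        + g.up f l * g.G j k * (g.G i m * g.up f m) := fun m => by
    simp only [connDiff]; ring
  simp only [h1, Finset.sum_add_distrib, Finset.sum_sub_distrib, ← Finset.mul_sum, sum_kd_mul,
    sum_kd_mul', sum_mul_kd', sum_G_mul_up, nsq]
  ring

theorem cov1_eq (f : Fin n → A) (i l : Fin n) :
    g.up (g.cov1 f i) l = g.d i (g.up f l) + ∑ m, g.chr l i m * g.up f m := by
  rw [d_up]
  simp only [sub_add_cancel]
  rfl

/-- The left side is the covariant derivative of `connDiff` without the Christoffel term on the pair
`i`, `j`, which is symmetric in that pair. For closed `f` the last three terms on the right are also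
symmetric in `i`, `j`, so they disappear from the curvature. -/
theorem covD_connDiff (f : Fin n → A) (l i j k : Fin n) :
    g.d i (g.connDiff f l j k) + ∑ m, g.chr l i m * g.connDiff f m j k
      - ∑ m, g.connDiff f l j m * g.chr m i k
    = g.G j k * g.up (g.cov1 f i) l - kd A l j * g.cov1 f i k - kd A l k * g.d i (f j)
      + g.up f l * g.gam k i j - g.chr l i j * f k := by
  have h1 : ∀ m, g.chr l i m * g.connDiff f m j k = g.G j k * (g.chr l i m * g.up f m)
      - f k * (g.chr l i m * kd A m j) - f j * (g.chr l i m * kd A m k) := fun m => by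
    rw [connDiff]; ring
  have h2 : ∀ m, g.connDiff f l j m * g.chr m i k = g.up f l * (g.chr m i k * g.G j m)
      - kd A l j * (g.chr m i k * f m) - f j * (kd A l m * g.chr m i k) := fun m => by
    rw [connDiff]; ring
  have h3 : g.d i (g.connDiff f l j k) = g.d i (g.G j k) * g.up f l + g.G j k * g.d i (g.up f l)
      - kd A l j * g.d i (f k) - kd A l k * g.d i (f j) := by
    simp only [connDiff, map_neg, map_sub, map_add, Derivation.leibniz, d_kd, smul_eq_mul]; ring
  simp only [h1, h2, h3, Finset.sum_sub_distrib, ← Finset.mul_sum, sum_mul_kd', sum_kd_mul,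
    sum_chr_mul_G']
  rw [cov1_eq, cov1, ← gam_add]
  ring

/-- The change of the Schouten tensor. -/
def schDiff (f : Fin n → A) (i j : Fin n) : A :=
  g.cov1 f i j + f i * f j - algebraMap ℝ A (1 / 2) * g.nsq f * g.G i j

/-- Changing a connection by a tensor $D$ changes its curvature by the antisymmetrisation of $\nabla
D$ plus $D\wedge D$; `h5` isolates these terms and the preceding lemmas evaluate them. -/
theorem conf_riemUp (l i j k : Fin n) : (g.conf s r h).riemUp l i j k = g.riemUp l i j k
    + kd A l i * g.schDiff (g.dlog s r) j k + g.G j k * g.up (g.schDiff (g.dlog s r) i) l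
    - g.G i k * g.up (g.schDiff (g.dlog s r) j) l - kd A l j * g.schDiff (g.dlog s r) i k := by
  have hu : ∀ i, g.up (g.schDiff (g.dlog s r) i) l = g.up (g.cov1 (g.dlog s r) i) l
      + g.dlog s r i * g.up (g.dlog s r) l
      - algebraMap ℝ A (1 / 2) * g.nsq (g.dlog s r) * kd A l i := fun i => by
    rw [← up_G_left, ← up_mul, ← up_mul, ← up_add, ← up_sub]; rfl
  have h1 := g.covD_connDiff (g.dlog s r) l i j k
  have h2 := g.covD_connDiff (g.dlog s r) l j i k
  have h3 := g.connDiff_mul_connDiff (g.dlog s r) l i j k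
  have h4 := g.connDiff_mul_connDiff (g.dlog s r) l j i k
  have h5 : (g.conf s r h).riemUp l i j k = g.riemUp l i j k
      + (g.d i (g.connDiff (g.dlog s r) l j k)
        + ∑ m, g.chr l i m * g.connDiff (g.dlog s r) m j k
        - ∑ m, g.connDiff (g.dlog s r) l j m * g.chr m i k)
      - (g.d j (g.connDiff (g.dlog s r) l i k)
        + ∑ m, g.chr l j m * g.connDiff (g.dlog s r) m i k
        - ∑ m, g.connDiff (g.dlog s r) l i m * g.chr m j k)
      + ∑ m, g.connDiff (g.dlog s r) l i m * g.connDiff (g.dlog s r) m j k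
      - ∑ m, g.connDiff (g.dlog s r) l j m * g.connDiff (g.dlog s r) m i k := by
    simp only [riemUp, conf_chr, conf_d, map_add, add_mul, mul_add, Finset.sum_sub_distrib,
      Finset.sum_add_distrib]
    ring
  rw [h5, h1, h2, h3, h4, hu, hu, schDiff, schDiff, g.gam_symm k j i, g.chr_symm l j i,
    g.d_dlog_symm s r h j i, g.G_symm j i]
  linear_combination (g.nsq (g.dlog s r) * (kd A l i * g.G j k - kd A l j * g.G i k)) *
    half_add_half (A := A)

include h in
theorem cov1_dlog_symm (i j : Fin n) : g.cov1 (g.dlog s r) i j = g.cov1 (g.dlog s r) j i := by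
  simp only [cov1, g.d_dlog_symm s r h i j, g.chr_symm _ i j]

theorem conf_ric (j k : Fin n) : (g.conf s r h).ric j k = g.ric j k
    + ((n : A) - 2) * g.schDiff (g.dlog s r) j k + g.G j k * g.tr (g.schDiff (g.dlog s r)) := by
  simp only [ric, conf_riemUp, Finset.sum_add_distrib, Finset.sum_sub_distrib, ← Finset.sum_mul,
    sum_kd_self, sum_G_mul_up', sum_kd_mul', ← Finset.mul_sum, ← tr_eq_sum_up]
  ring

theorem conf_scal : (g.conf s r h).scal = s ^ 2 * (g.scal
    + 2 * ((n : A) - 1) * g.tr (g.schDiff (g.dlog s r))) := by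
  have : (g.conf s r h).ric = fun j k => g.ric j k
    + ((n : A) - 2) * g.schDiff (g.dlog s r) j k + g.tr (g.schDiff (g.dlog s r)) * g.G j k := by
    funext j k; rw [conf_ric]; ring
  rw [scal, conf_tr, this, tr_add, tr_add, tr_mul, tr_mul, tr_G, scal]
  ring

theorem conf_sch (hn : 4 ≤ n) (i j : Fin n) : (g.conf s r h).sch i j
    = g.sch i j + g.schDiff (g.dlog s r) i j := by
  rw [sch, sch, conf_ric, conf_scal, conf_G]
  have h2 := const_sub_two (A := A) hn
  have h3 := const_sub_one (A := A) hn
  generalize algebraMap ℝ A (1 / ((n : ℝ) - 2)) = p at *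
  generalize algebraMap ℝ A (1 / (2 * ((n : ℝ) - 1))) = q at *
  generalize g.tr (g.schDiff (g.dlog s r)) = t
  linear_combination g.schDiff (g.dlog s r) i j * h2 - p * g.G i j * t * h3
    - p * q * (g.scal + 2 * ((n : A) - 1) * t) * g.G i j * (s * r + 1) * h

theorem weylUp_eq (l i j k : Fin n) : g.weylUp l i j k = g.riemUp l i j k
    - (kd A l i * g.sch j k + g.G j k * g.up (g.sch i) l - g.G i k * g.up (g.sch j) l
      - kd A l j * g.sch i k) := by
  rw [weylUp, ← up_riem, ← up_G_left, ← up_G_left, ← up_mul_right, ← up_mul_right, ← up_mul,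
    ← up_mul, ← up_add, ← up_sub, ← up_sub, ← up_sub]
  rfl

/-- The change of the curvature is the Kulkarni-Nomizu product of $g$ with `schDiff`, and `schDiff`
is the change of the Schouten tensor; the two contributions cancel. -/
theorem conf_weylUp (hn : 4 ≤ n) (l i j k : Fin n) :
    (g.conf s r h).weylUp l i j k = g.weylUp l i j k := by
  have hu : ∀ i, (g.conf s r h).up ((g.conf s r h).sch i) l
      = s ^ 2 * (g.up (g.sch i) l + g.up (g.schDiff (g.dlog s r) i) l) := fun i => by
    rw [conf_up, ← up_add, show (g.conf s r h).sch i = fun j => g.sch i j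
      + g.schDiff (g.dlog s r) i j from funext fun j => g.conf_sch s r h hn i j]
  rw [weylUp_eq, weylUp_eq, hu, hu, conf_sch _ _ _ _ hn, conf_sch _ _ _ _ hn, conf_riemUp, conf_G,
    conf_G]
  linear_combination (-(g.G j k * (g.up (g.sch i) l + g.up (g.schDiff (g.dlog s r) i) l)
    - g.G i k * (g.up (g.sch j) l + g.up (g.schDiff (g.dlog s r) j) l))) * (s * r + 1) * h

theorem low_weylUp (i j k l : Fin n) : g.low (fun m => g.weylUp m i j k) l = g.weyl i j k l :=
  g.low_up _ _

theorem conf_weyl (hn : 4 ≤ n) (i j k l : Fin n) :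
    (g.conf s r h).weyl i j k l = r ^ 2 * g.weyl i j k l := by
  rw [← low_weylUp, ← low_weylUp, conf_low]
  simp only [g.conf_weylUp s r h hn]

end AlgMetric

/-! ### Contractions of the Weyl tensor and conformal change of its divergences -/

namespace AlgMetric

variable {n : ℕ} {A : Type*} [CommRing A] [Algebra ℝ A] (g : AlgMetric n A)

/-- The contraction `W(·,·,·,u)` of the Weyl tensor with a one-form `u`. -/
def weylContr (u : Fin n → A) (a b c : Fin n) : A := ∑ m, u m * g.weylUp m a b c

theorem weylContr_eq (u : Fin n → A) (a b c : Fin n) :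
    g.weylContr u a b c = ∑ m, g.up u m * g.weyl a b c m := (g.sum_up_mul _ _).symm

theorem weylContr_sub (u v : Fin n → A) (a b c : Fin n) :
    g.weylContr (fun i => u i - v i) a b c = g.weylContr u a b c - g.weylContr v a b c := by
  simp only [weylContr, sub_mul, Finset.sum_sub_distrib]

theorem weylContr_add (u v : Fin n → A) (a b c : Fin n) :
    g.weylContr (fun i => u i + v i) a b c = g.weylContr u a b c + g.weylContr v a b c := by
  simp only [weylContr, add_mul, Finset.sum_add_distrib]

theorem weylContr_antisymm (u : Fin n → A) (a b c : Fin n) :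
    g.weylContr u a b c = -g.weylContr u b a c := by
  simp only [weylContr_eq, ← Finset.sum_neg_distrib]
  exact Finset.sum_congr rfl fun _ _ => by rw [g.weyl_curvLike.antisymm₁]; ring

theorem weylContr_cyclic (u : Fin n → A) (a b c : Fin n) :
    g.weylContr u a b c + g.weylContr u b c a + g.weylContr u c a b = 0 := by
  simp only [weylContr_eq, ← Finset.sum_add_distrib, ← mul_add, g.weyl_curvLike.cyclic, mul_zero,
    Finset.sum_const_zero]

theorem sum_up_mul_weyl₁ (u : Fin n → A) (a b c : Fin n) :
    ∑ m, g.up u m * g.weyl m b c a = g.weylContr u a c b := by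
  rw [weylContr_eq]
  exact Finset.sum_congr rfl fun m _ => by
    rw [g.weyl_curvLike.pair, g.weyl_curvLike.antisymm₁, g.weyl_curvLike.antisymm₂, neg_neg]

theorem sum_up_mul_weyl₂ (u : Fin n → A) (a b c : Fin n) :
    ∑ m, g.up u m * g.weyl a m c b = g.weylContr u c b a := by
  rw [weylContr_eq]
  exact Finset.sum_congr rfl fun m _ => by rw [g.weyl_curvLike.pair]

theorem sum_up_mul_weyl₃ (u : Fin n → A) (a b c : Fin n) :
    ∑ m, g.up u m * g.weyl a b m c = -g.weylContr u a b c := by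
  rw [weylContr_eq, ← Finset.sum_neg_distrib]
  exact Finset.sum_congr rfl fun m _ => by rw [g.weyl_curvLike.antisymm₂]; ring

/-- The action of the Weyl tensor on `(0,2)` tensors. -/
def wOp (b : Fin n → Fin n → A) (k l : Fin n) : A :=
  ∑ p, ∑ q, b p q * ∑ c, ∑ d, g.H p c * g.H q d * g.weyl d k l c

/-- Only one explicit index raising remains next to the invariant `weylUp`, which accounts for the
factor `s ^ 2` in `conf_wOp`. -/
theorem wOp_eq (b : Fin n → Fin n → A) (k l : Fin n) :
    g.wOp b k l = ∑ p, ∑ d, g.up (b p) d * g.weylUp p d k l := by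
  refine Finset.sum_congr rfl fun p _ => ?_
  simp only [up, weylUp, Finset.sum_mul, Finset.mul_sum]
  rw [Finset.sum_congr rfl fun q _ => Finset.sum_comm, Finset.sum_comm]
  refine Finset.sum_congr rfl fun d _ => ?_
  rw [Finset.sum_comm]
  exact Finset.sum_congr rfl fun q _ => Finset.sum_congr rfl fun c _ => by
    rw [g.H_symm d]; ring

theorem wOp_add (b c : Fin n → Fin n → A) (k l : Fin n) :
    g.wOp (fun i j => b i j + c i j) k l = g.wOp b k l + g.wOp c k l := by
  simp only [wOp, add_mul, Finset.sum_add_distrib]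

theorem wOp_sub (b c : Fin n → Fin n → A) (k l : Fin n) :
    g.wOp (fun i j => b i j - c i j) k l = g.wOp b k l - g.wOp c k l := by
  simp only [wOp, sub_mul, Finset.sum_sub_distrib]

theorem wOp_mul (x : A) (b : Fin n → Fin n → A) (k l : Fin n) :
    g.wOp (fun i j => x * b i j) k l = x * g.wOp b k l := by
  simp only [wOp, mul_assoc, ← Finset.mul_sum]

theorem wOp_transpose (b : Fin n → Fin n → A) (k l : Fin n) :
    g.wOp (fun i j => b j i) k l = g.wOp b l k := by
  simp only [wOp]
  rw [Finset.sum_comm]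
  refine Finset.sum_congr rfl fun p _ => Finset.sum_congr rfl fun q _ => ?_
  congr 1
  rw [Finset.sum_comm]
  exact Finset.sum_congr rfl fun c _ => Finset.sum_congr rfl fun d _ => by
    rw [g.weyl_curvLike.pair, g.weyl_curvLike.antisymm₁, g.weyl_curvLike.antisymm₂]; ring

/-- The Weyl tensor is trace-free. Consequently pure-trace terms can be dropped wherever `wOp` is
applied. -/
theorem wOp_G (hn : 4 ≤ n) (k l : Fin n) : g.wOp g.G k l = 0 := by
  rw [wOp_eq, ← g.sum_weylUp_first hn k l]
  refine Finset.sum_congr rfl fun p _ => ?_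
  have : ∀ d, g.up (g.G p) d = kd A d p := g.up_G_left p
  simp only [this, sum_kd_mul']

theorem wOp_tensor (u v : Fin n → A) (k l : Fin n) :
    g.wOp (fun i j => u i * v j) k l = ∑ d, g.up v d * g.weylContr u d k l := by
  simp only [wOp_eq, up_mul, weylContr, Finset.mul_sum]
  rw [Finset.sum_comm]
  exact Finset.sum_congr rfl fun _ _ => Finset.sum_congr rfl fun _ _ => by ring

theorem wOp_tensor_of_left {u : Fin n → A} (hu : ∀ a b c, g.weylContr u a b c = 0)
    (v : Fin n → A) (k l : Fin n) : g.wOp (fun i j => u i * v j) k l = 0 := by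
  simp [wOp_tensor, hu]

theorem wOp_tensor_of_right {v : Fin n → A} (hv : ∀ a b c, g.weylContr v a b c = 0)
    (u : Fin n → A) (k l : Fin n) : g.wOp (fun i j => u i * v j) k l = 0 := by
  rw [show (fun i j => u i * v j) = fun i j => v j * u i from by funext i j; ring,
    g.wOp_transpose (fun i j => v i * u j), wOp_tensor_of_left g hv]

theorem wOp_ric (hn : 4 ≤ n) (k l : Fin n) :
    g.wOp g.ric k l = ((n : A) - 2) * g.wOp g.sch k l := by
  rw [show g.ric = _ from funext fun i => funext fun j => g.ric_eq_sch hn i j, wOp_add, wOp_mul,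
    wOp_mul, wOp_G g hn]
  ring

theorem wOp_symm {b : Fin n → Fin n → A} (hb : ∀ i j, b i j = b j i) (k l : Fin n) :
    g.wOp b k l = g.wOp b l k := by
  rw [← wOp_transpose]
  congr 1
  funext i j
  exact hb j i

theorem cov3_sub (B C : Fin n → Fin n → Fin n → A) (j a b c : Fin n) :
    g.cov3 (fun a b c => B a b c - C a b c) j a b c = g.cov3 B j a b c - g.cov3 C j a b c := by
  simp only [cov3, map_sub, mul_sub, Finset.sum_sub_distrib]; ring

theorem cov3_natCast_sub_mul (x y : ℕ) (B : Fin n → Fin n → Fin n → A) (j a b c : Fin n) :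
    g.cov3 (fun a b c => ((x : A) - y) * B a b c) j a b c = ((x : A) - y) * g.cov3 B j a b c := by
  simp only [cov3, Derivation.leibniz, map_sub, Derivation.map_natCast, smul_eq_mul,
    mul_sub, Finset.mul_sum, mul_left_comm]
  ring

/-- Leibniz rule for a contraction: the Christoffel terms on the contracted index cancel. -/
theorem cov3_contr (u : Fin n → A) (B : Fin n → Fin n → Fin n → Fin n → A) (i a b c : Fin n) :
    g.cov3 (fun a b c => ∑ m, u m * B m a b c) i a b c
      = ∑ m, g.cov1 u i m * B m a b c + ∑ m, u m * g.covU B i m a b c := by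
  have h1 : ∑ m, (∑ q, g.chr q i m * u q) * B m a b c
      = ∑ m, u m * ∑ q, g.chr m i q * B q a b c := by
    simp only [Finset.sum_mul, Finset.mul_sum]
    rw [Finset.sum_comm]
    exact Finset.sum_congr rfl fun _ _ => Finset.sum_congr rfl fun _ _ => by ring
  have h2 : ∀ (a : Fin n) (X : Fin n → Fin n → A), ∑ m, g.chr m i a * ∑ q, u q * X m q
      = ∑ m, u m * ∑ q, g.chr q i a * X q m := fun a X => by
    simp only [Finset.mul_sum]
    rw [Finset.sum_comm]
    exact Finset.sum_congr rfl fun _ _ => Finset.sum_congr rfl fun _ _ => by ring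
  simp only [cov3, h2 a fun m q => B q m b c, h2 b fun m q => B q a m c,
    h2 c fun m q => B q a b m]
  simp only [covU, cov1, mul_sub, mul_add, sub_mul, Finset.sum_sub_distrib,
    Finset.sum_add_distrib, h1, map_sum, Derivation.leibniz, smul_eq_mul]
  have h3 : ∑ m, B m a b c * g.d i (u m) = ∑ m, g.d i (u m) * B m a b c :=
    Finset.sum_congr rfl fun _ _ => mul_comm _ _
  rw [h3]; ring

theorem cov4_reverse {B : Fin n → Fin n → Fin n → Fin n → A}
    (hB : ∀ a b c e, B a b c e = B e c b a) (i a b c e : Fin n) :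
    g.cov4 B i a b c e = g.cov4 B i e c b a := by
  have h1 : ∑ m, g.chr m i a * B m b c e = ∑ m, g.chr m i a * B e c b m :=
    Finset.sum_congr rfl fun m _ => by rw [hB]
  have h2 : ∑ m, g.chr m i b * B a m c e = ∑ m, g.chr m i b * B e c m a :=
    Finset.sum_congr rfl fun m _ => by rw [hB]
  have h3 : ∑ m, g.chr m i c * B a b m e = ∑ m, g.chr m i c * B e m b a :=
    Finset.sum_congr rfl fun m _ => by rw [hB]
  have h4 : ∑ m, g.chr m i e * B a b c m = ∑ m, g.chr m i e * B m c b a :=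
    Finset.sum_congr rfl fun m _ => by rw [hB]
  rw [cov4, cov4, hB a b c e, h1, h2, h3, h4]
  ring

theorem weyl_reverse (a b c e : Fin n) : g.weyl a b c e = g.weyl e c b a := by
  rw [g.weyl_curvLike.pair, g.weyl_curvLike.antisymm₁, g.weyl_curvLike.antisymm₂, neg_neg]

/-- The Leibniz rule splits the divergence of $W(\cdot,\cdot,\cdot,u)$: the derivative falls either
on $u$, giving $\mathcal W(\nabla u)$, or on $W$, where reversing its arguments turns $\delta_1$
into $\delta_4$. -/
theorem tr_cov3_weylContr (u : Fin n → A) (a b : Fin n) :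
    g.tr (fun i j => g.cov3 (g.weylContr u) i j a b)
      = ∑ m, g.up u m * g.divWeyl m b a + g.wOp (g.cov1 u) b a := by
  have h1 : ∀ i j, g.cov3 (g.weylContr u) i j a b
      = ∑ m, g.cov1 u i m * g.weylUp m j a b + ∑ m, g.up u m * g.cov4 g.weyl i m b a j :=
    fun i j => by
      rw [show g.weylContr u = fun a b c => ∑ m, u m * g.weylUp m a b c from rfl, cov3_contr]
      congr 1
      rw [Finset.sum_congr rfl fun m _ => by rw [show g.covU g.weylUp i m j a b =
        g.up (g.cov4 g.weyl i j a b) m from g.covU_up g.weyl i m j a b], ← sum_up_mul]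
      exact Finset.sum_congr rfl fun m _ => by rw [g.cov4_reverse g.weyl_reverse]
  simp only [h1, tr_add, tr_sum, tr_mul]
  rw [add_comm, ← g.wOp_transpose (g.cov1 u) a b]
  congr 1
  rw [wOp_eq]
  refine Finset.sum_congr rfl fun m _ => ?_
  rw [tr_eq_sum_up']
  simp only [up_mul_right]

/-- The second divergence of the Weyl tensor. -/
def divDivWeyl (a b : Fin n) : A := g.tr fun i j => g.cov3 g.divWeyl i j a b

/-- Take the divergence of the identity $W(\cdot,\cdot,\cdot,u)=0$. The derivative of a null form is
thereby traded for $\delta W$. -/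
theorem wOp_cov1_of_null {u : Fin n → A} (hu : ∀ a b c, g.weylContr u a b c = 0) (a b : Fin n) :
    g.wOp (g.cov1 u) a b = -∑ m, g.up u m * g.divWeyl m a b := by
  have h1 : g.tr (fun i j => g.cov3 (g.weylContr u) i j b a) = 0 := by
    rw [show g.weylContr u = fun _ _ _ => 0 from
      funext fun a => funext fun b => funext fun c => hu a b c]
    simp [cov3, tr]
  rw [tr_cov3_weylContr] at h1
  linear_combination h1

theorem divWeyl_antisymm (hn : 4 ≤ n) (a b c : Fin n) : g.divWeyl a b c = -g.divWeyl b a c := by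
  rw [divWeyl_eq_cotton g hn, divWeyl_eq_cotton g hn, cotton_antisymm]; ring

theorem divWeyl_cyclic (hn : 4 ≤ n) (a b c : Fin n) :
    g.divWeyl a b c + g.divWeyl b c a + g.divWeyl c a b = 0 := by
  simp only [divWeyl_eq_cotton g hn]
  linear_combination ((n : A) - 3) * g.cotton_cyclic a b c

theorem tr_divWeyl (hn : 4 ≤ n) (a : Fin n) : g.tr (fun b c => g.divWeyl a b c) = 0 := by
  simp only [divWeyl_eq_cotton g hn, tr_mul, tr_cotton g hn, mul_zero]

section conformal

variable (s r : A) (h : s * r = 1)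

theorem conf_covU (B : Fin n → Fin n → Fin n → Fin n → A) (j l a b c : Fin n) :
    (g.conf s r h).covU B j l a b c = g.covU B j l a b c
      + ∑ m, g.connDiff (g.dlog s r) l j m * B m a b c
      - ∑ m, g.connDiff (g.dlog s r) m j a * B l m b c
      - ∑ m, g.connDiff (g.dlog s r) m j b * B l a m c
      - ∑ m, g.connDiff (g.dlog s r) m j c * B l a b m := by
  simp only [covU, conf_chr, add_mul, Finset.sum_add_distrib, conf_d]; ring

theorem sum_connDiff_mul (f : Fin n → A) (j a : Fin n) (X : Fin n → A) :
    ∑ m, g.connDiff f m j a * X m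
      = g.G j a * (∑ m, g.up f m * X m) - f a * X j - f j * X a := by
  have h1 : ∀ m, g.connDiff f m j a * X m = g.G j a * (g.up f m * X m)
      - f a * (kd A m j * X m) - f j * (kd A m a * X m) := fun m => by rw [connDiff]; ring
  simp only [h1, Finset.sum_sub_distrib, ← Finset.mul_sum, sum_kd_mul']

theorem sum_connDiff_first (f : Fin n → A) (m : Fin n) :
    ∑ i, g.connDiff f i i m = -((n : A) * f m) := by
  have h1 : ∀ i, g.connDiff f i i m = g.G i m * g.up f i - kd A i i * f m - kd A i m * f i :=
    fun i => by rw [connDiff]; ring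
  simp only [h1, Finset.sum_sub_distrib, sum_G_mul_up', sum_kd_mul', ← Finset.sum_mul, sum_kd_self]
  ring

theorem sum_G_mul_weylUp (a m b c : Fin n) : ∑ i, g.G i a * g.weylUp i m b c = g.weyl m b c a := by
  rw [← low_weylUp, low]
  simp only [g.G_symm a]

/-- The contracted upper index contributes $-n$ and each of the three lower indices contributes
$+1$. The other terms vanish, either as traces of $W$ or by the first Bianchi identity. -/
theorem conf_divWeyl (hn : 4 ≤ n) (a b c : Fin n) : (g.conf s r h).divWeyl a b c
    = g.divWeyl a b c - ((n : A) - 3) * g.weylContr (g.dlog s r) a b c := by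
  have hw : (g.conf s r h).weylUp = g.weylUp := funext fun l => funext fun i => funext fun j =>
    funext fun k => g.conf_weylUp s r h hn l i j k
  simp only [divWeyl_eq_sum, hw, conf_covU, sum_connDiff_mul, Finset.sum_sub_distrib,
    Finset.sum_add_distrib]
  generalize g.dlog s r = f
  have h0 : ∑ i, ∑ m, g.connDiff f i i m * g.weylUp m a b c = -((n : A) * g.weylContr f a b c) := by
    rw [Finset.sum_comm]
    simp only [← Finset.sum_mul, sum_connDiff_first, weylContr, Finset.mul_sum,
      ← Finset.sum_neg_distrib]
    exact Finset.sum_congr rfl fun _ _ => by ring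
  have h1 : ∀ (a : Fin n) (X : Fin n → Fin n → A), ∑ i, g.G i a * ∑ m, g.up f m * X i m
      = ∑ m, g.up f m * ∑ i, g.G i a * X i m := fun a X => by
    simp only [Finset.mul_sum]
    rw [Finset.sum_comm]
    exact Finset.sum_congr rfl fun _ _ => Finset.sum_congr rfl fun _ _ => by ring
  rw [h0, h1 a fun i m => g.weylUp i m b c, h1 b fun i m => g.weylUp i a m c,
    h1 c fun i m => g.weylUp i a b m]
  simp only [sum_G_mul_weylUp, sum_up_mul_weyl₁, sum_up_mul_weyl₂, sum_up_mul_weyl₃,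
    ← Finset.mul_sum, g.sum_weylUp_first hn, g.sum_weylUp_second hn, g.sum_weylUp_third]
  have h2 : ∀ a b c, ∑ i, f i * g.weylUp i a b c = g.weylContr f a b c := fun _ _ _ => rfl
  simp only [h2]
  linear_combination g.weylContr_cyclic f a b c - g.weylContr_antisymm f a c b
    - g.weylContr_antisymm f c b a

theorem conf_cov3 (B : Fin n → Fin n → Fin n → A) (j a b c : Fin n) :
    (g.conf s r h).cov3 B j a b c = g.cov3 B j a b c
      - ∑ m, g.connDiff (g.dlog s r) m j a * B m b c
      - ∑ m, g.connDiff (g.dlog s r) m j b * B a m c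
      - ∑ m, g.connDiff (g.dlog s r) m j c * B a b m := by
  simp only [cov3, conf_chr, add_mul, Finset.sum_add_distrib, conf_d]; ring

/-- The change of the divergence in the first argument of a tensor with the symmetries of the
Cotton tensor. -/
theorem tr_conf_cov3 {B : Fin n → Fin n → Fin n → A} (h1 : ∀ a b c, B a b c = -B b a c)
    (h2 : ∀ a b c, B a b c + B b c a + B c a b = 0) (h3 : ∀ a, g.tr (fun b c => B a b c) = 0)
    (a b : Fin n) : g.tr (fun i j => (g.conf s r h).cov3 B i j a b)
      = g.tr (fun i j => g.cov3 B i j a b)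
        + (4 - (n : A)) * ∑ m, g.up (g.dlog s r) m * B m a b
        + ∑ m, g.up (g.dlog s r) m * B m b a := by
  simp only [conf_cov3, sum_connDiff_mul, tr_sub]
  generalize g.dlog s r = f
  have e1 : g.tr (fun i j => g.G i j * ∑ m, g.up f m * B m a b)
      = n * ∑ m, g.up f m * B m a b := by
    rw [← tr_G, mul_comm, ← tr_mul]; congr 1; funext i j; ring
  have e2 : g.tr (fun i j => f j * B i a b) = ∑ m, g.up f m * B m a b := by
    rw [tr_eq_sum_up]; simp only [up_mul_right]
  have e3 : g.tr (fun i j => f i * B j a b) = ∑ m, g.up f m * B m a b := by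
    rw [tr_eq_sum_up']; simp only [up_mul_right]
  have e4 : g.tr (fun i j => f a * B j i b) = 0 :=
    g.tr_antisymm_of _ fun i j => by rw [h1]; ring
  have e5 : g.tr (fun i j => f b * B j a i) = 0 := by
    have : (fun i j => f b * B j a i) = fun i j => -f b * B a j i := by
      funext i j; rw [h1]; ring
    rw [this, tr_mul, g.tr_swap fun j i => B a j i, h3, mul_zero]
  have e6 : ∑ m, g.up f m * B a m b = -∑ m, g.up f m * B m a b := by
    rw [← Finset.sum_neg_distrib]
    exact Finset.sum_congr rfl fun _ _ => by rw [h1]; ring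
  have e7 : ∑ m, g.up f m * B b a m = ∑ m, g.up f m * B m a b - ∑ m, g.up f m * B m b a := by
    rw [← Finset.sum_sub_distrib]
    exact Finset.sum_congr rfl fun m _ => by
      linear_combination g.up f m * h2 b a m - g.up f m * h1 a m b
  rw [e1, e2, e3, e4, e5, g.tr_G_left (fun j => ∑ m, g.up f m * B j m b),
    g.tr_G_left (fun j => ∑ m, g.up f m * B j a m), e6, e7]
  ring

theorem conf_divDivWeyl (hn : 4 ≤ n) (a b : Fin n) : (g.conf s r h).divDivWeyl a b
    = s ^ 2 * (g.divDivWeyl a b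
      - ((n : A) - 4) * (∑ m, g.up (g.dlog s r) m * g.divWeyl m a b
        + ∑ m, g.up (g.dlog s r) m * g.divWeyl m b a)
      - ((n : A) - 3) * g.wOp (g.cov1 (g.dlog s r)) a b
      + ((n : A) - 3) * ((n : A) - 5) * g.wOp (fun i j => g.dlog s r i * g.dlog s r j) a b) := by
  -- Since `s` is invertible, vanishing of the new trace implies vanishing of the old trace, which
  -- is the one required by `tr_conf_cov3`.
  have hs : ∀ X : A, s ^ 2 * X = 0 → X = 0 := fun X hX => by
    linear_combination r ^ 2 * hX - X * (s * r + 1) * h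
  have h3 : ∀ a, g.tr (fun b c => (g.conf s r h).divWeyl a b c) = 0 := fun a => by
    refine hs _ ?_
    rw [← g.conf_tr s r h]
    exact (g.conf s r h).tr_divWeyl hn a
  rw [divDivWeyl, conf_tr, tr_conf_cov3 g s r h ((g.conf s r h).divWeyl_antisymm hn)
    ((g.conf s r h).divWeyl_cyclic hn) h3]
  have h4 : (g.conf s r h).divWeyl = fun a b c => g.divWeyl a b c
      - ((n : A) - (3 : ℕ)) * g.weylContr (g.dlog s r) a b c := by
    funext a b c; push_cast; exact g.conf_divWeyl s r h hn a b c
  have h5 : g.tr (fun i j => g.cov3 (g.conf s r h).divWeyl i j a b) = g.divDivWeyl a b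
      - ((n : A) - 3) * (∑ m, g.up (g.dlog s r) m * g.divWeyl m b a
        + g.wOp (g.cov1 (g.dlog s r)) b a) := by
    rw [h4]
    simp only [cov3_sub, cov3_natCast_sub_mul, tr_sub, tr_mul]
    rw [show (fun i j => g.cov3 (fun a b c => g.weylContr (g.dlog s r) a b c) i j a b)
      = fun i j => g.cov3 (g.weylContr (g.dlog s r)) i j a b from rfl, tr_cov3_weylContr]
    push_cast
    rfl
  have h6 : ∀ a b, ∑ m, g.up (g.dlog s r) m * (g.conf s r h).divWeyl m a b
      = ∑ m, g.up (g.dlog s r) m * g.divWeyl m a b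
        - ((n : A) - 3) * g.wOp (fun i j => g.dlog s r i * g.dlog s r j) a b := fun a b => by
    rw [wOp_tensor, Finset.mul_sum, ← Finset.sum_sub_distrib]
    exact Finset.sum_congr rfl fun m _ => by rw [conf_divWeyl _ _ _ _ hn]; ring
  rw [h5, h6, h6, g.wOp_symm (g.cov1_dlog_symm s r h) b a,
    g.wOp_symm (fun i j => mul_comm (g.dlog s r i) (g.dlog s r j)) b a]
  ring

theorem conf_wOp (hn : 4 ≤ n) (b : Fin n → Fin n → A) (k l : Fin n) :
    (g.conf s r h).wOp b k l = s ^ 2 * g.wOp b k l := by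
  simp only [wOp_eq, conf_up, g.conf_weylUp s r h hn, mul_assoc, ← Finset.mul_sum]

theorem conf_weylContr (hn : 4 ≤ n) (u : Fin n → A) (a b c : Fin n) :
    (g.conf s r h).weylContr u a b c = g.weylContr u a b c := by
  simp only [weylContr, g.conf_weylUp s r h hn]

end conformal

end AlgMetric

/-! ### Conformal invariance of the generalized Bach tensor -/

namespace AlgMetric

variable {n : ℕ} {A : Type*} [CommRing A] [Algebra ℝ A] (g : AlgMetric n A)

/-- The tensor `C_𝕋`, where the one-form `t` is `𝕋*`. -/
def cottonT (t : Fin n → A) (a b c : Fin n) : A := g.cotton a b c - g.weylContr t a b c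

/-- The conformal Ricci tensor `E_𝕋`, where the one-form `t` is `𝕋*`. -/
def confRicciT (t : Fin n → A) (i j : Fin n) : A :=
  g.ric i j - algebraMap ℝ A (1 / (n : ℝ)) * g.scal * g.G i j
    + algebraMap ℝ A ((n : ℝ) - 2) * (g.cov1 t i j + t i * t j
      - algebraMap ℝ A (1 / (n : ℝ)) * (g.tr (g.cov1 t) + g.nsq t) * g.G i j)

/-- The symmetrization of a bilinear form. -/
def symm (b : Fin n → Fin n → A) (i j : Fin n) : A := b i j + b j i

/-- The generalized Bach tensor, where the one-form `t` is `𝕋*`. -/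
def genBach (t : Fin n → A) (i j : Fin n) : A :=
  g.divDivWeyl i j
    + algebraMap ℝ A (((n : ℝ) - 3) / ((n : ℝ) - 2)) * g.wOp g.ric i j
    - algebraMap ℝ A (((n : ℝ) - 4) / ((n : ℝ) - 2)) * g.wOp (symm (g.confRicciT t)) i j
    - algebraMap ℝ A (((n : ℝ) - 3) * ((n : ℝ) - 4)) * (g.wOp (fun a b => t a * t b) i j
      + symm (fun a b => ∑ d, g.up t d * g.cottonT t d a b) i j)

theorem wOp_symm_eq (b : Fin n → Fin n → A) (k l : Fin n) :
    g.wOp (symm b) k l = g.wOp b k l + g.wOp b l k := by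
  rw [show symm b = fun i j => b i j + b j i from rfl, wOp_add,
    g.wOp_transpose b]

theorem wOp_confRicciT (hn : 4 ≤ n) (t : Fin n → A) (k l : Fin n) :
    g.wOp (g.confRicciT t) k l = ((n : A) - 2) *
      (g.wOp g.sch k l + g.wOp (g.cov1 t) k l + g.wOp (fun i j => t i * t j) k l) := by
  simp only [show g.confRicciT t = fun i j => g.ric i j - algebraMap ℝ A (1 / (n : ℝ)) * g.scal *
    g.G i j + algebraMap ℝ A ((n : ℝ) - 2) * (g.cov1 t i j + t i * t j
      - algebraMap ℝ A (1 / (n : ℝ)) * (g.tr (g.cov1 t) + g.nsq t) * g.G i j) from rfl,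
    wOp_add, wOp_sub, wOp_mul]
  rw [wOp_G g hn, wOp_ric g hn, map_sub, map_natCast, map_ofNat]
  ring

/-- The trace parts of `confRicciT` drop out by `wOp_G` and the factors $n-2$ cancel; what remains
is linear in quantities whose conformal change is known. -/
theorem genBach_eq (hn : 4 ≤ n) (t : Fin n → A) (i j : Fin n) : g.genBach t i j =
    g.divDivWeyl i j + ((n : A) - 3) * g.wOp g.sch i j
    - ((n : A) - 4) * (2 * g.wOp g.sch i j + g.wOp (g.cov1 t) i j + g.wOp (g.cov1 t) j i
      + 2 * g.wOp (fun a b => t a * t b) i j)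
    - ((n : A) - 3) * ((n : A) - 4) * (g.wOp (fun a b => t a * t b) i j
      + ∑ d, g.up t d * g.cottonT t d i j + ∑ d, g.up t d * g.cottonT t d j i) := by
  rw [genBach, wOp_symm_eq, wOp_confRicciT g hn, wOp_confRicciT g hn, wOp_ric g hn, symm,
    div_eq_mul_one_div, div_eq_mul_one_div ((n : ℝ) - 4)]
  simp only [map_mul, map_sub, map_natCast, map_ofNat]
  rw [g.wOp_symm (fun i j => mul_comm (t i) (t j)) j i, g.wOp_symm g.sch_symm j i]
  linear_combination (((n : A) - 3) * g.wOp g.sch i j - ((n : A) - 4) * (2 * g.wOp g.sch i j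
    + g.wOp (g.cov1 t) i j + g.wOp (g.cov1 t) j i + 2 * g.wOp (fun a b => t a * t b) i j))
    * const_sub_two (A := A) hn

variable (s r : A) (h : s * r = 1)

theorem conf_cov1 (u : Fin n → A) (i j : Fin n) : (g.conf s r h).cov1 u i j = g.cov1 u i j
    - g.G i j * (∑ m, g.up (g.dlog s r) m * u m) + u i * g.dlog s r j + g.dlog s r i * u j := by
  simp only [cov1, conf_chr, add_mul, Finset.sum_add_distrib, conf_d, sum_connDiff_mul]
  ring

theorem cov1_add (u v : Fin n → A) (i j : Fin n) :
    g.cov1 (fun a => u a + v a) i j = g.cov1 u i j + g.cov1 v i j := by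
  simp only [cov1, map_add, mul_add, Finset.sum_add_distrib]; ring

theorem cov1_sub (u v : Fin n → A) (i j : Fin n) :
    g.cov1 (fun a => u a - v a) i j = g.cov1 u i j - g.cov1 v i j := by
  simp only [cov1, map_sub, mul_sub, Finset.sum_sub_distrib]; ring

theorem const_sub_three (hn : 4 ≤ n) :
    ((n : A) - 3) * algebraMap ℝ A (1 / ((n : ℝ) - 3)) = 1 := by
  have h : (4 : ℝ) ≤ n := by exact_mod_cast hn
  rw [← map_natCast (algebraMap ℝ A), ← map_ofNat (algebraMap ℝ A) 3, ← map_sub, ← map_mul,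
    mul_one_div_cancel (by linarith), map_one]

/-- This follows from `conf_divWeyl` on dividing by $n-3$, which is invertible for $n\ge4$. -/
theorem conf_cotton (hn : 4 ≤ n) (a b c : Fin n) : (g.conf s r h).cotton a b c
    = g.cotton a b c - g.weylContr (g.dlog s r) a b c := by
  have h1 := g.conf_divWeyl s r h hn a b c
  rw [divWeyl_eq_cotton _ hn, divWeyl_eq_cotton _ hn] at h1
  linear_combination algebraMap ℝ A (1 / ((n : ℝ) - 3)) * h1 - ((g.conf s r h).cotton a b c
    - g.cotton a b c + g.weylContr (g.dlog s r) a b c) * const_sub_three (A := A) hn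

/-- Conformal invariance of the generalized Bach tensor, if the one-forms `t` and `t'` transform
like a gradient up to an error in the null space of the Weyl tensor. -/
theorem conf_genBach (hn : 4 ≤ n) (t t' u : Fin n → A)
    (ht : ∀ i, t' i = t i - g.dlog s r i + u i) (hu : ∀ a b c, g.weylContr u a b c = 0)
    (i j : Fin n) : (g.conf s r h).genBach t' i j = s ^ 2 * g.genBach t i j := by
  -- The Cotton tensor and $W(t)$ both lose $W(f)$, and $W(u)=0$.
  have hC : ∀ a b c, (g.conf s r h).cottonT t' a b c = g.cottonT t a b c := fun a b c => by
    have e : t' = fun i => t i - g.dlog s r i + u i := funext ht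
    rw [cottonT, cottonT, conf_cotton _ _ _ _ hn, conf_weylContr _ _ _ _ hn, e, weylContr_add,
      weylContr_sub, hu]
    ring
  have hW : ∀ (v w : Fin n → A) a b, ∑ d, g.up v d * g.weylContr w d a b = g.wOp (fun i j => w i * v j) a b :=
    fun v w a b => (g.wOp_tensor w v a b).symm
  -- Contracting $C_t$ with a form `v` gives $\delta W$ up to a quadratic term. It is used for `v =
  -- dlog`, to match the change of $\delta_1\delta_4W$, and for `v = u`.
  have hD : ∀ (v : Fin n → A) a b, ((n : A) - 3) * ∑ d, g.up v d * g.cottonT t d a b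
      = ∑ d, g.up v d * g.divWeyl d a b
        - ((n : A) - 3) * g.wOp (fun i j => t i * v j) a b := fun v a b => by
    rw [← hW, Finset.mul_sum, Finset.mul_sum, ← Finset.sum_sub_distrib]
    exact Finset.sum_congr rfl fun d _ => by rw [cottonT, divWeyl_eq_cotton _ hn]; ring
  have hS : ∀ a b, ∑ d, (g.conf s r h).up t' d * (g.conf s r h).cottonT t' d a b
      = s ^ 2 * (∑ d, g.up t d * g.cottonT t d a b
        - ∑ d, g.up (g.dlog s r) d * g.cottonT t d a b
        + ∑ d, g.up u d * g.cottonT t d a b) := fun a b => by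
    rw [← Finset.sum_sub_distrib, ← Finset.sum_add_distrib, Finset.mul_sum]
    refine Finset.sum_congr rfl fun d _ => ?_
    rw [hC, conf_up, show t' = fun i => t i - g.dlog s r i + u i from funext ht, up_add, up_sub]
    ring
  -- The derivative of the error `u` does not vanish under `wOp`; it leaves a $\delta W$ term.
  have hcov : ∀ a b, g.wOp (g.cov1 t') a b = g.wOp (g.cov1 t) a b
      - g.wOp (g.cov1 (g.dlog s r)) a b - ∑ m, g.up u m * g.divWeyl m a b := fun a b => by
    have e : g.cov1 t' = fun i j => g.cov1 t i j - g.cov1 (g.dlog s r) i j + g.cov1 u i j := by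
      funext i j
      rw [← cov1_sub, ← cov1_add, show t' = _ from funext ht]
    rw [e, wOp_add, wOp_sub, g.wOp_cov1_of_null hu]
    ring
  have hl : ∀ (v : Fin n → A) a b, g.wOp (fun i j => t' i * v j) a b = g.wOp (fun i j => t i * v j) a b
      - g.wOp (fun i j => g.dlog s r i * v j) a b := fun v a b => by
    simp only [ht, add_mul, sub_mul, wOp_add, wOp_sub, g.wOp_tensor_of_left hu, add_zero]
  have hr : ∀ (v : Fin n → A) a b, g.wOp (fun i j => v i * t' j) a b = g.wOp (fun i j => v i * t j) a b
      - g.wOp (fun i j => v i * g.dlog s r j) a b := fun v a b => by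
    simp only [ht, mul_add, mul_sub, wOp_add, wOp_sub, g.wOp_tensor_of_right hu, add_zero]
  have hcov' : ∀ a b, g.wOp ((g.conf s r h).cov1 t') a b = g.wOp (g.cov1 t') a b
      + g.wOp (fun i j => t' i * g.dlog s r j) a b
      + g.wOp (fun i j => g.dlog s r i * t' j) a b := fun a b => by
    have e : (g.conf s r h).cov1 t' = fun i j => g.cov1 t' i j
        - (∑ m, g.up (g.dlog s r) m * t' m) * g.G i j + t' i * g.dlog s r j
        + g.dlog s r i * t' j := by
      funext i j; rw [conf_cov1]; ring
    rw [e, wOp_add, wOp_add, wOp_sub, wOp_mul, wOp_G g hn]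
    ring
  have hk : g.wOp (g.conf s r h).sch i j = g.wOp g.sch i j + g.wOp (g.cov1 (g.dlog s r)) i j
      + g.wOp (fun i j => g.dlog s r i * g.dlog s r j) i j := by
    have e : (g.conf s r h).sch = fun i j => g.sch i j + (g.cov1 (g.dlog s r) i j
        + g.dlog s r i * g.dlog s r j - algebraMap ℝ A (1 / 2) * g.nsq (g.dlog s r) * g.G i j) :=
      funext fun i => funext fun j => g.conf_sch s r h hn i j
    rw [e, wOp_add, wOp_sub, wOp_add, wOp_mul, wOp_G g hn]
    ring
  have hfs : g.wOp (g.cov1 (g.dlog s r)) j i = g.wOp (g.cov1 (g.dlog s r)) i j :=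
    g.wOp_symm (g.cov1_dlog_symm s r h) j i
  have hff : g.wOp (fun i j => g.dlog s r i * g.dlog s r j) j i
      = g.wOp (fun i j => g.dlog s r i * g.dlog s r j) i j :=
    g.wOp_symm (fun i j => mul_comm _ _) j i
  have htt : g.wOp (fun i j => t i * g.dlog s r j) j i
      = g.wOp (fun i j => g.dlog s r i * t j) i j := by
    rw [← g.wOp_transpose fun i j => t i * g.dlog s r j]
    congr 1; funext i j; ring
  have htt' : g.wOp (fun i j => g.dlog s r i * t j) j i
      = g.wOp (fun i j => t i * g.dlog s r j) i j := by
    rw [← g.wOp_transpose fun i j => g.dlog s r i * t j]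
    congr 1; funext i j; ring
  have hut : ∀ a b, g.wOp (fun i j => t i * u j) a b = 0 := fun a b =>
    g.wOp_tensor_of_right hu t a b
  rw [genBach_eq _ hn, genBach_eq _ hn, conf_divDivWeyl _ _ _ _ hn]
  simp only [conf_wOp _ _ _ _ hn, hS, hk, hcov', hcov, hl, hr, hfs, hff, htt, htt']
  have d1 := hD (g.dlog s r) i j
  have d2 := hD (g.dlog s r) j i
  have d3 := hD u i j
  have d4 := hD u j i
  rw [hut] at d3 d4
  rw [htt] at d2
  -- The relations `d1`, `d2` absorb the terms with $f$; `d3`, `d4` cancel $\mathcal W(\nabla u)$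
  -- against $C_t(u^\#,\cdot,\cdot)$, both symmetrised.
  linear_combination s ^ 2 * ((n : A) - 4) * (d1 + d2 - d3 - d4)

end AlgMetric

/-! ### Moore-Penrose inverses of self-adjoint matrices -/

section MoorePenrose

variable {n : ℕ} {H M L N Q : Matrix (Fin n) (Fin n) ℝ}

theorem eq_zero_of_transpose_mul_mul (hH : H.PosDef) {Z : Matrix (Fin n) (Fin n) ℝ}
    (h : Z.transpose * H * Z = 0) : Z = 0 := by
  ext i j
  by_contra hij
  have hv : (fun k => Z k j) ≠ 0 := fun h0 => hij (congrFun h0 i)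
  have := hH.dotProduct_mulVec_pos hv
  have h1 := congrFun (congrFun h j) j
  rw [Matrix.mul_assoc, Matrix.mul_apply] at h1
  simp only [dotProduct, Matrix.mulVec] at this
  simp only [Matrix.mul_apply, Matrix.transpose_apply, Matrix.zero_apply] at h1
  simp only [Pi.star_apply, star_trivial] at this
  linarith

/-- For `M` self-adjoint with respect to `H`, $\langle MY,MY\rangle = \langle Y,M^2Y\rangle$, hence
$\ker M^2 = \ker M$. -/
theorem mul_cancel_left (hH : H.PosDef) (hM : M.transpose * H = H * M)
    {Y : Matrix (Fin n) (Fin n) ℝ} (h : M * (M * Y) = 0) : M * Y = 0 := by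
  refine eq_zero_of_transpose_mul_mul hH ?_
  rw [Matrix.transpose_mul, Matrix.mul_assoc Y.transpose, hM, Matrix.mul_assoc, Matrix.mul_assoc,
    h, Matrix.mul_zero, Matrix.mul_zero]

/-- The `H`-adjoint of `mul_cancel_left`. -/
theorem mul_cancel_right (hH : H.PosDef) (hM : M.transpose * H = H * M)
    {Y : Matrix (Fin n) (Fin n) ℝ} (h : Y * M * M = 0) : Y * M = 0 := by
  have hu : IsUnit H.det := hH.isUnit.map Matrix.detMonoidHom
  have hM' : M.transpose = H * M * H⁻¹ := by
    rw [← hM, Matrix.mul_nonsing_inv_cancel_right _ _ hu]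
  have h1 : H * (M * (M * (H⁻¹ * Y.transpose))) = 0 := by
    have := congrArg Matrix.transpose h
    rw [Matrix.transpose_mul, Matrix.transpose_mul, hM', Matrix.transpose_zero] at this
    simpa only [Matrix.mul_assoc, Matrix.nonsing_inv_mul_cancel_left _ _ hu] using this
  have h2 := congrArg (H⁻¹ * ·) h1
  simp only [Matrix.nonsing_inv_mul_cancel_left _ _ hu, Matrix.mul_zero] at h2
  have h3 := mul_cancel_left hH hM h2
  have h4 : (Y * M).transpose = 0 := by
    rw [Matrix.transpose_mul, hM', Matrix.mul_assoc, Matrix.mul_assoc, h3, Matrix.mul_zero]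
  simpa using congrArg Matrix.transpose h4

theorem mul_cancel_both (hH : H.PosDef) (hM : M.transpose * H = H * M)
    {Y : Matrix (Fin n) (Fin n) ℝ} (h : M * M * M * Y * (M * M * M) = 0) : M * Y * M = 0 := by
  have h1 : M * (M * (M * Y * (M * M * M))) = 0 := by simpa only [Matrix.mul_assoc] using h
  have h2 : M * (M * (Y * (M * M * M))) = 0 := by
    simpa only [Matrix.mul_assoc] using mul_cancel_left hH hM h1
  have h3 : (M * Y * M) * M * M = 0 := by
    simpa only [Matrix.mul_assoc] using mul_cancel_left hH hM h2
  have h4 : (M * Y) * M * M = 0 := mul_cancel_right hH hM h3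
  exact mul_cancel_right hH hM h4

theorem sq_mul_mul_sq (hH : H.PosDef) (hM : M.transpose * H = H * M)
    (hL : M * M * M * L * (M * M * M) = M * M * M) : M * M * L * (M * M) = M := by
  have h1 : M * (M * (M * (L * (M * M * M) - 1))) = 0 := by
    have : M * (M * (M * (L * (M * M * M) - 1))) = M * M * M * L * (M * M * M) - M * M * M := by
      noncomm_ring
    rw [this, hL, sub_self]
  have h2 : (M * M * L * M - 1) * M * M = 0 := by
    have := mul_cancel_left hH hM h1
    rw [← this]
    noncomm_ring
  have h3 := mul_cancel_right hH hM h2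
  rw [← sub_eq_zero, ← h3]
  noncomm_ring

/-- The space is the orthogonal sum of $\ker M$ and $\operatorname{im} M$, and `M` is invertible on
the latter. The hypothesis forces the compression of `L` to $\operatorname{im} M$ to be $M^{-3}$, so
$MLM$ is $M^{-1}$ there and vanishes on $\ker M$. The cube makes this work for an arbitrary
generalized inverse `L`, self-adjoint or not. -/
theorem isMoorePenrose_of_reg (hH : H.PosDef) (hM : M.transpose * H = H * M)
    (hL : M * M * M * L * (M * M * M) = M * M * M) : IsMoorePenrose H M (M * L * M) := by
  have hu : IsUnit H.det := hH.isUnit.map Matrix.detMonoidHom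
  have hs := sq_mul_mul_sq hH hM hL
  have hcomm : M * (M * L * M) = M * L * M * M := by
    have : M * (M * L - L * M) * M = 0 := by
      refine mul_cancel_both hH hM ?_
      have : M * M * M * (M * L - L * M) * (M * M * M) =
          M * (M * M * M * L * (M * M * M)) - M * M * M * L * (M * M * M) * M := by noncomm_ring
      rw [this, hL]
      noncomm_ring
    rw [← sub_eq_zero, ← this]
    noncomm_ring
  -- `L'` is the `H`-adjoint of `L`. It is again a generalized inverse of $M^3$, and cancelling `M`
  -- on both sides gives $ML'M = MLM$.
  obtain ⟨L', hL'⟩ : ∃ L', L.transpose * H = H * L' :=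
    ⟨H⁻¹ * (L.transpose * H), by rw [Matrix.mul_nonsing_inv_cancel_left _ _ hu]⟩
  have hM1 : ∀ X, M.transpose * (H * X) = H * (M * X) := fun X => by
    rw [← Matrix.mul_assoc, hM, Matrix.mul_assoc]
  have hL1 : ∀ X, L.transpose * (H * X) = H * (L' * X) := fun X => by
    rw [← Matrix.mul_assoc, hL', Matrix.mul_assoc]
  have hL2 : M * M * M * L' * (M * M * M) = M * M * M := by
    have h4 := congrArg (fun X => H⁻¹ * (X.transpose * H)) hL
    simp only [Matrix.transpose_mul, Matrix.mul_assoc, hM, hM1, hL1,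
      Matrix.nonsing_inv_mul_cancel_left _ _ hu] at h4
    simpa only [Matrix.mul_assoc] using h4
  have hLL : M * L' * M = M * L * M := by
    rw [← sub_eq_zero]
    have : M * (L' - L) * M = 0 := by
      refine mul_cancel_both hH hM ?_
      rw [Matrix.mul_sub, Matrix.sub_mul, hL, hL2, sub_self]
    rw [← this]
    noncomm_ring
  have hsym : (M * (M * L * M)).transpose * H = H * (M * (M * L * M)) := by
    have e : (M * (M * L * M)).transpose * H = H * (M * L' * M * M) := by
      simp only [Matrix.transpose_mul, Matrix.mul_assoc, hM, hM1, hL1]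
    rw [e, hLL, hcomm]
  refine ⟨?_, ?_, hsym, ?_⟩
  · simpa only [Matrix.mul_assoc] using hs
  · have h1 : M * (M * (L * (M * M * M) - 1)) = 0 := by
      refine mul_cancel_left hH hM ?_
      have : M * (M * (M * (L * (M * M * M) - 1)))
          = M * M * M * L * (M * M * M) - M * M * M := by noncomm_ring
      rw [this, hL, sub_self]
    have h2 := mul_cancel_left hH hM h1
    have h3 : M * L * M * M * (M * L * M) = M * L * M + M * (L * (M * M * M) - 1) * (L * M) := by
      noncomm_ring
    rw [h3, h2, Matrix.zero_mul, add_zero]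
  · rw [← hcomm]; exact hsym

theorem IsMoorePenrose.eq_of_reg (hH : H.PosDef) (hM : M.transpose * H = H * M)
    (hL : M * M * M * L * (M * M * M) = M * M * M) {B : Matrix (Fin n) (Fin n) ℝ}
    (hB : IsMoorePenrose H M B) : B = M * L * M := by
  have hu : IsUnit H.det := hH.isUnit.map Matrix.detMonoidHom
  obtain ⟨h1, h2, h3, h4⟩ := hB
  obtain ⟨B', hB'⟩ : ∃ B', B.transpose * H = H * B' :=
    ⟨H⁻¹ * (B.transpose * H), by rw [Matrix.mul_nonsing_inv_cancel_left _ _ hu]⟩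
  have hinj : ∀ X Y, H * X = H * Y → X = Y := fun X Y hXY => by
    have := congrArg (H⁻¹ * ·) hXY
    simpa only [Matrix.nonsing_inv_mul_cancel_left _ _ hu] using this
  have e1 : B' * M = M * B := by
    refine hinj _ _ ?_
    rw [← h3, Matrix.transpose_mul, Matrix.mul_assoc, hM, ← Matrix.mul_assoc, ← Matrix.mul_assoc,
      hB']
  have e2 : M * B' = B * M := by
    refine hinj _ _ ?_
    rw [← h4, Matrix.transpose_mul, Matrix.mul_assoc, hB', ← Matrix.mul_assoc, ← Matrix.mul_assoc,
      hM]
  -- The Penrose equations put `B` in the form $MXM$, and for such matrices $MBM = M$ determines the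
  -- middle factor up to what `M` kills on both sides.
  have e3 : B = M * (B' * B * M * B * B') * M := by
    calc B = B * M * B := h2.symm
      _ = (B * M * B) * M * (B * (M * B)) := by rw [← Matrix.mul_assoc B M B, h2, h2]
      _ = (M * B' * B) * M * (B * (B' * M)) := by rw [e1, e2]
      _ = _ := by simp only [Matrix.mul_assoc]
  have hs := sq_mul_mul_sq hH hM hL
  generalize B' * B * M * B * B' = X at e3
  rw [e3] at h1 ⊢
  have : M * (X - L) * M = 0 := by
    refine mul_cancel_both hH hM ?_
    have : M * M * M * (X - L) * (M * M * M)
        = M * (M * (M * X * M) * M) * M - M * (M * M * L * (M * M)) * M := by noncomm_ring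
    rw [this, h1, hs, sub_self]
  rw [← sub_eq_zero, ← this]
  noncomm_ring

theorem moorePenrose_eq_of_reg (hH : H.PosDef) (hM : M.transpose * H = H * M)
    (hL : M * M * M * L * (M * M * M) = M * M * M) : moorePenrose H M = M * L * M :=
  IsMoorePenrose.eq_of_reg hH hM hL
    (Classical.epsilon_spec ⟨_, isMoorePenrose_of_reg hH hM hL⟩)

/-- On $\ker N$ the matrix $(N+Q)^{-1}Q$ is the identity, so its range contains $\ker N$; the rank
bound forces equality, whence $N(N+Q)^{-1}Q = 0$. When `N` varies with `Q` fixed, the first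
hypothesis is open and the second persists as long as the rank of `N` is constant. -/
theorem mul_inv_mul_of_finrank (hu : IsUnit (N + Q).det)
    (hr : Module.finrank ℝ (LinearMap.range Q.mulVecLin)
      ≤ Module.finrank ℝ (LinearMap.ker N.mulVecLin)) : N * (N + Q)⁻¹ * N = N := by
  have h1 : LinearMap.ker N.mulVecLin ≤ LinearMap.range ((N + Q)⁻¹ * Q).mulVecLin := by
    intro v hv
    refine ⟨v, ?_⟩
    rw [LinearMap.mem_ker, Matrix.mulVecLin_apply] at hv
    have : (N + Q).mulVec v = Q.mulVec v := by rw [Matrix.add_mulVec, hv, zero_add]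
    rw [Matrix.mulVecLin_apply, ← Matrix.mulVec_mulVec, ← this, Matrix.mulVec_mulVec,
      Matrix.nonsing_inv_mul _ hu, Matrix.one_mulVec]
  have h2 : LinearMap.ker N.mulVecLin = LinearMap.range ((N + Q)⁻¹ * Q).mulVecLin := by
    refine Submodule.eq_of_le_of_finrank_le h1 (le_trans ?_ hr)
    rw [Matrix.mulVecLin_mul, LinearMap.range_comp]
    exact Submodule.finrank_map_le _ _
  have h3 : N * ((N + Q)⁻¹ * Q) = 0 := by
    refine Matrix.mulVec_injective ?_
    funext v
    have : ((N + Q)⁻¹ * Q).mulVec v ∈ LinearMap.ker N.mulVecLin := by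
      rw [h2]; exact ⟨v, rfl⟩
    rw [LinearMap.mem_ker, Matrix.mulVecLin_apply, Matrix.mulVec_mulVec] at this
    rw [this, Matrix.zero_mulVec]
  calc N * (N + Q)⁻¹ * N = N * ((N + Q)⁻¹ * (N + Q)) - N * ((N + Q)⁻¹ * Q) := by noncomm_ring
    _ = N := by rw [Matrix.nonsing_inv_mul _ hu, h3, Matrix.mul_one, sub_zero]

theorem exists_isUnit_add (N : Matrix (Fin n) (Fin n) ℝ) : ∃ Q : Matrix (Fin n) (Fin n) ℝ,
    IsUnit (N + Q).det ∧ Module.finrank ℝ (LinearMap.range Q.mulVecLin)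
      ≤ Module.finrank ℝ (LinearMap.ker N.mulVecLin) := by
  set f := N.mulVecLin with hf
  obtain ⟨C, hC⟩ := Submodule.exists_isCompl (LinearMap.ker f)
  obtain ⟨R, hR⟩ := Submodule.exists_isCompl (LinearMap.range f)
  have hfin : Module.finrank ℝ (LinearMap.ker f) = Module.finrank ℝ R := by
    have e1 := Submodule.finrank_add_eq_of_isCompl hR
    have e2 := LinearMap.finrank_range_add_finrank_ker f
    omega
  let e := LinearEquiv.ofFinrankEq _ _ hfin
  -- Project onto $\ker N$ along `C`, then map $\ker N$ isomorphically onto a complement `R` of the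
  -- range.
  let q : (Fin n → ℝ) →ₗ[ℝ] (Fin n → ℝ) :=
    R.subtype ∘ₗ e.toLinearMap ∘ₗ Submodule.projectionOnto _ _ hC
  have hq : (LinearMap.toMatrix' q).mulVecLin = q := by
    rw [← Matrix.toLin'_apply', Matrix.toLin'_toMatrix']
  refine ⟨LinearMap.toMatrix' q, ?_, ?_⟩
  · rw [← Matrix.isUnit_iff_isUnit_det, ← Matrix.mulVec_injective_iff_isUnit]
    have hinj : Function.Injective (f + q) := by
      rw [injective_iff_map_eq_zero]
      intro v hv
      have h1 : f v = -q v := eq_neg_of_add_eq_zero_left hv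
      have h2 : q v ∈ R := Subtype.coe_prop _
      have h3 : f v ∈ R := h1 ▸ R.neg_mem h2
      have h4 : f v = 0 := Submodule.disjoint_def.1 hR.disjoint _ ⟨v, rfl⟩ h3
      have h5 : q v = 0 := by rw [h4] at h1; simpa using h1.symm
      have h6 : Submodule.projectionOnto _ _ hC v = 0 := by
        have : e (Submodule.projectionOnto _ _ hC v) = 0 := Subtype.ext h5
        simpa using this
      have h7 : v ∈ C := (Submodule.projectionOnto_apply_eq_zero_iff hC).1 h6
      exact Submodule.disjoint_def.1 hC.disjoint _ h4 h7
    intro v w hvw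
    apply hinj
    have : (N + LinearMap.toMatrix' q).mulVecLin = f + q := by
      rw [Matrix.mulVecLin_add, hq]
    rw [← this]
    exact hvw
  · rw [hq, hfin]
    refine le_trans (Submodule.finrank_mono (LinearMap.range_comp_le_range _ _)) ?_
    rw [Submodule.range_subtype]

theorem exists_reg (N : Matrix (Fin n) (Fin n) ℝ) :
    ∃ L : Matrix (Fin n) (Fin n) ℝ, N * L * N = N := by
  obtain ⟨Q, h1, h2⟩ := exists_isUnit_add N
  exact ⟨_, mul_inv_mul_of_finrank h1 h2⟩

theorem isMoorePenrose_moorePenrose (hH : H.PosDef) (hM : M.transpose * H = H * M) :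
    IsMoorePenrose H M (moorePenrose H M) := by
  obtain ⟨L, hL⟩ := exists_reg (M * M * M)
  exact Classical.epsilon_spec ⟨_, isMoorePenrose_of_reg hH hM hL⟩

theorem IsMoorePenrose.eq (hH : H.PosDef) (hM : M.transpose * H = H * M)
    {B : Matrix (Fin n) (Fin n) ℝ} (hB : IsMoorePenrose H M B) : moorePenrose H M = B := by
  obtain ⟨L, hL⟩ := exists_reg (M * M * M)
  rw [moorePenrose_eq_of_reg hH hM hL, hB.eq_of_reg hH hM hL]

theorem moorePenrose_smul (hH : H.PosDef) (hM : M.transpose * H = H * M) {a b : ℝ} (ha : 0 < a)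
    (hb : b ≠ 0) : moorePenrose (a • H) (b • M) = b⁻¹ • moorePenrose H M := by
  obtain ⟨h1, h2, h3, h4⟩ := isMoorePenrose_moorePenrose hH hM
  have hH' : (a • H).PosDef := hH.smul ha
  refine IsMoorePenrose.eq hH' (by simp [hM, smul_comm a b]) ⟨?_, ?_, ?_, ?_⟩
  · simp [h1, smul_smul, hb]
  · simp [h2, smul_smul, hb]
  · simp [smul_smul, hb] at h3 ⊢; rw [h3]
  · simp [smul_smul, hb] at h4 ⊢; rw [h4]

theorem ker_mulVecLin_cube (hH : H.PosDef) (hM : M.transpose * H = H * M) :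
    LinearMap.ker (M * M * M).mulVecLin = LinearMap.ker M.mulVecLin := by
  have h1 : ∀ v, M.mulVec (M.mulVec v) = 0 → M.mulVec v = 0 := fun v hv => by
    have h2 : M * (M * Matrix.of fun i (_ : Fin n) => v i) = 0 := by
      ext i j
      exact congrFun hv i
    have h3 := mul_cancel_left hH hM h2
    funext i
    exact congrFun (congrFun h3 i) i
  ext v
  simp only [LinearMap.mem_ker, Matrix.mulVecLin_apply, ← Matrix.mulVec_mulVec]
  constructor
  · intro h; exact h1 _ (h1 _ h)
  · intro h; rw [h, Matrix.mulVec_zero, Matrix.mulVec_zero]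

end MoorePenrose

/-! ### The operator $\mathfrak w$ and its conformal change -/

namespace AlgMetric

variable {n : ℕ} {A : Type*} [CommRing A] [Algebra ℝ A] (g : AlgMetric n A)

theorem wOp_sum {ι : Type*} (t : Finset ι) (b : ι → Fin n → Fin n → A) (k l : Fin n) :
    g.wOp (fun i j => ∑ m ∈ t, b m i j) k l = ∑ m ∈ t, g.wOp (b m) k l := by
  simp only [wOp, Finset.sum_mul]
  rw [Finset.sum_congr rfl fun p _ => Finset.sum_comm, Finset.sum_comm]

/-- The negative Ricci contraction `Σ_i ∂_i ⌟ 𝒲²(dx^i ∧ θ)` of `𝒲²`. -/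
def wsq (θ : Fin n → A) (b : Fin n) : A :=
  ∑ i, g.wOp (g.wOp fun a e => kd A i a * θ e - θ a * kd A i e) i b

theorem wOp_kd_tensor (θ : Fin n → A) (i k l : Fin n) :
    g.wOp (fun a e => kd A i a * θ e) k l = g.up (fun m => g.weylContr θ m l k) i := by
  rw [wOp_tensor]
  have h1 : ∀ d, g.weylContr (kd A i) d k l = g.up (g.weyl d k l) i := fun d => sum_kd_mul _ _
  simp only [h1, ← up_mul, ← up_sum, sum_up_mul_weyl₁]

/-- The first Bianchi identity merges the two terms of the wedge into a single contraction
$W(\cdot,\cdot,\cdot,\theta)$ with its third index raised. -/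
theorem wOp_kd_wedge (θ : Fin n → A) (i k l : Fin n) :
    g.wOp (fun a e => kd A i a * θ e - θ a * kd A i e) k l = g.up (g.weylContr θ k l) i := by
  rw [wOp_sub, wOp_kd_tensor,
    show (fun a e => θ a * kd A i e) = fun a e => (fun a e => kd A i a * θ e) e a from by
      funext a e; ring, wOp_transpose, wOp_kd_tensor, ← up_sub]
  congr 1
  funext m
  linear_combination (-1 : A) * g.weylContr_cyclic θ k l m + g.weylContr_antisymm θ m l k

theorem wsq_eq (θ : Fin n → A) (b : Fin n) :
    g.wsq θ b = ∑ i, g.wOp (fun k l => g.up (g.weylContr θ k l) i) i b := by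
  simp only [wsq, show ∀ i, g.wOp (fun a e => kd A i a * θ e - θ a * kd A i e)
    = fun k l => g.up (g.weylContr θ k l) i from fun i => funext fun k => funext fun l =>
      g.wOp_kd_wedge θ i k l]

theorem wsq_eq_sum (θ : Fin n → A) (b : Fin n) : g.wsq θ b = ∑ c, g.wsq (kd A c) b * θ c := by
  have h1 : ∀ k l, g.weylContr θ k l = fun j => ∑ c, θ c * g.weylContr (kd A c) k l j :=
    fun k l => funext fun j => by
      simp only [weylContr, sum_kd_mul]
  simp only [wsq_eq, h1, up_sum, up_mul, wOp_sum, wOp_mul]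
  rw [Finset.sum_comm]
  simp only [Finset.sum_mul]
  exact Finset.sum_congr rfl fun _ _ => Finset.sum_congr rfl fun _ _ => mul_comm _ _

/-- The one-form `Σ_i e_i ⌟ 𝒲(δW_{e_i})`. -/
def weylDivForm (b : Fin n) : A := g.tr fun i j => g.wOp (fun a c => g.divWeyl a c j) i b

theorem weylDivForm_eq (b : Fin n) :
    g.weylDivForm b = ∑ i, g.wOp (fun k l => g.up (g.divWeyl k l) i) i b := by
  simp only [weylDivForm, tr, up, wOp_sum, wOp_mul]

/-- Raising all indices. -/
def up3 (Y : Fin n → Fin n → Fin n → A) (p q j : Fin n) : A :=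
  g.up (fun i => g.up (fun d => g.up (fun m => Y m d i) p) q) j

theorem up_comm (X : Fin n → Fin n → A) (p q : Fin n) :
    g.up (fun d => g.up (fun m => X m d) p) q = g.up (fun m => g.up (fun d => X m d) q) p := by
  simp only [up, Finset.mul_sum]
  rw [Finset.sum_comm]
  exact Finset.sum_congr rfl fun _ _ => Finset.sum_congr rfl fun _ _ => by ring

theorem up3_swap (Y : Fin n → Fin n → Fin n → A) (p q j : Fin n) :
    g.up3 (fun a b c => Y b a c) p q j = g.up3 Y q p j := by
  simp only [up3]
  congr 1
  funext i
  exact g.up_comm (fun m d => Y d m i) p q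

theorem up3_sub (X Y : Fin n → Fin n → Fin n → A) (p q j : Fin n) :
    g.up3 (fun a b c => X a b c - Y a b c) p q j = g.up3 X p q j - g.up3 Y p q j := by
  simp only [up3, up_sub]

/-- This exhibits $2\mathfrak w$ as the Gram operator of $\theta\mapsto W(\theta)$. It is the source
of both the self-adjointness of $\mathfrak w$ and the description of its kernel. -/
theorem two_mul_sum_wsq (η θ : Fin n → A) : 2 * ∑ b, g.up η b * g.wsq θ b
    = ∑ p, ∑ q, ∑ j, g.weylContr θ p q j * g.up3 (g.weylContr η) p q j := by
  have h1 : ∀ i p d, ∑ b, g.up η b * g.weylUp p d i b = -g.up (g.weylContr η d i) p :=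
    fun i p d => by
      have : ∀ b, g.up η b * g.weylUp p d i b = g.up (fun m => g.up η b * g.weyl d i b m) p :=
        fun b => (g.up_mul _ _ _).symm
      simp only [this, ← up_sum, sum_up_mul_weyl₃]
      simp only [up, mul_neg, Finset.sum_neg_distrib]
  have h2 : ∑ b, g.up η b * g.wsq θ b = -∑ p, ∑ q, ∑ j, g.weylContr θ p q j *
      g.up3 (fun m d i => g.weylContr η d i m) p q j := by
    have e1 : ∑ b, g.up η b * g.wsq θ b = ∑ i, ∑ p, ∑ d,
        g.up (fun q => g.up (g.weylContr θ p q) i) d * ∑ b, g.up η b * g.weylUp p d i b := by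
      simp only [wsq_eq, wOp_eq, Finset.mul_sum]
      rw [Finset.sum_comm]
      refine Finset.sum_congr rfl fun i _ => ?_
      rw [Finset.sum_comm]
      refine Finset.sum_congr rfl fun p _ => ?_
      rw [Finset.sum_comm]
      exact Finset.sum_congr rfl fun d _ => Finset.sum_congr rfl fun b _ => by ring
    have e2 : ∀ p q, ∑ i, g.up (g.weylContr θ p q) i *
        g.up (fun d => g.up (g.weylContr η d i) p) q
        = ∑ j, g.weylContr θ p q j * g.up3 (fun m d i => g.weylContr η d i m) p q j :=
      fun p q => g.sum_up_mul _ _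
    rw [e1]
    simp only [h1, mul_neg, Finset.sum_neg_distrib, ← e2]
    rw [neg_inj, Finset.sum_comm]
    refine Finset.sum_congr rfl fun p _ => ?_
    refine Eq.trans (Finset.sum_congr rfl fun i _ => g.sum_up_mul
      (fun q => g.up (g.weylContr θ p q) i) fun d => g.up (g.weylContr η d i) p) ?_
    exact Finset.sum_comm
  have h3 : ∑ p, ∑ q, ∑ j, g.weylContr θ p q j * g.up3 (fun m d i => g.weylContr η d i m) p q j
      = -∑ p, ∑ q, ∑ j, g.weylContr θ p q j *
        g.up3 (fun m d i => g.weylContr η m i d) p q j := by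
    rw [Finset.sum_comm]
    simp only [← Finset.sum_neg_distrib]
    refine Finset.sum_congr rfl fun p _ => Finset.sum_congr rfl fun q _ =>
      Finset.sum_congr rfl fun j _ => ?_
    have e : g.up3 (fun m d i => g.weylContr η d i m) q p j
        = g.up3 (fun m d i => g.weylContr η m i d) p q j :=
      (g.up3_swap (fun m d i => g.weylContr η d i m) p q j).symm
    rw [e, g.weylContr_antisymm θ q p, neg_mul]
  -- The first Bianchi identity splits $W(\eta)$ into two permuted copies. By `h2` and `h3` each
  -- contributes one $\langle\mathfrak w\theta,\eta\rangle$, hence the factor 2.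
  have h4 : ∀ p q j, g.up3 (g.weylContr η) p q j
      = g.up3 (fun m d i => g.weylContr η m i d) p q j
        - g.up3 (fun m d i => g.weylContr η d i m) p q j := fun p q j => by
    rw [← up3_sub]
    congr 1
    funext m d i
    linear_combination g.weylContr_cyclic η m d i - g.weylContr_antisymm η i m d
  simp only [h4, mul_sub, Finset.sum_sub_distrib]
  linear_combination 2 * h2 - h3

section conformal

variable (s r : A) (h : s * r = 1)

theorem conf_wsq (hn : 4 ≤ n) (θ : Fin n → A) (b : Fin n) :
    (g.conf s r h).wsq θ b = s ^ 4 * g.wsq θ b := by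
  have h1 : ∀ c, (g.conf s r h).wOp c = fun k l => s ^ 2 * g.wOp c k l := fun c =>
    funext fun k => funext fun l => g.conf_wOp s r h hn c k l
  simp only [wsq, h1, wOp_mul, Finset.mul_sum]
  exact Finset.sum_congr rfl fun _ _ => by ring

/-- The correction to $\delta W$ is $W(f)$, and contracting it in this way is the formula `wsq_eq`
for $\mathfrak w(f)$. -/
theorem conf_weylDivForm (hn : 4 ≤ n) (b : Fin n) : (g.conf s r h).weylDivForm b
    = s ^ 4 * (g.weylDivForm b - ((n : A) - 3) * g.wsq (g.dlog s r) b) := by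
  have h1 : ∀ k l, (g.conf s r h).divWeyl k l = fun c => g.divWeyl k l c
      - ((n : A) - 3) * g.weylContr (g.dlog s r) k l c := fun k l => funext fun c =>
    g.conf_divWeyl s r h hn k l c
  simp only [weylDivForm_eq, wsq_eq, g.conf_wOp s r h hn, conf_up, h1, up_sub, up_mul, wOp_mul,
    wOp_sub, Finset.mul_sum, ← Finset.sum_sub_distrib]
  exact Finset.sum_congr rfl fun _ _ => by ring

end conformal

end AlgMetric

/-! ### The ring of smooth functions on an open set -/

section SmoothRing

variable {n : ℕ} (U : Opens (Coord n))

/-- The algebra of smooth functions on an open set. -/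
def smoothRing : Subalgebra ℝ (U → ℝ) where
  carrier := {f | ∃ F : Coord n → ℝ, ContDiffOn ℝ ∞ F U ∧ ∀ x : U, F x = f x}
  mul_mem' := by
    rintro f f' ⟨F, hF, hf⟩ ⟨F', hF', hf'⟩
    exact ⟨fun x => F x * F' x, hF.mul hF', fun x => by simp [hf, hf']⟩
  add_mem' := by
    rintro f f' ⟨F, hF, hf⟩ ⟨F', hF', hf'⟩
    exact ⟨fun x => F x + F' x, hF.add hF', fun x => by simp [hf, hf']⟩
  algebraMap_mem' c := ⟨fun _ => c, contDiffOn_const, fun _ => rfl⟩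

variable {U}

/-- The function `F` on the coordinate space restricts to the smooth function `a` on `U`. -/
def Rep (F : Coord n → ℝ) (a : smoothRing U) : Prop := ∀ x : U, F x = a.1 x

theorem Rep.contDiffOn {F : Coord n → ℝ} {a : smoothRing U} (h : Rep F a) :
    ContDiffOn ℝ ∞ F U := by
  obtain ⟨F', hF', h'⟩ := a.2
  exact hF'.congr fun x hx => (h ⟨x, hx⟩).trans (h' ⟨x, hx⟩).symm

theorem exists_rep {F : Coord n → ℝ} (h : ContDiffOn ℝ ∞ F U) : ∃ a : smoothRing U, Rep F a :=
  ⟨⟨fun x => F x, F, h, fun _ => rfl⟩, fun _ => rfl⟩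

theorem Rep.unique {F : Coord n → ℝ} {a b : smoothRing U} (ha : Rep F a) (hb : Rep F b) :
    a = b :=
  Subtype.ext (funext fun x => (ha x).symm.trans (hb x))

theorem Rep.const (c : ℝ) : Rep (fun _ => c) (algebraMap ℝ (smoothRing U) c) := fun _ => rfl

theorem Rep.add {F F' : Coord n → ℝ} {a a' : smoothRing U} (h : Rep F a) (h' : Rep F' a') :
    Rep (fun x => F x + F' x) (a + a') := fun x => by simp [h x, h' x]

theorem Rep.sub {F F' : Coord n → ℝ} {a a' : smoothRing U} (h : Rep F a) (h' : Rep F' a') :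
    Rep (fun x => F x - F' x) (a - a') := fun x => by simp [h x, h' x]

theorem Rep.mul {F F' : Coord n → ℝ} {a a' : smoothRing U} (h : Rep F a) (h' : Rep F' a') :
    Rep (fun x => F x * F' x) (a * a') := fun x => by simp [h x, h' x]

theorem Rep.sum {ι : Type*} {s : Finset ι} {F : ι → Coord n → ℝ} {a : ι → smoothRing U}
    (h : ∀ i, Rep (F i) (a i)) : Rep (fun x => ∑ i ∈ s, F i x) (∑ i ∈ s, a i) := fun x => by
  simp only [h _ x]
  rw [AddSubmonoidClass.coe_finsetSum, Finset.sum_apply]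

theorem Rep.of_eq {F : Coord n → ℝ} {a b : smoothRing U} (h : Rep F a) (hab : a = b) : Rep F b :=
  hab ▸ h

theorem Rep.congr {F F' : Coord n → ℝ} {a : smoothRing U} (h : Rep F a)
    (hF : ∀ x ∈ U, F' x = F x) : Rep F' a := fun x => (hF x x.2).trans (h x)

/-- Because `U` is open, derivatives on `U` ignore values off `U`. Hence the arbitrary choice made
in `lift` does not affect `pdFun`. -/
theorem pd_congr {F F' : Coord n → ℝ} (h : ∀ x ∈ U, F x = F' x) (i : Fin n) {x : Coord n}
    (hx : x ∈ U) : pd i F x = pd i F' x := by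
  have : F =ᶠ[𝓝 x] F' := by
    filter_upwards [U.isOpen.mem_nhds hx] with y hy using h y hy
  rw [pd, pd, this.fderiv_eq]

theorem contDiffOn_pd {F : Coord n → ℝ} (h : ContDiffOn ℝ ∞ F U) (i : Fin n) :
    ContDiffOn ℝ ∞ (pd i F) U :=
  (h.fderiv_of_isOpen U.isOpen (m := ∞) (by simp)).clm_apply contDiffOn_const

/-- A function on the coordinate space that represents a smooth function on `U`. -/
def lift (a : smoothRing U) : Coord n → ℝ := a.2.choose

theorem rep_lift (a : smoothRing U) : Rep (lift a) a := a.2.choose_spec.2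

theorem Rep.differentiableAt {F : Coord n → ℝ} {a : smoothRing U} (h : Rep F a) (x : U) :
    DifferentiableAt ℝ F x :=
  (h.contDiffOn.contDiffAt (U.isOpen.mem_nhds x.2)).differentiableAt (by simp)

theorem pd_add {F F' : Coord n → ℝ} {x : Coord n} (h : DifferentiableAt ℝ F x)
    (h' : DifferentiableAt ℝ F' x) (i : Fin n) :
    pd i (fun y => F y + F' y) x = pd i F x + pd i F' x := by
  simp only [pd]
  rw [fderiv_fun_add h h']
  rfl

theorem pd_mul {F F' : Coord n → ℝ} {x : Coord n} (h : DifferentiableAt ℝ F x)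
    (h' : DifferentiableAt ℝ F' x) (i : Fin n) :
    pd i (fun y => F y * F' y) x = F x * pd i F' x + F' x * pd i F x := by
  simp only [pd]
  rw [fderiv_fun_mul h h']
  rfl

theorem pd_const (c : ℝ) (i : Fin n) (x : Coord n) : pd i (fun _ => c) x = 0 := by
  simp [pd]

variable (U) in
/-- The partial derivative as a function on the ring of smooth functions. -/
def pdFun (i : Fin n) (a : smoothRing U) : smoothRing U :=
  ⟨fun x => pd i (lift a) x, pd i (lift a), contDiffOn_pd (rep_lift a).contDiffOn i, fun _ => rfl⟩

theorem Rep.pdFun {F : Coord n → ℝ} {a : smoothRing U} (h : Rep F a) (i : Fin n) :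
    Rep (pd i F) (pdFun U i a) := fun x =>
  pd_congr (fun y hy => (h ⟨y, hy⟩).trans (rep_lift a ⟨y, hy⟩).symm) i x.2

variable (U) in
/-- The partial derivative as a derivation of the ring of smooth functions. -/
def pdDer (i : Fin n) : Derivation ℝ (smoothRing U) (smoothRing U) :=
  Derivation.mk' {
    toFun := pdFun U i
    map_add' := fun a b => ((rep_lift a).add (rep_lift b)).pdFun i |>.unique
      ((((rep_lift a).pdFun i).add ((rep_lift b).pdFun i)).congr fun x hx =>
        pd_add ((rep_lift a).differentiableAt ⟨x, hx⟩) ((rep_lift b).differentiableAt ⟨x, hx⟩) i)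
    map_smul' := fun c a => by
      rw [RingHom.id_apply, Algebra.smul_def, Algebra.smul_def]
      refine ((Rep.const c).mul (rep_lift a)).pdFun i |>.unique
        (((Rep.const c).mul ((rep_lift a).pdFun i)).congr fun x hx => ?_)
      rw [pd_mul (by fun_prop) ((rep_lift a).differentiableAt ⟨x, hx⟩), pd_const]
      ring }
    fun a b => ((rep_lift a).mul (rep_lift b)).pdFun i |>.unique
      ((((rep_lift a).mul ((rep_lift b).pdFun i)).add
        ((rep_lift b).mul ((rep_lift a).pdFun i))).congr fun x hx =>
        pd_mul ((rep_lift a).differentiableAt ⟨x, hx⟩) ((rep_lift b).differentiableAt ⟨x, hx⟩) i)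

theorem Rep.pd {F : Coord n → ℝ} {a : smoothRing U} (h : Rep F a) (i : Fin n) :
    Rep (pd i F) (pdDer U i a) := h.pdFun i

theorem pdDer_comm (i j : Fin n) (a : smoothRing U) :
    pdDer U i (pdDer U j a) = pdDer U j (pdDer U i a) := by
  refine (((rep_lift a).pd j).pd i).unique ((((rep_lift a).pd i).pd j).congr fun x hx => ?_)
  have h2 : ContDiffAt ℝ 2 (lift a) x :=
    ((rep_lift a).contDiffOn.contDiffAt (U.isOpen.mem_nhds hx)).of_le 
      (WithTop.coe_le_coe.2 le_top)
  have hd : DifferentiableAt ℝ (fderiv ℝ (lift a)) x :=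
    (h2.fderiv_right (m := 1) (by norm_num)).differentiableAt (by simp)
  have key : ∀ i j, ConformalBach.pd i (ConformalBach.pd j (lift a)) x
      = fderiv ℝ (fderiv ℝ (lift a)) x (EuclideanSpace.single i 1)
        (EuclideanSpace.single j 1) := fun i j => by
    change fderiv ℝ (fun y => fderiv ℝ (lift a) y (EuclideanSpace.single j 1)) x _ = _
    rw [fderiv_clm_apply hd (differentiableAt_const _)]
    simp
  rw [key, key]
  exact (h2.isSymmSndFDerivAt (by simp)).eq _ _

end SmoothRing

/-! ### Transfer between coordinate tensors and the algebraic calculus -/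

section Transfer

variable {n : ℕ} {U : Opens (Coord n)}

/-- The metric `G` restricts to the metric `g` over the ring of smooth functions on `U`. -/
structure RepMetric (G : Coord n → Matrix (Fin n) (Fin n) ℝ)
    (g : AlgMetric n (smoothRing U)) : Prop where
  d_eq : g.d = pdDer U
  rep_G : ∀ i j, Rep (fun x => G x i j) (g.G i j)
  rep_H : ∀ i j, Rep (fun x => ginv G x i j) (g.H i j)

namespace RepMetric

variable {G : Coord n → Matrix (Fin n) (Fin n) ℝ} {g : AlgMetric n (smoothRing U)}
  (hg : RepMetric G g)
include hg

theorem pd {F : Coord n → ℝ} {a : smoothRing U} (h : Rep F a) (i : Fin n) :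
    Rep (pd i F) (g.d i a) := hg.d_eq ▸ h.pd i

theorem chr (k i j : Fin n) : Rep (fun x => christoffel G x k i j) (g.chr k i j) := by
  have e : g.chr k i j = algebraMap ℝ _ (1 / 2) * ∑ l, g.H k l *
      (g.d i (g.G j l) + g.d j (g.G i l) - g.d l (g.G i j)) := by
    simp only [AlgMetric.chr, AlgMetric.gam, AlgMetric.up_mul]
    rfl
  rw [e]
  unfold christoffel
  exact (Rep.const _).mul (Rep.sum fun l => (hg.rep_H k l).mul
    (((hg.pd (hg.rep_G j l) i).add (hg.pd (hg.rep_G i l) j)).sub (hg.pd (hg.rep_G i j) l)))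

theorem up {F : Coord n → Fin n → ℝ} {a : Fin n → smoothRing U}
    (h : ∀ i, Rep (fun x => F x i) (a i)) (k : Fin n) :
    Rep (fun x => ∑ l, ginv G x k l * F x l) (g.up a k) :=
  Rep.sum fun l => (hg.rep_H k l).mul (h l)

theorem tr {F : Coord n → Fin n → Fin n → ℝ} {a : Fin n → Fin n → smoothRing U}
    (h : ∀ i j, Rep (fun x => F x i j) (a i j)) :
    Rep (fun x => ∑ i, ∑ j, ginv G x i j * F x i j) (g.tr a) :=
  Rep.sum fun i => Rep.sum fun j => (hg.rep_H i j).mul (h i j)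

theorem cov1 {F : Coord n → Fin n → ℝ} {a : Fin n → smoothRing U}
    (h : ∀ i, Rep (fun x => F x i) (a i)) (j i : Fin n) :
    Rep (fun x => covD1 G F x j i) (g.cov1 a j i) :=
  (hg.pd (h i) j).sub (Rep.sum fun m => (hg.chr m j i).mul (h m))

theorem cov2 {F : Coord n → Fin n → Fin n → ℝ} {B : Fin n → Fin n → smoothRing U}
    (h : ∀ a b, Rep (fun x => F x a b) (B a b)) (j a b : Fin n) :
    Rep (fun x => covD2 G F x j a b) (g.cov2 B j a b) :=
  ((hg.pd (h a b) j).sub (Rep.sum fun m => (hg.chr m j a).mul (h m b))).sub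
    (Rep.sum fun m => (hg.chr m j b).mul (h a m))

theorem cov3 {F : Coord n → Fin n → Fin n → Fin n → ℝ} {B : Fin n → Fin n → Fin n → smoothRing U}
    (h : ∀ a b c, Rep (fun x => F x a b c) (B a b c)) (j a b c : Fin n) :
    Rep (fun x => covD3 G F x j a b c) (g.cov3 B j a b c) :=
  (((hg.pd (h a b c) j).sub (Rep.sum fun m => (hg.chr m j a).mul (h m b c))).sub
    (Rep.sum fun m => (hg.chr m j b).mul (h a m c))).sub
    (Rep.sum fun m => (hg.chr m j c).mul (h a b m))

theorem cov4 {F : Coord n → Fin n → Fin n → Fin n → Fin n → ℝ}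
    {B : Fin n → Fin n → Fin n → Fin n → smoothRing U}
    (h : ∀ a b c e, Rep (fun x => F x a b c e) (B a b c e)) (j a b c e : Fin n) :
    Rep (fun x => covD4 G F x j a b c e) (g.cov4 B j a b c e) :=
  ((((hg.pd (h a b c e) j).sub (Rep.sum fun m => (hg.chr m j a).mul (h m b c e))).sub
    (Rep.sum fun m => (hg.chr m j b).mul (h a m c e))).sub
    (Rep.sum fun m => (hg.chr m j c).mul (h a b m e))).sub
    (Rep.sum fun m => (hg.chr m j e).mul (h a b c m))

theorem riemUp (l i j k : Fin n) : Rep (fun x => riemannUp G x l i j k) (g.riemUp l i j k) :=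
  ((hg.pd (hg.chr l j k) i).sub (hg.pd (hg.chr l i k) j)).add
    (Rep.sum fun m => ((hg.chr l i m).mul (hg.chr m j k)).sub ((hg.chr l j m).mul (hg.chr m i k)))

theorem riem (i j k l : Fin n) : Rep (fun x => riemann G x i j k l) (g.riem i j k l) :=
  Rep.of_eq (Rep.sum fun m => (hg.rep_G m l).mul (hg.riemUp m i j k))
    (Finset.sum_congr rfl fun m _ => by rw [g.G_symm])

theorem ric (i j : Fin n) : Rep (fun x => ricci G x i j) (g.ric i j) :=
  Rep.sum fun a => hg.riemUp a a i j

theorem scal : Rep (fun x => scal G x) g.scal := hg.tr hg.ric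

theorem sch (i j : Fin n) : Rep (fun x => schouten G x i j) (g.sch i j) :=
  (Rep.const _).mul ((hg.ric i j).sub (((Rep.const _).mul hg.scal).mul (hg.rep_G i j)))

theorem weyl (i j k l : Fin n) : Rep (fun x => weyl G x i j k l) (g.weyl i j k l) :=
  (hg.riem i j k l).sub (((((hg.rep_G i l).mul (hg.sch j k)).add
    ((hg.rep_G j k).mul (hg.sch i l))).sub ((hg.rep_G i k).mul (hg.sch j l))).sub
    ((hg.rep_G j l).mul (hg.sch i k)))

theorem wOp {F : Coord n → Fin n → Fin n → ℝ} {b : Fin n → Fin n → smoothRing U}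
    (h : ∀ i j, Rep (fun x => F x i j) (b i j)) (k l : Fin n) :
    Rep (fun x => weylOp G x (F x) k l) (g.wOp b k l) :=
  Rep.sum fun p => Rep.sum fun q => (h p q).mul (Rep.sum fun c => Rep.sum fun d =>
    ((hg.rep_H p c).mul (hg.rep_H q d)).mul (hg.weyl d k l c))

theorem divWeyl (a b c : Fin n) : Rep (fun x => divWeyl G x a b c) (g.divWeyl a b c) :=
  hg.tr fun i j => hg.cov4 hg.weyl i a b c j

theorem divDivWeyl (a b : Fin n) : Rep (fun x => divDivWeyl G x a b) (g.divDivWeyl a b) :=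
  hg.tr fun i j => hg.cov3 hg.divWeyl i j a b

omit hg in
theorem single (i a : Fin n) :
    Rep (fun _ : Coord n => (Pi.single i (1 : ℝ) : Fin n → ℝ) a) (kd (smoothRing U) i a) := by
  by_cases h : i = a
  · subst h
    simpa [kd] using Rep.const (U := U) 1
  · simpa [kd, h, Pi.single_apply, Ne.symm h] using Rep.const (U := U) 0

theorem ricciWeylSq (b c : Fin n) :
    Rep (fun x => ricciWeylSq G x b c) (g.wsq (kd (smoothRing U) c) b) :=
  Rep.congr (Rep.sum fun i => hg.wOp (hg.wOp fun a e => ((single i a).mul (single c e)).sub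
    ((single c a).mul (single i e))) i b) fun _ _ => rfl

theorem weylDivForm (b : Fin n) : Rep (fun x => weylDivForm G x b) (g.weylDivForm b) :=
  hg.tr fun i j => hg.wOp (fun a c => hg.divWeyl a c j) i b

section

variable {t : Fin n → smoothRing U} (ht : ∀ i, Rep (fun x => tForm G x i) (t i))
include ht

theorem tVec (i : Fin n) : Rep (fun x => tVec G x i) (g.up t i) := hg.up ht i

theorem normSqT : Rep (fun x => normSqT G x) (g.nsq t) := by
  refine Rep.of_eq (Rep.sum fun i => Rep.sum fun j => ((hg.rep_G i j).mul (hg.tVec ht i)).mul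
    (hg.tVec ht j)) ?_
  have : ∀ i, ∑ j, g.G i j * g.up t i * g.up t j = t i * g.up t i := fun i => by
    conv_rhs => rw [← g.low_up t i, AlgMetric.low, Finset.sum_mul]
    exact Finset.sum_congr rfl fun _ _ => by ring
  simp only [this]
  rfl

theorem cottonT (a b c : Fin n) : Rep (fun x => cottonT G x a b c) (g.cottonT t a b c) := by
  have e : g.cottonT t a b c = g.cov2 g.sch a b c - g.cov2 g.sch b a c
      - ∑ d, g.weyl a b c d * g.up t d := by
    rw [AlgMetric.cottonT, AlgMetric.weylContr_eq, AlgMetric.cotton]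
    congr 1
    exact Finset.sum_congr rfl fun _ _ => mul_comm _ _
  rw [e]
  exact ((hg.cov2 hg.sch a b c).sub (hg.cov2 hg.sch b a c)).sub
    (Rep.sum fun d => (hg.weyl a b c d).mul (hg.tVec ht d))

theorem confRicciT (i j : Fin n) :
    Rep (fun x => confRicciT G x i j) (g.confRicciT t i j) := by
  have e : ∀ x, ConformalBach.confRicciT G x i j = ricci G x i j
      - (1 / (n : ℝ)) * ConformalBach.scal G x * G x i j
      + ((n : ℝ) - 2) * (covD1 G (tForm G) x i j + tForm G x i * tForm G x j
      - 1 / n * (divT G x + ConformalBach.normSqT G x) * G x i j) := fun x => by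
    rw [ConformalBach.confRicciT, div_eq_mul_one_div (ConformalBach.scal G x), mul_comm _ (1 / (n : ℝ))]
  simp only [e]
  exact ((hg.ric i j).sub (((Rep.const _).mul hg.scal).mul (hg.rep_G i j))).add
    ((Rep.const _).mul (((hg.cov1 ht i j).add ((ht i).mul (ht j))).sub
      (((Rep.const _).mul ((hg.tr (hg.cov1 ht)).add (hg.normSqT ht))).mul (hg.rep_G i j))))

theorem genBach (i j : Fin n) : Rep (fun x => genBach G x i j) (g.genBach t i j) :=
  (((hg.divDivWeyl i j).add ((Rep.const _).mul (hg.wOp hg.ric i j))).sub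
    ((Rep.const _).mul (hg.wOp
      (fun a b => (hg.confRicciT ht a b).add (hg.confRicciT ht b a)) i j))).sub
    ((Rep.const _).mul ((hg.wOp (fun a b => (ht a).mul (ht b)) i j).add
      ((Rep.sum fun d => (hg.tVec ht d).mul (hg.cottonT ht d i j)).add
        (Rep.sum fun d => (hg.tVec ht d).mul (hg.cottonT ht d j i)))))

end

end RepMetric

end Transfer

/-! ### The kernel of $\mathfrak w$ and smoothness of $\mathbb T$ in coordinates -/

section Local

variable {n : ℕ} {U : Opens (Coord n)}

theorem contDiffOn_det {S : Set (Coord n)} {F : Coord n → Matrix (Fin n) (Fin n) ℝ}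
    (hF : ∀ i j, ContDiffOn ℝ ∞ (fun x => F x i j) S) :
    ContDiffOn ℝ ∞ (fun x => (F x).det) S := by
  simp only [Matrix.det_apply']
  exact ContDiffOn.sum fun σ _ => contDiffOn_const.mul (contDiffOn_prod fun i _ => hF _ _)

theorem contDiffOn_inv_apply {S : Set (Coord n)} {F : Coord n → Matrix (Fin n) (Fin n) ℝ}
    (hF : ∀ i j, ContDiffOn ℝ ∞ (fun x => F x i j) S) (hdet : ∀ x ∈ S, (F x).det ≠ 0)
    (i j : Fin n) : ContDiffOn ℝ ∞ (fun x => (F x)⁻¹ i j) S := by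
  simp only [Matrix.inv_def, Ring.inverse_eq_inv', Matrix.smul_apply, smul_eq_mul,
    Matrix.adjugate_apply]
  refine ((contDiffOn_det hF).inv hdet).mul (contDiffOn_det fun a b => ?_)
  simp only [Matrix.updateRow_apply]
  split_ifs
  · exact contDiffOn_const
  · exact hF a b

theorem contDiffOn_mul_apply {S : Set (Coord n)} {F F' : Coord n → Matrix (Fin n) (Fin n) ℝ}
    (hF : ∀ i j, ContDiffOn ℝ ∞ (fun x => F x i j) S)
    (hF' : ∀ i j, ContDiffOn ℝ ∞ (fun x => F' x i j) S)
    (i j : Fin n) : ContDiffOn ℝ ∞ (fun x => (F x * F' x) i j) S := by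
  simp only [Matrix.mul_apply]
  exact ContDiffOn.sum fun k _ => (hF i k).mul (hF' k j)

/-- `G` is a smooth Riemannian metric on `U`. -/
structure IsMetricOn (G : Coord n → Matrix (Fin n) (Fin n) ℝ) (U : Opens (Coord n)) : Prop where
  smooth : ∀ i j, ContDiffOn ℝ ∞ (fun x => G x i j) U
  posDef : ∀ x ∈ U, (G x).PosDef

theorem IsMetricOn.mono {G : Coord n → Matrix (Fin n) (Fin n) ℝ} {V : Opens (Coord n)}
    (h : IsMetricOn G U) (hV : V ≤ U) : IsMetricOn G V :=
  ⟨fun i j => (h.smooth i j).mono hV, fun x hx => h.posDef x (hV hx)⟩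

theorem Rep.eval_eq {F F' : Coord n → ℝ} {a b : smoothRing U} (h : Rep F a) (h' : Rep F' b)
    (hab : a = b) {x : Coord n} (hx : x ∈ U) : F x = F' x := by
  subst hab
  exact (h ⟨x, hx⟩).trans (h' ⟨x, hx⟩).symm

theorem Rep.eq_of_eval {F F' : Coord n → ℝ} {a b : smoothRing U} (h : Rep F a) (h' : Rep F' b)
    (hF : ∀ x ∈ U, F x = F' x) : a = b :=
  h.unique (h'.congr hF)

variable {G : Coord n → Matrix (Fin n) (Fin n) ℝ}

theorem IsMetricOn.isUnit_det (hG : IsMetricOn G U) {x : Coord n} (hx : x ∈ U) :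
    IsUnit (G x).det := (hG.posDef x hx).isUnit.map Matrix.detMonoidHom

theorem IsMetricOn.symm (hG : IsMetricOn G U) {x : Coord n} (hx : x ∈ U) (i j : Fin n) :
    G x i j = G x j i := by
  simpa using ((hG.posDef x hx).isHermitian.apply i j).symm

theorem IsMetricOn.exists_repMetric (hG : IsMetricOn G U) :
    ∃ g : AlgMetric n (smoothRing U), RepMetric G g := by
  choose a ha using fun i j => exists_rep (hG.smooth i j)
  choose b hb using fun i j => exists_rep (U := U) (contDiffOn_inv_apply hG.smooth
    (fun x hx => (hG.isUnit_det hx).ne_zero) i j)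
  refine ⟨⟨pdDer U, pdDer_comm, a, b, fun i j => ?_, fun i j => ?_, fun i j => ?_⟩,
    rfl, ha, hb⟩
  · exact (ha i j).eq_of_eval (ha j i) fun x hx => hG.symm hx i j
  · refine (hb i j).eq_of_eval (hb j i) fun x hx => ?_
    simpa using ((hG.posDef x hx).inv.isHermitian.apply i j).symm
  · refine (Rep.sum fun k => (ha i k).mul (hb k j)).eq_of_eval
      (F' := fun _ => if i = j then 1 else 0) ?_ fun x hx => ?_
    · split_ifs
      · exact Rep.const 1
      · exact Rep.const 0
    · have := congrFun (congrFun (Matrix.mul_nonsing_inv _ (hG.isUnit_det hx)) i) j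
      rwa [Matrix.mul_apply, Matrix.one_apply] at this

/-- The matrix of the map `θ ↦ W(·,·,·,θ)`. -/
def weylMat (G : Coord n → Matrix (Fin n) (Fin n) ℝ) (x : Coord n) :
    Matrix (Fin n × Fin n × Fin n) (Fin n) ℝ :=
  Matrix.of fun P c => ∑ m, ginv G x c m * weyl G x P.1 P.2.1 P.2.2 m

/-- The inner product on `(0,3)` tensors. -/
def gram3 (H : Matrix (Fin n) (Fin n) ℝ) :
    Matrix (Fin n × Fin n × Fin n) (Fin n × Fin n × Fin n) ℝ :=
  Matrix.kroneckerMap (· * ·) H (Matrix.kroneckerMap (· * ·) H H)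

variable {g : AlgMetric n (smoothRing U)}

theorem RepMetric.weylUp (hg : RepMetric G g) (l i j k : Fin n) :
    Rep (fun x => weylMat G x (i, j, k) l) (g.weylUp l i j k) := hg.up (hg.weyl i j k) l

/-- This is `two_mul_sum_wsq` evaluated on $\theta = dx^c$, $\eta = dx^a$, as a factorisation
$K^{\mathsf T}(H\otimes H\otimes H)K$ with $H = G^{-1}$. -/
theorem two_smul_ginv_mul_ricciWeylSq (hg : RepMetric G g) {x : Coord n} (hx : x ∈ U) :
    (2 : ℝ) • ((G x)⁻¹ * ricciWeylSq G x).transpose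
      = (weylMat G x).transpose * (gram3 (G x)⁻¹ * weylMat G x) := by
  ext c a
  have e1 : ∀ c, g.weylContr (kd _ c) = fun p q j => g.weylUp c p q j := fun c => by
    funext p q j; exact sum_kd_mul _ _
  have e2 : ∀ b, g.up (kd _ a) b = g.H b a := fun b => sum_mul_kd _ _
  have h := g.two_mul_sum_wsq (kd _ a) (kd _ c)
  simp only [e1, e2, AlgMetric.up3] at h
  rw [← map_ofNat (algebraMap ℝ (smoothRing U)) 2] at h
  have h1 := ((Rep.const 2).mul (Rep.sum (s := Finset.univ) fun b =>
    (hg.rep_H b a).mul (hg.ricciWeylSq b c)))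
  have h2 := Rep.sum (s := Finset.univ) fun p => Rep.sum (s := Finset.univ) fun q =>
    Rep.sum (s := Finset.univ) fun j => (hg.weylUp c p q j).mul
    (hg.up (fun i => hg.up (fun d => hg.up (fun m => hg.weylUp a m d i) p) q) j)
  have h3 := h1.eval_eq h2 h hx
  have h4 : ((2 : ℝ) • ((G x)⁻¹ * ricciWeylSq G x).transpose) c a
      = 2 * ∑ b, ginv G x b a * ricciWeylSq G x b c := by
    rw [Matrix.smul_apply, Matrix.transpose_apply, Matrix.mul_apply, smul_eq_mul]
    congr 1
    refine Finset.sum_congr rfl fun b _ => ?_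
    have h5 := (hg.rep_H a b).eval_eq (hg.rep_H b a) (g.H_symm a b) hx
    rw [← h5]; rfl
  rw [h4, h3, Matrix.mul_apply, Fintype.sum_prod_type]
  refine Finset.sum_congr rfl fun p _ => ?_
  rw [Fintype.sum_prod_type]
  refine Finset.sum_congr rfl fun q _ => Finset.sum_congr rfl fun j _ => ?_
  rw [Matrix.transpose_apply]
  congr 1
  simp only [Matrix.mul_apply, Fintype.sum_prod_type, gram3, Matrix.kroneckerMap_apply,
    Finset.mul_sum]
  rw [Finset.sum_comm, Finset.sum_congr rfl fun d _ => Finset.sum_comm, Finset.sum_comm]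
  exact Finset.sum_congr rfl fun m _ => Finset.sum_congr rfl fun d _ =>
    Finset.sum_congr rfl fun i _ => by simp only [ginv]; ring

theorem posDef_gram3 {H : Matrix (Fin n) (Fin n) ℝ} (hH : H.PosDef) : (gram3 H).PosDef :=
  hH.kronecker (hH.kronecker hH)

theorem IsMetricOn.posDef_inv (hG : IsMetricOn G U) {x : Coord n} (hx : x ∈ U) :
    ((G x)⁻¹).PosDef := (hG.posDef x hx).inv

theorem ricciWeylSq_selfAdjoint (hG : IsMetricOn G U) {x : Coord n} (hx : x ∈ U) :
    (ricciWeylSq G x).transpose * (G x)⁻¹ = (G x)⁻¹ * ricciWeylSq G x := by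
  obtain ⟨g, hg⟩ := hG.exists_repMetric
  have h1 := two_smul_ginv_mul_ricciWeylSq hg hx
  have hH : ((G x)⁻¹).transpose = (G x)⁻¹ := by
    simpa using (hG.posDef_inv hx).isHermitian.eq
  have hK : (gram3 (G x)⁻¹).transpose = gram3 (G x)⁻¹ := by
    simpa using (posDef_gram3 (hG.posDef_inv hx)).isHermitian.eq
  have h2 : ((2 : ℝ) • ((G x)⁻¹ * ricciWeylSq G x).transpose).transpose
      = (2 : ℝ) • ((G x)⁻¹ * ricciWeylSq G x).transpose := by
    rw [h1, Matrix.transpose_mul, Matrix.transpose_mul, Matrix.transpose_transpose, hK,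
      Matrix.mul_assoc]
  rw [Matrix.transpose_smul, Matrix.transpose_transpose] at h2
  have h3 := smul_right_injective _ (two_ne_zero (α := ℝ)) h2
  rw [h3, Matrix.transpose_mul, hH]

/-- From $\mathfrak w\theta = 0$ the factorisation gives $|K\theta|^2 = 0$, and `gram3` is positive
definite. -/
theorem mulVec_ricciWeylSq_eq_zero_iff (hG : IsMetricOn G U) {x : Coord n} (hx : x ∈ U)
    (θ : Fin n → ℝ) : (ricciWeylSq G x).mulVec θ = 0 ↔ (weylMat G x).mulVec θ = 0 := by
  obtain ⟨g, hg⟩ := hG.exists_repMetric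
  have h1 := two_smul_ginv_mul_ricciWeylSq hg hx
  have hs := ricciWeylSq_selfAdjoint hG hx
  have hH : ((G x)⁻¹).transpose = (G x)⁻¹ := by
    simpa using (hG.posDef_inv hx).isHermitian.eq
  rw [Matrix.transpose_mul, hH, hs] at h1
  have h2 : (2 : ℝ) • (G x)⁻¹.mulVec ((ricciWeylSq G x).mulVec θ)
      = (weylMat G x).transpose.mulVec ((gram3 (G x)⁻¹).mulVec ((weylMat G x).mulVec θ)) := by
    rw [Matrix.mulVec_mulVec, ← Matrix.smul_mulVec, h1]
    simp only [Matrix.mulVec_mulVec]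
  constructor
  · intro h
    rw [h, Matrix.mulVec_zero, smul_zero] at h2
    by_contra hne
    have h3 := (posDef_gram3 (hG.posDef_inv hx)).dotProduct_mulVec_pos hne
    have h4 : θ ⬝ᵥ (weylMat G x).transpose.mulVec ((gram3 (G x)⁻¹).mulVec
        ((weylMat G x).mulVec θ)) = 0 := by rw [← h2, dotProduct_zero]
    rw [Matrix.dotProduct_mulVec, Matrix.vecMul_transpose] at h4
    rw [star_trivial, h4] at h3
    exact lt_irrefl _ h3
  · intro h
    rw [h, Matrix.mulVec_zero, Matrix.mulVec_zero] at h2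
    have h3 : (G x)⁻¹.mulVec ((ricciWeylSq G x).mulVec θ) = 0 := by simpa using h2
    have h4 := congrArg (G x).mulVec h3
    rwa [Matrix.mulVec_mulVec, Matrix.mul_nonsing_inv _ (hG.isUnit_det hx), Matrix.one_mulVec,
      Matrix.mulVec_zero] at h4

theorem mem_weylNull_iff (hG : IsMetricOn G U) {x : Coord n} (hx : x ∈ U) (v : Fin n → ℝ) :
    v ∈ weylNull G x ↔ (weylMat G x).mulVec ((G x).mulVec v) = 0 := by
  obtain ⟨g, hg⟩ := hG.exists_repMetric
  have h1 : ∀ p q j, (weylMat G x).mulVec ((G x).mulVec v) (p, q, j)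
      = ∑ i, v i * weyl G x i j q p := fun p q j => by
    have e : ∀ i, ∑ c, G x c i * ∑ m, ginv G x c m * weyl G x p q j m = weyl G x p q j i :=
      fun i => by
        have := congrFun (Matrix.mulVec_mulVec (fun m => weyl G x p q j m) (G x) (G x)⁻¹) i
        rw [Matrix.mul_nonsing_inv _ (hG.isUnit_det hx), Matrix.one_mulVec] at this
        rw [← this]
        simp only [Matrix.mulVec, dotProduct]
        exact Finset.sum_congr rfl fun c _ => by rw [hG.symm hx c i]; rfl
    simp only [Matrix.mulVec, dotProduct, weylMat, Matrix.of_apply]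
    simp only [Finset.mul_sum _ _ (∑ m, ginv G x _ m * weyl G x p q j m)]
    rw [Finset.sum_comm]
    refine Finset.sum_congr rfl fun i _ => ?_
    rw [← (hg.weyl p q j i).eval_eq (hg.weyl i j q p) (g.weyl_reverse p q j i) hx, ← e i,
      Finset.mul_sum]
    exact Finset.sum_congr rfl fun c _ => by ring
  constructor
  · intro h
    funext ⟨p, q, j⟩
    rw [h1]
    exact h j q p
  · intro h j k l
    rw [← h1, h]
    rfl

/-- Lowering the index with `G` maps the null space isomorphically onto $\ker\mathfrak w$, so local
constancy of its dimension is a condition on the rank of $\mathfrak w$. -/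
theorem finrank_weylNull (hG : IsMetricOn G U) {x : Coord n} (hx : x ∈ U) :
    Module.finrank ℝ (weylNull G x)
      = Module.finrank ℝ (LinearMap.ker (ricciWeylSq G x).mulVecLin) := by
  let e : (Fin n → ℝ) ≃ₗ[ℝ] (Fin n → ℝ) :=
    Matrix.toLinearEquiv' (G x) (Matrix.invertibleOfIsUnitDet _ (hG.isUnit_det hx))
  have he : ∀ v, e v = (G x).mulVec v := fun v => rfl
  have hmap : (weylNull G x).map (e : (Fin n → ℝ) →ₗ[ℝ] (Fin n → ℝ))
      = LinearMap.ker (ricciWeylSq G x).mulVecLin := by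
    ext θ
    rw [Submodule.mem_map_equiv, mem_weylNull_iff hG hx, ← he, LinearEquiv.apply_symm_apply,
      LinearMap.mem_ker, Matrix.mulVecLin_apply, mulVec_ricciWeylSq_eq_zero_iff hG hx]
  rw [← hmap, LinearEquiv.finrank_map_eq e]

/-- If the rank of the null space of the Weyl tensor is locally constant, then `𝕋*` is smooth. -/
theorem exists_contDiffOn_tForm (hG : IsMetricOn G U) {x₀ : Coord n} (hx₀ : x₀ ∈ U)
    (hr : ∀ᶠ x in 𝓝 x₀, Module.finrank ℝ (weylNull G x) = Module.finrank ℝ (weylNull G x₀)) :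
    ∃ V : Opens (Coord n), V ≤ U ∧ x₀ ∈ V ∧
      ∀ i, ContDiffOn ℝ ∞ (fun x => tForm G x i) V := by
  obtain ⟨g, hg⟩ := hG.exists_repMetric
  have hM : ∀ i j, ContDiffOn ℝ ∞ (fun x => ricciWeylSq G x i j) U := fun i j =>
    (hg.ricciWeylSq i j).contDiffOn
  have hN := contDiffOn_mul_apply (contDiffOn_mul_apply hM hM) hM
  -- `Q` is chosen at `x₀` and kept constant; invertibility of the sum persists nearby by continuity
  -- of the determinant.
  obtain ⟨Q, hQ1, hQ2⟩ := exists_isUnit_add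
    (ricciWeylSq G x₀ * ricciWeylSq G x₀ * ricciWeylSq G x₀)
  have hNQ : ∀ i j, ContDiffOn ℝ ∞
      (fun x => (ricciWeylSq G x * ricciWeylSq G x * ricciWeylSq G x + Q) i j) U := fun i j =>
    (hN i j).add contDiffOn_const
  have hdet : ∀ᶠ x in 𝓝 x₀,
      (ricciWeylSq G x * ricciWeylSq G x * ricciWeylSq G x + Q).det ≠ 0 :=
    ((contDiffOn_det hNQ).contDiffAt (U.isOpen.mem_nhds hx₀)).continuousAt.eventually_ne
      hQ1.ne_zero
  have hfin : ∀ x ∈ U, Module.finrank ℝ (weylNull G x) = Module.finrank ℝ (LinearMap.ker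
      (ricciWeylSq G x * ricciWeylSq G x * ricciWeylSq G x).mulVecLin) := fun x hx => by
    rw [ker_mulVecLin_cube (hG.posDef_inv hx) (ricciWeylSq_selfAdjoint hG hx),
      finrank_weylNull hG hx]
  obtain ⟨V, hV, hVo, hVx⟩ := eventually_nhds_iff.1
    (hr.and (hdet.and (U.isOpen.mem_nhds hx₀)))
  refine ⟨⟨V, hVo⟩, fun x hx => (hV x hx).2.2, hVx, fun i => ?_⟩
  have hVU : V ⊆ U := fun x hx => (hV x hx).2.2
  have hL := contDiffOn_inv_apply (fun i j => (hNQ i j).mono hVU) fun x hx => (hV x hx).2.1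
  have hMV : ∀ i j, ContDiffOn ℝ ∞ (fun x => ricciWeylSq G x i j) V := fun i j =>
    (hM i j).mono hVU
  -- The rank bound on `Q` is known at `x₀` only; it carries over to `x` because the kernel has the
  -- same dimension there.
  have hmp : ∀ x ∈ V, moorePenrose (G x)⁻¹ (ricciWeylSq G x) = ricciWeylSq G x *
      (ricciWeylSq G x * ricciWeylSq G x * ricciWeylSq G x + Q)⁻¹ * ricciWeylSq G x :=
    fun x hx => by
      refine moorePenrose_eq_of_reg (hG.posDef_inv (hVU hx))
        (ricciWeylSq_selfAdjoint hG (hVU hx)) (mul_inv_mul_of_finrank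
          (isUnit_iff_ne_zero.2 (hV x hx).2.1) ?_)
      rw [← hfin x (hVU hx), (hV x hx).1, hfin x₀ hx₀]
      exact hQ2
  have hmp' : ∀ i j, ContDiffOn ℝ ∞
      (fun x => moorePenrose (G x)⁻¹ (ricciWeylSq G x) i j) V := fun i j =>
    (contDiffOn_mul_apply (contDiffOn_mul_apply hMV hL) hMV i j).congr fun x hx => by
      rw [hmp x hx]
  exact contDiffOn_const.mul (ContDiffOn.sum fun b _ =>
    (hmp' i b).mul ((hg.weylDivForm b).contDiffOn.mono hVU))

end Local

/-! ### Smoothness and conformal invariance in coordinates -/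

section Local

variable {n : ℕ} {U : Opens (Coord n)} {G G' : Coord n → Matrix (Fin n) (Fin n) ℝ}

theorem contDiffAt_genBach (hG : IsMetricOn G U) {x₀ : Coord n} (hx₀ : x₀ ∈ U)
    (hr : ∀ᶠ x in 𝓝 x₀, Module.finrank ℝ (weylNull G x) = Module.finrank ℝ (weylNull G x₀)) :
    ContDiffAt ℝ ∞ (tVec G) x₀ ∧ ContDiffAt ℝ ∞ (genBach G) x₀ := by
  obtain ⟨V, hVU, hxV, ht⟩ := exists_contDiffOn_tForm hG hx₀ hr
  obtain ⟨g, hg⟩ := (hG.mono hVU).exists_repMetric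
  choose t ht using fun i => exists_rep (ht i)
  refine ⟨contDiffAt_pi.2 fun i => ?_, contDiffAt_pi.2 fun i => contDiffAt_pi.2 fun j => ?_⟩
  · exact (hg.tVec ht i).contDiffOn.contDiffAt (V.isOpen.mem_nhds hxV)
  · exact (hg.genBach ht i j).contDiffOn.contDiffAt (V.isOpen.mem_nhds hxV)

/-- The metric `G'` is conformal to `G` on `U` with factor `σ⁻²`. -/
structure IsConformalOn (G G' : Coord n → Matrix (Fin n) (Fin n) ℝ) (σ : Coord n → ℝ)
    (U : Opens (Coord n)) : Prop where
  isMetricOn : IsMetricOn G U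
  smooth : ContDiffOn ℝ ∞ σ U
  pos : ∀ x ∈ U, 0 < σ x
  eq : ∀ x ∈ U, G' x = ((σ x)⁻¹ ^ 2) • G x

variable {σ : Coord n → ℝ}

theorem IsConformalOn.mono (h : IsConformalOn G G' σ U) {V : Opens (Coord n)} (hV : V ≤ U) :
    IsConformalOn G G' σ V :=
  ⟨h.isMetricOn.mono hV, h.smooth.mono hV, fun x hx => h.pos x (hV hx),
    fun x hx => h.eq x (hV hx)⟩

theorem IsConformalOn.isMetricOn' (h : IsConformalOn G G' σ U) : IsMetricOn G' U where
  smooth i j := by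
    refine (((h.smooth.inv fun x hx => (h.pos x hx).ne').pow 2).mul
      (h.isMetricOn.smooth i j)).congr fun x hx => ?_
    rw [h.eq x hx]; rfl
  posDef x hx := by
    rw [h.eq x hx]
    have := h.pos x hx
    exact (h.isMetricOn.posDef x hx).smul (by positivity)

theorem IsConformalOn.inv_eq (h : IsConformalOn G G' σ U) {x : Coord n} (hx : x ∈ U) :
    (G' x)⁻¹ = (σ x ^ 2) • (G x)⁻¹ := by
  have hs := (h.pos x hx).ne'
  refine Matrix.inv_eq_left_inv ?_
  rw [h.eq x hx, Matrix.smul_mul, Matrix.mul_smul, smul_smul,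
    Matrix.nonsing_inv_mul _ (h.isMetricOn.isUnit_det hx)]
  have : σ x ^ 2 * (σ x)⁻¹ ^ 2 = 1 := by field_simp
  rw [this, one_smul]

theorem IsConformalOn.exists_repMetric (h : IsConformalOn G G' σ U) :
    ∃ (g : AlgMetric n (smoothRing U)) (s r : smoothRing U) (hsr : s * r = 1),
      RepMetric G g ∧ Rep σ s ∧ Rep (fun x => (σ x)⁻¹) r ∧ RepMetric G' (g.conf s r hsr) := by
  obtain ⟨g, hg⟩ := h.isMetricOn.exists_repMetric
  obtain ⟨s, hs⟩ := ConformalBach.exists_rep h.smooth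
  obtain ⟨r, hr⟩ := ConformalBach.exists_rep (U := U)
    (h.smooth.inv fun x hx => (h.pos x hx).ne')
  have hsr : s * r = 1 := (hs.mul hr).eq_of_eval (Rep.const 1 |>.of_eq (map_one _))
    fun x hx => mul_inv_cancel₀ (h.pos x hx).ne'
  have hpow : ∀ {F : Coord n → ℝ} {a : smoothRing U}, Rep F a → Rep (fun x => F x ^ 2) (a ^ 2) :=
    fun {F a} ha => ((ha.mul ha).of_eq (pow_two a).symm).congr fun x _ => pow_two _
  refine ⟨g, s, r, hsr, hg, hs, hr, hg.d_eq, fun i j => ?_, fun i j => ?_⟩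
  · exact ((hpow hr).mul (hg.rep_G i j)).congr fun x hx => by rw [h.eq x hx]; rfl
  · exact ((hpow hs).mul (hg.rep_H i j)).congr fun x hx => by rw [ginv, h.inv_eq hx]; rfl

theorem IsConformalOn.weylNull_eq (h : IsConformalOn G G' σ U) (hn : 4 ≤ n) {x : Coord n}
    (hx : x ∈ U) : weylNull G' x = weylNull G x := by
  obtain ⟨g, s, r, hsr, hg, hs, hr, hg'⟩ := h.exists_repMetric
  have h1 : ∀ i j k l, weyl G' x i j k l = (σ x)⁻¹ * (σ x)⁻¹ * weyl G x i j k l :=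
    fun i j k l => (hg'.weyl i j k l).eval_eq ((hr.mul hr).mul (hg.weyl i j k l))
      (by rw [g.conf_weyl s r hsr hn]; ring) hx
  have h0 := (h.pos x hx).ne'
  ext v
  change (∀ j k l, _ = _) ↔ (∀ j k l, _ = _)
  refine forall_congr' fun j => forall_congr' fun k => forall_congr' fun l => ?_
  have : ∑ i, v i * weyl G' x i j k l
      = ((σ x)⁻¹ * (σ x)⁻¹) * ∑ i, v i * weyl G x i j k l := by
    rw [Finset.mul_sum]
    exact Finset.sum_congr rfl fun i _ => by rw [h1]; ring
  rw [this]
  simp [h0]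

/-- The transformation of the one-form `𝕋*`. -/
theorem IsConformalOn.tForm_eq (h : IsConformalOn G G' σ U) (hn : 4 ≤ n) {x : Coord n}
    (hx : x ∈ U) (a : Fin n) : tForm G' x a = tForm G x a
      - (moorePenrose (G x)⁻¹ (ricciWeylSq G x) * ricciWeylSq G x).mulVec
        (fun c => (σ x)⁻¹ * pd c σ x) a := by
  obtain ⟨g, s, r, hsr, hg, hs, hr, hg'⟩ := h.exists_repMetric
  have h0 := (h.pos x hx).ne'
  have hs2 := hs.mul hs
  have hs4 := hs2.mul hs2
  have hM : ricciWeylSq G' x = (σ x ^ 4) • ricciWeylSq G x := by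
    ext b c
    refine ((hg'.ricciWeylSq b c).eval_eq (hs4.mul (hg.ricciWeylSq b c))
      (by rw [g.conf_wsq s r hsr hn]; ring) hx).trans ?_
    rw [Matrix.smul_apply, smul_eq_mul]
    ring
  have hD : ∀ b, weylDivForm G' x b = σ x ^ 4 * (weylDivForm G x b - ((n : ℝ) - 3) *
      (ricciWeylSq G x).mulVec (fun c => (σ x)⁻¹ * pd c σ x) b) := fun b => by
    refine ((hg'.weylDivForm b).eval_eq (hs4.mul ((hg.weylDivForm b).sub
      ((Rep.const ((n : ℝ) - 3)).mul (Rep.sum (s := Finset.univ) fun c =>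
        (hg.ricciWeylSq b c).mul (hr.mul (hg.pd hs c)))))) ?_ hx).trans ?_
    · rw [g.conf_weylDivForm s r hsr hn, g.wsq_eq_sum, map_sub, map_natCast, map_ofNat]
      simp only [AlgMetric.dlog]
      ring
    · simp only [Matrix.mulVec, dotProduct]
      ring
  -- Rescaling the inner product by a positive factor does not affect the Moore-Penrose inverse, and
  -- the factor $\sigma^{-4}$ coming from $\mathfrak w$ cancels the $\sigma^4$ in `hD`.
  have hmp : moorePenrose (G' x)⁻¹ (ricciWeylSq G' x)
      = (σ x ^ 4)⁻¹ • moorePenrose (G x)⁻¹ (ricciWeylSq G x) := by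
    rw [h.inv_eq hx, hM]
    have := h.pos x hx
    exact moorePenrose_smul (h.isMetricOn.posDef_inv hx)
      (ricciWeylSq_selfAdjoint h.isMetricOn hx) (by positivity) (by positivity)
  have hn3 : (n : ℝ) - 3 ≠ 0 := by
    have : (4 : ℝ) ≤ n := by exact_mod_cast hn
    linarith
  rw [tForm, tForm, hmp, ← Matrix.mulVec_mulVec]
  simp only [hD, Matrix.smul_apply, smul_eq_mul]
  generalize (ricciWeylSq G x).mulVec (fun c => (σ x)⁻¹ * pd c σ x) = f
  simp only [Matrix.mulVec, dotProduct, Finset.mul_sum, ← Finset.sum_sub_distrib]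
  refine Finset.sum_congr rfl fun b _ => ?_
  field_simp

/-- Conformal invariance of the generalized Bach tensor in coordinates. -/
theorem IsConformalOn.genBach_eq (h : IsConformalOn G G' σ U) (hn : 4 ≤ n) {x₀ : Coord n}
    (hx₀ : x₀ ∈ U)
    (hr : ∀ᶠ x in 𝓝 x₀, Module.finrank ℝ (weylNull G x) = Module.finrank ℝ (weylNull G x₀))
    (i j : Fin n) : genBach G' x₀ i j = σ x₀ ^ 2 * genBach G x₀ i j := by
  -- Both forms $\mathbb T^*$ have to be smooth on a common neighbourhood to become elements of
  -- `smoothRing`.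
  have hr' : ∀ᶠ x in 𝓝 x₀,
      Module.finrank ℝ (weylNull G' x) = Module.finrank ℝ (weylNull G' x₀) := by
    filter_upwards [hr, U.isOpen.mem_nhds hx₀] with x hx hxU
    rw [h.weylNull_eq hn hxU, h.weylNull_eq hn hx₀, hx]
  obtain ⟨V₁, hVU, hxV, ht⟩ := exists_contDiffOn_tForm h.isMetricOn hx₀ hr
  obtain ⟨V₂, -, hxV', ht'⟩ := exists_contDiffOn_tForm h.isMetricOn' hx₀ hr'
  have hV : V₁ ⊓ V₂ ≤ U := inf_le_left.trans hVU
  have hx : x₀ ∈ V₁ ⊓ V₂ := ⟨hxV, hxV'⟩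
  replace h := h.mono hV
  choose t ht using fun i => exists_rep (U := V₁ ⊓ V₂) ((ht i).mono fun x hx => hx.1)
  choose t' ht' using fun i => exists_rep (U := V₁ ⊓ V₂) ((ht' i).mono fun x hx => hx.2)
  obtain ⟨g, s, r, hsr, hg, hs, hrr, hg'⟩ := h.exists_repMetric
  have hf : ∀ c, Rep (fun x => (σ x)⁻¹ * pd c σ x) (g.dlog s r c) := fun c =>
    hrr.mul (hg.pd hs c)
  have hu := fun c => ((ht' c).sub (ht c)).add (hf c)
  have hnull : ∀ a b c, g.weylContr (fun i => t' i - t i + g.dlog s r i) a b c = 0 :=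
    fun a b c => by
      refine (Rep.sum fun m => (hu m).mul (hg.weylUp m a b c)).eq_of_eval
        ((Rep.const 0).of_eq (map_zero _)) fun x hx => ?_
      have hS := ricciWeylSq_selfAdjoint h.isMetricOn hx
      obtain ⟨hmp, -⟩ := isMoorePenrose_moorePenrose (h.isMetricOn.posDef_inv hx) hS
      set f : Fin n → ℝ := fun c => (σ x)⁻¹ * pd c σ x
      -- The error is $u = f - \mathfrak w^\#\mathfrak w f$, and $\mathfrak w\mathfrak w^\#\mathfrak
      -- w = \mathfrak w$.
      have h1 : (ricciWeylSq G x).mulVec (fun m => tForm G' x m - tForm G x m + f m) = 0 := by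
        have : (fun m => tForm G' x m - tForm G x m + f m) = f - (moorePenrose (G x)⁻¹
            (ricciWeylSq G x) * ricciWeylSq G x).mulVec f := by
          funext m
          rw [h.tForm_eq hn hx, Pi.sub_apply]
          ring
        rw [this, Matrix.mulVec_sub, Matrix.mulVec_mulVec, ← Matrix.mul_assoc, hmp, sub_self]
      have h2 := congrFun ((mulVec_ricciWeylSq_eq_zero_iff h.isMetricOn hx _).1 h1) (a, b, c)
      exact (Finset.sum_congr rfl fun m _ => mul_comm _ _).trans h2
  refine ((hg'.genBach ht' i j).eval_eq ((hs.mul hs).mul (hg.genBach ht i j)) ?_ hx).trans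
    (by ring)
  rw [g.conf_genBach s r hsr hn t t' _ (fun i => by ring) hnull]
  ring

/-- Every term containing $\mathbb T$ carries the factor $n-4$, and $(n-3)/(n-2) = 1/2$ for $n=4$.
-/
theorem genBach_eq_classicalBach {G : Coord 4 → Matrix (Fin 4) (Fin 4) ℝ} (x : Coord 4) :
    genBach G x = classicalBach G x := by
  funext i j
  simp only [genBach, classicalBach]
  norm_num

end Local

/-! ### From charts of the manifold to coordinate metrics -/

theorem eventually_symm_of_eventually {n : ℕ} {M : Type*} [TopologicalSpace M]
    {e : OpenPartialHomeomorph M (Coord n)} {p : M} (hp : p ∈ e.source)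
    {P : Coord n → Prop}
    (h : ∀ᶠ q in 𝓝 p, P (e q)) : ∀ᶠ x in 𝓝 (e p), P x := by
  rwa [← e.map_nhds_eq hp, Filter.eventually_map]

theorem chart_mdifferentiable {n : ℕ} {M : Type*} [TopologicalSpace M]
    [ChartedSpace (Coord n) M] {e : OpenPartialHomeomorph M (Coord n)}
    (he : e ∈ IsManifold.maximalAtlas (𝓡 n) ∞ M) :
    e.MDifferentiable (𝓡 n) (𝓡 n) :=
  ⟨(contMDiffOn_of_mem_maximalAtlas he).mdifferentiableOn (by simp),
    (contMDiffOn_symm_of_mem_maximalAtlas he).mdifferentiableOn (by simp)⟩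

section Manifold

variable {n : ℕ} {M : Type*} [TopologicalSpace M] [ChartedSpace (Coord n) M]
  [IsManifold (𝓡 n) ∞ M] {e : OpenPartialHomeomorph M (Coord n)}

theorem contMDiffOn_coordVec (he : e ∈ IsManifold.maximalAtlas (𝓡 n) ∞ M) (v : Coord n) :
    ContMDiffOn 𝓘(ℝ, Coord n) (𝓡 n).tangent ∞ (fun x => (⟨e.symm x,
      mfderiv (𝓡 n) (𝓡 n) e.symm x v⟩ : TangentBundle (𝓡 n) M)) e.target := by
  have h1 := (contMDiffOn_symm_of_mem_maximalAtlas he).contMDiffOn_tangentMapWithin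
    (m := ∞) (by simp) e.open_target.uniqueMDiffOn
  have h2 : ContMDiff 𝓘(ℝ, Coord n) (𝓡 n).tangent ∞
      (fun x => (⟨x, v⟩ : TangentBundle (𝓡 n) (Coord n))) :=
    contMDiff_vectorSpace_iff_contDiff.2 contDiff_const
  refine (h1.comp h2.contMDiffOn fun x hx => hx).congr fun x hx => ?_
  simp only [Function.comp, tangentMapWithin]
  rw [mfderivWithin_of_isOpen e.open_target hx]

theorem isMetricOn_metricInChart (g : RMetric n M) (he : e ∈ IsManifold.maximalAtlas (𝓡 n) ∞ M) :
    IsMetricOn (metricInChart g e) ⟨e.target, e.open_target⟩ where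
  smooth i j := by
    rw [← contMDiffOn_iff_contDiffOn]
    have hb := contMDiffOn_symm_of_mem_maximalAtlas he
    intro x hx
    -- The coefficient is viewed as a section of the trivial line bundle, so that the smooth bundle
    -- metric can be applied to the two smooth coordinate fields.
    have : ContMDiffWithinAt 𝓘(ℝ, Coord n) ((𝓡 n).prod 𝓘(ℝ)) ∞
        (fun m ↦ TotalSpace.mk' ℝ (E := Bundle.Trivial M ℝ) (e.symm m)
          (metricInChart g e m i j)) e.target x := by
      apply ContMDiffWithinAt.clm_bundle_apply₂ (F₁ := Coord n) (F₂ := Coord n)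
      · exact ContMDiffAt.comp_contMDiffWithinAt x g.contMDiff.contMDiffAt (hb x hx)
      · exact contMDiffOn_coordVec he _ x hx
      · exact contMDiffOn_coordVec he _ x hx
    simp only [contMDiffWithinAt_totalSpace] at this
    exact this.2
  posDef x hx := by
    have hinj := (chart_mdifferentiable he).symm.mfderiv_injective hx
    set D : Coord n →L[ℝ] TangentSpace (𝓡 n) (e.symm x) :=
      mfderiv (𝓡 n) (𝓡 n) e.symm x with hD
    have hM : ∀ i j, metricInChart g e x i j =
        g.inner (e.symm x) (D (EuclideanSpace.single i 1)) (D (EuclideanSpace.single j 1)) :=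
      fun _ _ => rfl
    refine Matrix.PosDef.of_dotProduct_mulVec_pos
      (Matrix.IsHermitian.ext fun i j => by simp [hM, g.symm]) fun v hv => ?_
    -- The quadratic form of the coefficient matrix at `v` is $g(Dw,Dw)$, and $D$ is injective
    -- because the chart is a diffeomorphism.
    set w : Coord n := ∑ i, v i • EuclideanSpace.single i (1 : ℝ) with hw
    have hwv : ∀ i, w i = v i := fun i => by
      simp [hw, Pi.single_apply]
    have hw0 : D w ≠ 0 := by
      intro h
      refine hv (funext fun i => ?_)
      have : w = 0 := hinj (h.trans (map_zero D).symm)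
      rw [← hwv i, this]
      rfl
    have hval : star v ⬝ᵥ (metricInChart g e x).mulVec v = g.inner (e.symm x) (D w) (D w) := by
      simp only [hw, map_sum, map_smul, sum_apply,
        smul_apply, smul_eq_mul, dotProduct, Matrix.mulVec, star_trivial,
        ← hM, Finset.mul_sum]
      exact Finset.sum_comm.trans (Finset.sum_congr rfl fun i _ =>
        Finset.sum_congr rfl fun j _ => by ring)
    rw [hval]
    exact g.pos _ _ hw0

theorem isConformalOn_metricInChart {g g' : RMetric n M} {ψ : M → ℝ}
    (hψ : ContMDiff (𝓡 n) 𝓘(ℝ, ℝ) ∞ ψ) (hψ_pos : ∀ p, 0 < ψ p)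
    (hconf : ∀ (p : M) (v w : TangentSpace (𝓡 n) p),
      g'.inner p v w = (ψ p) ^ (-2 : ℤ) * g.inner p v w)
    (he : e ∈ IsManifold.maximalAtlas (𝓡 n) ∞ M) :
    IsConformalOn (metricInChart g e) (metricInChart g' e) (fun x => ψ (e.symm x))
      ⟨e.target, e.open_target⟩ where
  isMetricOn := isMetricOn_metricInChart g he
  smooth := contMDiffOn_iff_contDiffOn.1
    (hψ.comp_contMDiffOn (contMDiffOn_symm_of_mem_maximalAtlas he))
  pos x _ := hψ_pos _
  eq x _ := by
    ext i j
    simp only [metricInChart, Matrix.of_apply, Matrix.smul_apply, smul_eq_mul, hconf]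
    rw [zpow_neg, inv_pow]
    rfl

theorem constRankSet_eq_of_weylNull_eq {g g' : RMetric n M}
    (h : ∀ x ∈ e.target, weylNull (metricInChart g' e) x = weylNull (metricInChart g e) x) :
    constRankSet g' e = constRankSet g e := by
  ext p
  refine and_congr_right fun hp => ?_
  rw [h _ (e.map_source hp)]
  refine Filter.eventually_congr ?_
  filter_upwards [e.open_source.mem_nhds hp] with q hq
  rw [h _ (e.map_source hq)]

end Manifold

end ConformalBach

end

theorem mainTheorem3 {n : ℕ} (hn : 4 ≤ n) {M : Type*} [TopologicalSpace M]
    [ChartedSpace (EuclideanSpace ℝ (Fin n)) M] [IsManifold (𝓡 n) ∞ M]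
    (g g' : ConformalBach.RMetric n M) (ψ : M → ℝ)
    (hψ : ContMDiff (𝓡 n) 𝓘(ℝ, ℝ) ∞ ψ) (hψ_pos : ∀ p, 0 < ψ p)
    (hconf : ∀ (p : M) (v w : TangentSpace (𝓡 n) p),
      g'.inner p v w = (ψ p) ^ (-2 : ℤ) * g.inner p v w)
    (e : OpenPartialHomeomorph M (EuclideanSpace ℝ (Fin n)))
    (he : e ∈ IsManifold.maximalAtlas (𝓡 n) ∞ M) :
    ConformalBach.constRankSet g' e = ConformalBach.constRankSet g e ∧
    (∀ p ∈ ConformalBach.constRankSet g e,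
      ContDiffAt ℝ ∞ (ConformalBach.tVec (ConformalBach.metricInChart g e)) (e p) ∧
      ContDiffAt ℝ ∞ (ConformalBach.genBach (ConformalBach.metricInChart g e)) (e p)) ∧
    (∀ p ∈ ConformalBach.constRankSet g e, ∀ v w : TangentSpace (𝓡 n) p,
      ConformalBach.genBachAt g' e p v w = (ψ p) ^ 2 * ConformalBach.genBachAt g e p v w) ∧
    (n = 4 → ∀ p ∈ ConformalBach.constRankSet g e, ∀ v w : TangentSpace (𝓡 n) p,
      ConformalBach.genBachAt g e p v w = ConformalBach.classicalBachAt g e p v w) := by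
  have hc := ConformalBach.isConformalOn_metricInChart hψ hψ_pos hconf he
  refine ⟨ConformalBach.constRankSet_eq_of_weylNull_eq fun x hx => hc.weylNull_eq hn hx,
    fun p hp => ConformalBach.contDiffAt_genBach hc.isMetricOn (e.map_source hp.1)
      (ConformalBach.eventually_symm_of_eventually hp.1 hp.2), fun p hp v w => ?_, ?_⟩
  · have hB := hc.genBach_eq hn (e.map_source hp.1)
      (ConformalBach.eventually_symm_of_eventually hp.1 hp.2)
    -- The conformal factor in the chart at `e p` is `ψ (e.symm (e p))`, which is `ψ p`.
    simp only [ConformalBach.genBachAt, ConformalBach.evalInChart, hB, e.left_inv hp.1,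
      Finset.mul_sum, mul_assoc]
  · rintro rfl p - v w
    rw [ConformalBach.genBachAt, ConformalBach.genBach_eq_classicalBach,
      ConformalBach.classicalBachAt]
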